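/- All graphs are simple; unless $\infty$ appears they are finite, and sets of graphs are considered up to isomorphism. $G+H$ is the join, $G\cup H$ the disjoint union, $\infty\cdot G$ the disjoint union of countably many copies of $G$, $\overline{G}$ the complement, $K_{a,\infty}$ the complete bipartite graph with parts of size $a$ and $\aleph_0$, $e(G)$ the number of edges, $\Delta(G)$ the maximum degree. For a family $\mathcal F$ of finite graphs, $G$ is $\mathcal F$-free if it contains no member of $\mathcal F$ as a (not necessarily induced) subgraph; $\mathrm{ex}(n,\mathcal F)$ is the maximum number of edges of an $n$-vertex $\mathcal F$-free graph; $\mathrm{EX}^{B}(n,\mathcal F)$ is the set of graphs with the maximum number of edges among the $n$-vertex $\mathcal F$-free graphs containing a copy of $B$; $\mathrm{SPEX}(n,\mathcal F)$ is the set of $n$-vertex $\mathcal F$-free graphs whose adjacency matrix has the maximum largest eigenvalue. **Theorem 1.1.** Let $\mathcal F$ be a family of graphs and $k\ge 1$ an integer. Suppose that $\mathrm{ex}(n,\mathcal F)=O(n)$, that $K_{k+1,\infty}$ is not $\mathcal F$-free, and that for all large enough $n$ there is a graph $H=H_n\in\mathrm{EX}^{K_{k,n-k}}(n,\mathcal F)$,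 where one of the following holds (the same one for all large $n$): - (a) $H=K_{k,n-k}$; - (b) $H=K_k+\overline{K_{n-k}}$; - (c) $H=K_k+(K_2\cup\overline{K_{n-k-2}})$; - (d) $H=K_k+X$ where $X=X_n$ satisfies $e(X)\le Qn+O(1)$ for some constant $Q\in[0,3/4)$, and $\mathcal F$ is finite; - (e) $H=K_k+X$ where $X=X_n$ satisfies $e(X)\le Qn+O(1)$ for some constant $Q\in[3/4,\infty)$, and $\mathcal F$ is finite; - (f) (e) holds, and for some constant $d$ all but a bounded number (independent of $n$) of vertices of $X$ have degree $d$, and $K_k+(\infty\cdot K_{1,d+1})$ is not $\mathcal F$-free. Then: - If (a), (b) or (c) holds, then for all large enough $n$, $\mathrm{SPEX}(n,\mathcal F)=\{H\}$. - If (d) or (f) holds, then for all large enough $n$, $\mathrm{SPEX}(n,\mathcal F)\subseteq\mathrm{EX}^{K_k+\overline{K_{n-k}}}(n,\mathcal F)$. - If (e) holds, then for all large enough $n$ every graph in $\mathrm{SPEX}(n,\mathcal F)$ is of the form $K_k+Y$, where $e(Y)\ge e(X)-O(n^{1/2})$ and $\Delta(Y)$ is bounded by a constant depending only on $\mathcal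 F$. -/

import Mathlib

open Filter

namespace SpectralTuran

/-- A family of (finite) graphs; each member has vertex set `Fin m` for some `m`, so that up to
isomorphism every family of finite graphs is of this form, and such a family is finite as a set
exactly when it has finitely many members up to isomorphism. -/
abbrev GraphFamily : Type := Set (Σ m : ℕ, SimpleGraph (Fin m))

/-- `G` contains no member of `F` as a (not necessarily induced) subgraph. -/
def FamilyFree (F : GraphFamily) {V : Type*} (G : SimpleGraph V) : Prop :=
  ∀ A ∈ F, A.2.Free G

/-- The number of edges `e(G)`. -/
noncomputable def numEdges {V : Type*} (G : SimpleGraph V) : ℕ := G.edgeSet.ncard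

/-- The degree of a vertex. -/
noncomputable def deg {V : Type*} (G : SimpleGraph V) (v : V) : ℕ := (G.neighborSet v).ncard

/-- The join `G + H`: the disjoint union together with all edges between the two parts. -/
def graphJoin {V W : Type*} (G : SimpleGraph V) (H : SimpleGraph W) : SimpleGraph (V ⊕ W) :=
  (G ⊕g H) ⊔ completeBipartiteGraph V W

/-- The disjoint union of copies of `G`, one for each element of `ι`. -/
def copies (ι : Type*) {V : Type*} (G : SimpleGraph V) : SimpleGraph (ι × V) where
  Adj p q := p.1 = q.1 ∧ G.Adj p.2 q.2
  symm := ⟨fun _ _ h => ⟨h.1.symm, h.2.symm⟩⟩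
  loopless := ⟨fun _ h => G.irrefl h.2⟩

/-- The complete bipartite graph `K_{a,b}`. -/
abbrev Kbip (a b : ℕ) : SimpleGraph (Fin a ⊕ Fin b) := completeBipartiteGraph (Fin a) (Fin b)

/-- The join `K_k + X` of a clique of order `k` with `X`. -/
abbrev cliqueJoin (k : ℕ) {W : Type*} (X : SimpleGraph W) : SimpleGraph (Fin k ⊕ W) :=
  graphJoin (⊤ : SimpleGraph (Fin k)) X

/-- The graph `K_k + (complement of K_{n-k})`, of order `n` when `k ≤ n`. -/
abbrev cliqueJoinEmpty (k n : ℕ) : SimpleGraph (Fin k ⊕ Fin (n - k)) :=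
  cliqueJoin k (⊥ : SimpleGraph (Fin (n - k)))

/-- The graph `K_k + (K_2 ∪ (complement of K_{n-k-2}))`, of order `n` when `k + 2 ≤ n`. -/
abbrev cliqueJoinEdge (k n : ℕ) : SimpleGraph (Fin k ⊕ (Fin 2 ⊕ Fin (n - k - 2))) :=
  cliqueJoin k ((⊤ : SimpleGraph (Fin 2)) ⊕g (⊥ : SimpleGraph (Fin (n - k - 2))))

open scoped Classical in
/-- `λ(G)`, the largest eigenvalue of the adjacency matrix of `G`. -/
noncomputable def lambdaMax {V : Type*} [Fintype V] (G : SimpleGraph V) : ℝ :=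
  sSup (spectrum ℝ (G.adjMatrix ℝ))

/-- `ex(n, F)`, the maximum number of edges of an `F`-free graph of order `n`. -/
noncomputable def ex (F : GraphFamily) (n : ℕ) : ℕ :=
  sSup {e | ∃ G : SimpleGraph (Fin n), FamilyFree F G ∧ numEdges G = e}

/-- `EX^B(n, F)`, the graphs with the maximum number of edges among the `F`-free graphs of
order `n` that contain a copy of `B`. -/
def EXContaining {W : Type*} (B : SimpleGraph W) (F : GraphFamily) (n : ℕ) :
    Set (SimpleGraph (Fin n)) :=
  {G | (FamilyFree F G ∧ B.IsContained G) ∧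
    ∀ G' : SimpleGraph (Fin n), FamilyFree F G' → B.IsContained G' → numEdges G' ≤ numEdges G}

/-- `SPEX(n, F)`, the graphs with the maximum spectral radius among the `F`-free graphs of
order `n`. -/
def SPEX (F : GraphFamily) (n : ℕ) : Set (SimpleGraph (Fin n)) :=
  {G | FamilyFree F G ∧
    ∀ G' : SimpleGraph (Fin n), FamilyFree F G' → lambdaMax G' ≤ lambdaMax G}

/-- The graphs on the vertex set `Fin n` that are isomorphic to `H`. -/
def isoClass {V : Type*} (H : SimpleGraph V) (n : ℕ) : Set (SimpleGraph (Fin n)) :=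
  {G | Nonempty (G ≃g H)}

/-- The graph `H` belongs to the set `S` of graphs of order `n`, up to isomorphism. -/
def MemUpToIso {V : Type*} (H : SimpleGraph V) {n : ℕ} (S : Set (SimpleGraph (Fin n))) : Prop :=
  ∃ G ∈ S, Nonempty (G ≃g H)

/-- For all large `n`, the graph `K_k + X_n` belongs to `EX^{K_{k,n-k}}(n, F)`, and
`e(X_n) ≤ Q n + O(1)`. -/
def JoinExtremal (F : GraphFamily) (k : ℕ) (X : ∀ n : ℕ, SimpleGraph (Fin (n - k))) (Q : ℝ) :
    Prop :=
  (∀ᶠ n : ℕ in atTop, MemUpToIso (cliqueJoin k (X n)) (EXContaining (Kbip k (n - k)) F n)) ∧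
  ∃ C : ℝ, ∀ᶠ n : ℕ in atTop, (numEdges (X n) : ℝ) ≤ Q * n + C

end SpectralTuran

/-!
Let `G` be a graph in `SPEX(n, F)`, with Perron vector `x` of largest entry `1`. Since
`ex(n, F) = O(n)`, subgraphs of `G` are sparse, while `λ(G)` is at least `λ(K_{k,n-k})`, about
`√(k n)`, and any `k + 1` vertices have boundedly many common neighbours. Counting walks with two
edges weighted by `x` then shows that `x` is close to `1` on a set `L` of exactly `k` vertices,
which are adjacent to almost everything, and small elsewhere. Making a vertex outside `L` adjacent
to all of `L`, and to nothing else, gains more in the quadratic form of `x` than it loses, and it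
creates no forbidden graph, because `G` has unused common neighbours of `L` to substitute. Hence
every vertex outside `L` is adjacent to all of `L`, and in cases (a), (b), (c) counting the edges
inside `L` and outside `L` leaves only `H`.

If `F` is finite, then `G = K_k + Y` with `Δ(Y)` bounded, since `K_k` together with a vertex of
large degree in `Y` would play the role of `K_{k+1,m}`. The equation for `λ(K_k + Y)` only involves
the numbers of walks in `Y`, through the Neumann series of `(λ - A_Y)⁻¹`, so `λ(K_k + X) ≤ λ(G)`
yields `e(X) ≤ e(Y) + O(√n)`, and even `e(X) ≤ e(Y)` when `Y` has at most a constant more walks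
with two and with three edges than `X`. The latter holds as soon as almost all edges of `X` have
ends of the same prescribed degrees, and almost all edges of `Y` have ends of no larger degrees. In
case (d), if `T` is one of `K_{1,3}`, `K_3` and the path with three edges, then `K_k + ∞ · T` is not
`F`-free, because a packing of copies of `T` has about `3n/4` edges or more. So almost all
components of `X` and `Y` are isolated vertices, `K_2` or `K_{1,2}`.
-/

namespace SpectralTuran

section AdjacencyForm

variable {V W : Type*}

open Classical in
/-- The adjacency indicator as a real number: the entry of the adjacency matrix, without a
decidability instance in its type. -/
noncomputable def adjInd (G : SimpleGraph V) (u v : V) : ℝ := if G.Adj u v then 1 else 0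

lemma adjInd_of_adj {G : SimpleGraph V} {u v : V} (h : G.Adj u v) : adjInd G u v = 1 :=
  if_pos h

lemma adjInd_of_not_adj {G : SimpleGraph V} {u v : V} (h : ¬ G.Adj u v) : adjInd G u v = 0 :=
  if_neg h

lemma adjInd_nonneg (G : SimpleGraph V) (u v : V) : 0 ≤ adjInd G u v := by
  unfold adjInd; split_ifs <;> norm_num

lemma adjInd_le_one (G : SimpleGraph V) (u v : V) : adjInd G u v ≤ 1 := by
  unfold adjInd; split_ifs <;> norm_num

lemma adjInd_comm (G : SimpleGraph V) (u v : V) : adjInd G u v = adjInd G v u := by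
  by_cases h : G.Adj u v
  · rw [adjInd_of_adj h, adjInd_of_adj h.symm]
  · rw [adjInd_of_not_adj h, adjInd_of_not_adj fun h' => h h'.symm]

lemma adjInd_self (G : SimpleGraph V) (u : V) : adjInd G u u = 0 :=
  adjInd_of_not_adj G.irrefl

lemma adjInd_le_of_imp {G : SimpleGraph V} {H : SimpleGraph W} {u v : V} {u' v' : W}
    (h : G.Adj u v → H.Adj u' v') : adjInd G u v ≤ adjInd H u' v' := by
  by_cases hG : G.Adj u v
  · rw [adjInd_of_adj hG, adjInd_of_adj (h hG)]
  · rw [adjInd_of_not_adj hG]; exact adjInd_nonneg _ _ _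

lemma adjInd_congr {G : SimpleGraph V} {H : SimpleGraph W} {u v : V} {u' v' : W}
    (h : G.Adj u v ↔ H.Adj u' v') : adjInd G u v = adjInd H u' v' :=
  le_antisymm (adjInd_le_of_imp h.1) (adjInd_le_of_imp h.2)

variable [Fintype V] [Fintype W]

/-- The action of the adjacency matrix on functions: the sum of a function over the neighbours
of a vertex. -/
noncomputable def nbrSum (G : SimpleGraph V) (f : V → ℝ) (v : V) : ℝ := ∑ u, adjInd G v u * f u

/-- The quadratic form `xᵀ A x` of the adjacency matrix `A`. -/
noncomputable def quadForm (G : SimpleGraph V) (x : V → ℝ) : ℝ :=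
  ∑ u, ∑ v, adjInd G u v * x u * x v

open Classical in
lemma adjMatrix_mulVec_eq_nbrSum (G : SimpleGraph V) (f : V → ℝ) :
    (G.adjMatrix ℝ).mulVec f = nbrSum G f := by
  ext v
  simp [Matrix.mulVec, dotProduct, nbrSum, adjInd, SimpleGraph.adjMatrix_apply]

lemma quadForm_eq_sum_mul_nbrSum (G : SimpleGraph V) (x : V → ℝ) :
    quadForm G x = ∑ v, x v * nbrSum G x v := by
  simp only [quadForm, nbrSum, Finset.mul_sum]
  exact Finset.sum_congr rfl fun u _ => Finset.sum_congr rfl fun v _ => by ring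

lemma sum_nbrSum_mul_comm (G : SimpleGraph V) (f g : V → ℝ) :
    ∑ v, nbrSum G f v * g v = ∑ v, f v * nbrSum G g v := by
  simp only [nbrSum, Finset.sum_mul, Finset.mul_sum]
  rw [Finset.sum_comm]
  exact Finset.sum_congr rfl fun u _ => Finset.sum_congr rfl fun v _ => by
    rw [adjInd_comm]; ring

lemma quadForm_eq_mul_sum_sq {G : SimpleGraph V} {x : V → ℝ} {μ : ℝ}
    (h : ∀ v, nbrSum G x v = μ * x v) : quadForm G x = μ * ∑ v, x v ^ 2 := by
  rw [quadForm_eq_sum_mul_nbrSum, Finset.mul_sum]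
  exact Finset.sum_congr rfl fun v _ => by rw [h]; ring

lemma quadForm_le_quadForm_abs (G : SimpleGraph V) (x : V → ℝ) :
    quadForm G x ≤ quadForm G fun v => |x v| := by
  refine Finset.sum_le_sum fun u _ => Finset.sum_le_sum fun v _ => ?_
  rw [mul_assoc, mul_assoc, ← abs_mul]
  exact mul_le_mul_of_nonneg_left (le_abs_self _) (adjInd_nonneg G u v)

end AdjacencyForm

section LargestEigenvalue

variable {V W : Type*} [Fintype V] [Fintype W]

open Classical in
lemma isGreatest_lambdaMax [Nonempty V] (G : SimpleGraph V) :
    IsGreatest (spectrum ℝ (G.adjMatrix ℝ)) (lambdaMax G) := by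
  have hs := (G.isHermitian_adjMatrix ℝ).spectrum_real_eq_range_eigenvalues
  rw [lambdaMax, congrArg sSup hs, hs]
  have hfin := Set.finite_range (G.isHermitian_adjMatrix ℝ).eigenvalues
  exact ⟨(Set.range_nonempty _).csSup_mem hfin, fun _ => le_csSup hfin.bddAbove⟩

open Classical in
lemma posSemidef_lambdaMax_sub [Nonempty V] (G : SimpleGraph V) :
    (lambdaMax G • (1 : Matrix V V ℝ) - G.adjMatrix ℝ).PosSemidef := by
  refine Matrix.posSemidef_iff_isHermitian_and_spectrum_nonneg.2
    ⟨(Matrix.isHermitian_one.smul (IsSelfAdjoint.all _)).sub (G.isHermitian_adjMatrix ℝ), ?_⟩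
  rw [← Algebra.algebraMap_eq_smul_one, ← spectrum.singleton_sub_eq]
  rintro _ ⟨_, rfl, μ, hμ, rfl⟩
  exact sub_nonneg.2 ((isGreatest_lambdaMax G).2 hμ)

open Classical in
lemma dotProduct_lambdaMax_sub_mulVec (G : SimpleGraph V) (x : V → ℝ) :
    dotProduct (star x) ((lambdaMax G • (1 : Matrix V V ℝ) - G.adjMatrix ℝ).mulVec x)
      = lambdaMax G * ∑ v, x v ^ 2 - quadForm G x := by
  rw [Matrix.sub_mulVec, adjMatrix_mulVec_eq_nbrSum, Matrix.smul_mulVec, Matrix.one_mulVec,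
    quadForm_eq_sum_mul_nbrSum, Finset.mul_sum, ← Finset.sum_sub_distrib]
  refine Finset.sum_congr rfl fun v _ => ?_
  simp only [star_trivial, Pi.sub_apply, Pi.smul_apply, smul_eq_mul]
  ring

lemma quadForm_le_lambdaMax_mul [Nonempty V] (G : SimpleGraph V) (x : V → ℝ) :
    quadForm G x ≤ lambdaMax G * ∑ v, x v ^ 2 := by
  classical
  rw [← sub_nonneg, ← dotProduct_lambdaMax_sub_mulVec]
  exact (posSemidef_lambdaMax_sub G).dotProduct_mulVec_nonneg x

lemma nbrSum_eq_of_lambdaMax_mul_le_quadForm [Nonempty V] (G : SimpleGraph V) (x : V → ℝ)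
    (h : lambdaMax G * ∑ v, x v ^ 2 ≤ quadForm G x) (v : V) :
    nbrSum G x v = lambdaMax G * x v := by
  classical
  have hker := ((posSemidef_lambdaMax_sub G).dotProduct_mulVec_zero_iff x).1 (by
    rw [dotProduct_lambdaMax_sub_mulVec]; linarith [quadForm_le_lambdaMax_mul G x])
  rw [Matrix.sub_mulVec, adjMatrix_mulVec_eq_nbrSum, Matrix.smul_mulVec, Matrix.one_mulVec,
    sub_eq_zero] at hker
  exact (congrFun hker v).symm

lemma exists_eigenvector_lambdaMax [Nonempty V] (G : SimpleGraph V) :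
    ∃ x : V → ℝ, (∃ v, x v ≠ 0) ∧ ∀ v, nbrSum G x v = lambdaMax G * x v := by
  classical
  have hA := G.isHermitian_adjMatrix ℝ
  obtain ⟨i, hi⟩ : lambdaMax G ∈ Set.range hA.eigenvalues :=
    hA.spectrum_real_eq_range_eigenvalues ▸ (isGreatest_lambdaMax G).1
  refine ⟨(hA.eigenvectorBasis i).ofLp, ?_, fun v => ?_⟩
  · by_contra! hzero
    exact hA.eigenvectorBasis.orthonormal.ne_zero i (by ext v; exact hzero v)
  · have heig := hA.mulVec_eigenvectorBasis i
    rw [hi, adjMatrix_mulVec_eq_nbrSum] at heig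
    exact congrFun heig v

/-- A Perron vector: a nonnegative eigenvector for the largest eigenvalue, scaled so that its
largest entry is `1`. -/
structure IsPerron (G : SimpleGraph V) (x : V → ℝ) : Prop where
  eigen : ∀ v, nbrSum G x v = lambdaMax G * x v
  nonneg : ∀ v, 0 ≤ x v
  le_one : ∀ v, x v ≤ 1
  exists_eq_one : ∃ z, x z = 1

lemma exists_isPerron [Nonempty V] (G : SimpleGraph V) : ∃ x, IsPerron G x := by
  obtain ⟨e, ⟨v₀, hv₀⟩, he⟩ := exists_eigenvector_lambdaMax G
  have habs : ∀ v, nbrSum G (fun v => |e v|) v = lambdaMax G * |e v| := by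
    refine nbrSum_eq_of_lambdaMax_mul_le_quadForm G _ ?_
    simp only [sq_abs]
    exact (quadForm_eq_mul_sum_sq he).symm.trans_le (quadForm_le_quadForm_abs G e)
  obtain ⟨z, -, hz⟩ := Finset.exists_max_image Finset.univ (fun v => |e v|) Finset.univ_nonempty
  have hzpos : 0 < |e z| := (abs_pos.2 hv₀).trans_le (hz v₀ (Finset.mem_univ _))
  refine ⟨fun v => |e v| / |e z|, fun v => ?_, fun v => by positivity,
    fun v => (div_le_one hzpos).2 (hz v (Finset.mem_univ _)), z, div_self hzpos.ne'⟩
  rw [← mul_div_assoc, ← habs, nbrSum, nbrSum, Finset.sum_div]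
  exact Finset.sum_congr rfl fun u _ => (mul_div_assoc _ _ _).symm

lemma IsPerron.sum_sq_pos {G : SimpleGraph V} {x : V → ℝ} (h : IsPerron G x) :
    0 < ∑ v, x v ^ 2 := by
  obtain ⟨z, hz⟩ := h.exists_eq_one
  exact Finset.sum_pos' (fun v _ => sq_nonneg _) ⟨z, Finset.mem_univ _, by rw [hz]; norm_num⟩

lemma quadForm_le_quadForm_extend {G : SimpleGraph V} {H : SimpleGraph W} (f : G.Copy H)
    {x : V → ℝ} (hx : ∀ v, 0 ≤ x v) : quadForm G x ≤ quadForm H (Function.extend f x 0) := by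
  set y := Function.extend f x 0
  have hyf (v : V) : y (f v) = x v := f.injective.extend_apply _ _ _
  have hy0 (w : W) (hw : w ∉ Set.range f) : y w = 0 := Function.extend_apply' _ _ _ hw
  calc quadForm G x
      ≤ ∑ u, ∑ v, adjInd H (f u) (f v) * y (f u) * y (f v) := by
        refine Finset.sum_le_sum fun u _ => Finset.sum_le_sum fun v _ => ?_
        rw [hyf, hyf]
        have hadj : adjInd G u v ≤ adjInd H (f u) (f v) := adjInd_le_of_imp f.toHom.map_adj
        exact mul_le_mul_of_nonneg_right (mul_le_mul_of_nonneg_right hadj (hx _)) (hx _)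
    _ = ∑ u, ∑ w, adjInd H (f u) w * y (f u) * y w :=
        Finset.sum_congr rfl fun u _ => Fintype.sum_of_injective f f.injective _
          (fun w => adjInd H (f u) w * y (f u) * y w) (fun w hw => by simp [hy0 w hw])
          fun _ => rfl
    _ = quadForm H y :=
        Fintype.sum_of_injective f f.injective _ (fun u => ∑ w, adjInd H u w * y u * y w)
          (fun w hw => by simp [hy0 w hw]) fun _ => rfl

lemma lambdaMax_le_of_isContained [Nonempty V] {G : SimpleGraph V} {H : SimpleGraph W}
    (h : G.IsContained H) : lambdaMax G ≤ lambdaMax H := by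
  obtain ⟨f⟩ := h
  have : Nonempty W := (inferInstance : Nonempty V).map f
  obtain ⟨x, hx⟩ := exists_isPerron G
  set y := Function.extend f x 0
  have hnorm : ∑ v, x v ^ 2 = ∑ w, y w ^ 2 :=
    Fintype.sum_of_injective f f.injective _ _
      (fun w hw => by
        rw [show y w = 0 from Function.extend_apply' _ _ _ hw, zero_pow two_ne_zero])
      fun v => by rw [show y (f v) = x v from f.injective.extend_apply _ _ _]
  refine le_of_mul_le_mul_right ?_ hx.sum_sq_pos
  calc lambdaMax G * ∑ v, x v ^ 2 = quadForm G x := (quadForm_eq_mul_sum_sq hx.eigen).symm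
    _ ≤ quadForm H y := quadForm_le_quadForm_extend f hx.nonneg
    _ ≤ lambdaMax H * ∑ v, x v ^ 2 := hnorm ▸ quadForm_le_lambdaMax_mul H y

lemma lambdaMax_congr [Nonempty V] {G : SimpleGraph V} {H : SimpleGraph W}
    (e : G ≃g H) : lambdaMax G = lambdaMax H := by
  have : Nonempty W := (inferInstance : Nonempty V).map e
  exact le_antisymm (lambdaMax_le_of_isContained e.isContained)
    (lambdaMax_le_of_isContained e.symm.isContained)

lemma IsPerron.congr {G : SimpleGraph V} {H : SimpleGraph W} (e : H ≃g G) {x : V → ℝ}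
    (h : IsPerron G x) : IsPerron H (x ∘ e) := by
  obtain ⟨z, hz⟩ := h.exists_eq_one
  have : Nonempty V := ⟨z⟩
  refine ⟨fun w => ?_, fun w => h.nonneg _, fun w => h.le_one _, e.symm z, by simpa using hz⟩
  rw [← lambdaMax_congr e.symm, Function.comp_apply, ← h.eigen]
  exact Fintype.sum_equiv e.toEquiv _ _ fun v => by
    simp [adjInd_congr (e.map_adj_iff (v := w) (w := v))]

lemma sqrt_mul_le_lambdaMax_Kbip {k m : ℕ} (hk : 1 ≤ k) (hm : 1 ≤ m) :
    √(k * m) ≤ lambdaMax (Kbip k m) := by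
  have : Nonempty (Fin k ⊕ Fin m) := ⟨Sum.inl ⟨0, hk⟩⟩
  set x : Fin k ⊕ Fin m → ℝ := Sum.elim (fun _ => √m) (fun _ => √k) with hx
  have hnorm : ∑ v, x v ^ 2 = 2 * (k * m) := by
    simp [hx, Fintype.sum_sum_type, Real.sq_sqrt]; ring
  have hform : quadForm (Kbip k m) x = 2 * (k * m) * √(k * m) := by
    simp [quadForm, hx, Fintype.sum_sum_type, adjInd]
    ring
  have hle := quadForm_le_lambdaMax_mul (Kbip k m) x
  rw [hnorm, hform, mul_comm] at hle
  exact le_of_mul_le_mul_right hle (by norm_cast; positivity)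

end LargestEigenvalue

section Counting

variable {V W : Type*}

lemma numEdges_congr {G : SimpleGraph V} {H : SimpleGraph W} (e : G ≃g H) :
    numEdges G = numEdges H :=
  Nat.card_congr e.mapEdgeSet

lemma numEdges_le_of_isContained [Finite W] {G : SimpleGraph V} {H : SimpleGraph W}
    (h : G.IsContained H) : numEdges G ≤ numEdges H := by
  obtain ⟨f⟩ := h
  exact Nat.card_le_card_of_injective _ f.mapEdgeSet.injective

lemma numEdges_bot : numEdges (⊥ : SimpleGraph V) = 0 := by simp [numEdges]

lemma eq_bot_of_numEdges_eq_zero [Finite V] {A : SimpleGraph V} (h : numEdges A = 0) : A = ⊥ :=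
  SimpleGraph.edgeSet_eq_empty.1 ((Set.ncard_eq_zero A.edgeSet.toFinite).1 h)

lemma numEdges_sup [Finite V] {A B : SimpleGraph V} (h : Disjoint A B) :
    numEdges (A ⊔ B) = numEdges A + numEdges B := by
  rw [numEdges, SimpleGraph.edgeSet_sup]
  exact Set.ncard_union_eq (SimpleGraph.disjoint_edgeSet.2 h)

lemma FamilyFree.of_isContained {F : GraphFamily} {G : SimpleGraph V} {H : SimpleGraph W}
    (hH : FamilyFree F H) (h : G.IsContained H) : FamilyFree F G :=
  fun A hA hAG => hH A hA (hAG.trans h)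

lemma FamilyFree.congr {F : GraphFamily} {G : SimpleGraph V} {H : SimpleGraph W}
    (e : G ≃g H) : FamilyFree F G ↔ FamilyFree F H :=
  ⟨fun h => h.of_isContained e.symm.isContained, fun h => h.of_isContained e.isContained⟩

variable [Fintype V]

open Classical in
lemma deg_eq_degree (G : SimpleGraph V) (v : V) : deg G v = G.degree v := by
  rw [deg, Set.ncard_eq_toFinset_card', ← SimpleGraph.card_neighborFinset_eq_degree]; rfl

open Classical in
lemma numEdges_eq_card_edgeFinset (G : SimpleGraph V) : numEdges G = G.edgeFinset.card := by
  rw [numEdges, Set.ncard_eq_toFinset_card']; rfl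

lemma sum_adjInd_eq_deg (G : SimpleGraph V) (v : V) : ∑ u, adjInd G v u = deg G v := by
  classical
  rw [deg_eq_degree, SimpleGraph.degree_eq_sum_if_adj]
  rfl

lemma sum_deg_eq (G : SimpleGraph V) : ∑ v, (deg G v : ℝ) = 2 * numEdges G := by
  classical
  simp only [deg_eq_degree, numEdges_eq_card_edgeFinset]
  exact_mod_cast G.sum_degrees_eq_twice_card_edges

lemma sum_sum_adjInd (G : SimpleGraph V) : ∑ u, ∑ v, adjInd G u v = 2 * numEdges G := by
  simp only [sum_adjInd_eq_deg, sum_deg_eq]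

end Counting

section EdgesBetween

variable {V : Type*} {G : SimpleGraph V}

/-- The number `e(A, B)` of edges between two sets of vertices; the edges inside `A ∩ B` are
counted twice. -/
noncomputable def edgeCount (G : SimpleGraph V) (A B : Finset V) : ℝ :=
  ∑ u ∈ A, ∑ v ∈ B, adjInd G u v

lemma edgeCount_nonneg (A B : Finset V) : 0 ≤ edgeCount G A B :=
  Finset.sum_nonneg fun _ _ => Finset.sum_nonneg fun _ _ => adjInd_nonneg _ _ _

lemma edgeCount_mono {A A' B B' : Finset V} (hA : A ⊆ A') (hB : B ⊆ B') :
    edgeCount G A B ≤ edgeCount G A' B' :=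
  (Finset.sum_le_sum fun _ _ => Finset.sum_le_sum_of_subset_of_nonneg hB fun _ _ _ =>
    adjInd_nonneg _ _ _).trans <| Finset.sum_le_sum_of_subset_of_nonneg hA fun _ _ _ =>
    Finset.sum_nonneg fun _ _ => adjInd_nonneg _ _ _

lemma edgeCount_le_card_mul_card (A B : Finset V) : edgeCount G A B ≤ A.card * B.card := by
  calc edgeCount G A B ≤ ∑ _u ∈ A, ∑ _v ∈ B, (1 : ℝ) :=
        Finset.sum_le_sum fun u _ => Finset.sum_le_sum fun v _ => adjInd_le_one G u v
    _ = A.card * B.card := by simp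

lemma edgeCount_sdiff_add [DecidableEq V] {B B' : Finset V} (h : B ⊆ B') (A : Finset V) :
    edgeCount G A (B' \ B) + edgeCount G A B = edgeCount G A B' := by
  simp only [edgeCount, ← Finset.sum_add_distrib, Finset.sum_sdiff h]

lemma sum_adjInd_mul [Fintype V] [DecidableEq V] [DecidableRel G.Adj] (f : V → ℝ)
    (U : Finset V) (v : V) :
    ∑ u ∈ U, adjInd G v u * f u = ∑ u ∈ G.neighborFinset v ∩ U, f u := by
  rw [Finset.inter_comm, ← Finset.filter_mem_eq_inter, Finset.sum_filter]
  refine Finset.sum_congr rfl fun u _ => ?_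
  by_cases h : G.Adj v u <;> simp [adjInd, h]

lemma sum_adjInd_eq_card [Fintype V] [DecidableEq V] [DecidableRel G.Adj] (U : Finset V)
    (v : V) : ∑ u ∈ U, adjInd G v u = (G.neighborFinset v ∩ U).card := by
  simpa using sum_adjInd_mul (G := G) (fun _ => 1) U v

lemma card_neighborFinset_eq_deg [Fintype V] [DecidableRel G.Adj] (v : V) :
    (G.neighborFinset v).card = deg G v := by
  rw [deg, Set.ncard_eq_toFinset_card']; rfl

lemma sum_sum_adjInd_mul_le {x : V → ℝ} {η : ℝ} (A B : Finset V) (h : ∀ w ∈ B, x w ≤ η) :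
    ∑ u ∈ A, ∑ w ∈ B, adjInd G u w * x w ≤ η * edgeCount G A B := by
  simp only [edgeCount, Finset.mul_sum]
  refine Finset.sum_le_sum fun u _ => Finset.sum_le_sum fun w hw => ?_
  rw [mul_comm]
  exact mul_le_mul_of_nonneg_right (h w hw) (adjInd_nonneg _ _ _)

end EdgesBetween

section Sparsity

variable {V W : Type*}

/-- Every set `U` of vertices spans at most `C |U|` edges. -/
def Sparse (C : ℝ) (G : SimpleGraph V) : Prop :=
  ∀ U : Finset V, edgeCount G U U ≤ 2 * C * U.card

/-- Any `k + 1` vertices have fewer than `m` common neighbours. -/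
def NoBip (k m : ℕ) (G : SimpleGraph V) : Prop :=
  ∀ T S : Finset V, T.card = k + 1 → (∀ t ∈ T, ∀ s ∈ S, G.Adj t s) → S.card < m

lemma Sparse.edgeCount_le {C : ℝ} {G : SimpleGraph V} (hS : Sparse C G) (hC : 0 ≤ C)
    (A B : Finset V) :
    edgeCount G A B ≤ 2 * C * (A.card + B.card) := by
  classical
  calc edgeCount G A B ≤ edgeCount G (A ∪ B) (A ∪ B) :=
        edgeCount_mono Finset.subset_union_left Finset.subset_union_right
    _ ≤ 2 * C * (A ∪ B).card := hS _
    _ ≤ 2 * C * (A.card + B.card) := by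
      gcongr
      exact_mod_cast Finset.card_union_le A B

lemma numEdges_le_ex {F : GraphFamily} {n : ℕ} {G : SimpleGraph (Fin n)} (h : FamilyFree F G) :
    numEdges G ≤ ex F n := by
  refine le_csSup ((Set.finite_range (numEdges (V := Fin n))).bddAbove.mono ?_) ⟨G, h, rfl⟩
  rintro _ ⟨G, -, rfl⟩
  exact ⟨G, rfl⟩

lemma two_mul_numEdges_le_sq {n : ℕ} (G : SimpleGraph (Fin n)) :
    2 * (numEdges G : ℝ) ≤ n * n := by
  simpa [← sum_sum_adjInd, edgeCount] using
    edgeCount_le_card_mul_card (G := G) Finset.univ Finset.univ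

lemma exists_numEdges_le_mul {F : GraphFamily}
    (hex : (fun n : ℕ => (ex F n : ℝ)) =O[atTop] (fun n : ℕ => (n : ℝ))) :
    ∃ C : ℝ, 1 ≤ C ∧ ∀ (n : ℕ) (G : SimpleGraph (Fin n)), FamilyFree F G →
      (numEdges G : ℝ) ≤ C * n := by
  obtain ⟨c, hc⟩ := hex.bound
  obtain ⟨N, hN⟩ := eventually_atTop.1 hc
  refine ⟨max 1 (max c N), le_max_left _ _, fun n G hG => ?_⟩
  rcases le_or_gt N n with hle | hlt
  · have hexn : (ex F n : ℝ) ≤ c * n := by simpa only [Real.norm_natCast] using hN n hle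
    calc (numEdges G : ℝ) ≤ ex F n := by exact_mod_cast numEdges_le_ex hG
      _ ≤ c * n := hexn
      _ ≤ max 1 (max c N) * n := by gcongr; exact (le_max_left _ _).trans (le_max_right _ _)
  · calc (numEdges G : ℝ) ≤ n * n := by
          linarith [two_mul_numEdges_le_sq G, Nat.cast_nonneg (α := ℝ) (numEdges G)]
      _ ≤ N * n := by gcongr
      _ ≤ max 1 (max c N) * n := by gcongr; exact (le_max_right _ _).trans (le_max_right _ _)

lemma exists_sparse {F : GraphFamily}
    (hex : (fun n : ℕ => (ex F n : ℝ)) =O[atTop] (fun n : ℕ => (n : ℝ))) :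
    ∃ C : ℝ, 1 ≤ C ∧ ∀ (V : Type) (G : SimpleGraph V), FamilyFree F G → Sparse C G := by
  classical
  obtain ⟨C, hC, hmul⟩ := exists_numEdges_le_mul hex
  refine ⟨C, hC, fun V G hG U => ?_⟩
  have hcard : Fintype.card U = U.card := Fintype.card_coe U
  have e : G.induce (U : Set V) ≃g (G.induce (U : Set V)).overFin hcard :=
    (G.induce (U : Set V)).overFinIso hcard
  have hfree : FamilyFree F ((G.induce (U : Set V)).overFin hcard) :=
    hG.of_isContained (e.symm.isContained.trans
      (SimpleGraph.Embedding.induce (G := G) (U : Set V)).isContained)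
  have hcount : edgeCount G U U = 2 * numEdges (G.induce (U : Set V)) := by
    rw [edgeCount, ← sum_sum_adjInd, ← Finset.sum_coe_sort U]
    refine Finset.sum_congr rfl fun u _ => ?_
    rw [← Finset.sum_coe_sort U]
    exact Finset.sum_congr rfl fun v _ => by simp [adjInd]
  rw [hcount, numEdges_congr e, mul_assoc]
  gcongr
  exact hmul _ _ hfree

lemma NoBip.of_free {k m : ℕ} {G : SimpleGraph V} (h : (Kbip (k + 1) m).Free G) :
    NoBip k m G := by
  intro T S hT hTS
  by_contra! hm
  obtain ⟨S', hS', hcard⟩ := Finset.exists_subset_card_eq hm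
  exact h (SimpleGraph.completeBipartiteGraph_isContained_iff.2
    ⟨T, S', by simpa using hT, by simpa using hcard, fun t ht s hs => hTS t ht s (hS' hs)⟩)

lemma isContained_Kbip_of_isContained_nat {a : ℕ} {A : SimpleGraph W} [Finite W]
    (h : A.IsContained (completeBipartiteGraph (Fin a) ℕ)) :
    ∃ m, A.IsContained (Kbip a m) := by
  obtain ⟨f⟩ := h
  obtain ⟨M, hM⟩ := (Set.finite_range fun i => Sum.elim (fun _ => 0) id (f i)).bddAbove
  have hle {i : W} {j : ℕ} (hij : f i = Sum.inr j) : j < M + 1 :=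
    Nat.lt_succ_of_le (by simpa [hij] using hM ⟨i, rfl⟩)
  refine ⟨M + 1, ⟨⟨⟨fun i => (f i).map id (Fin.ofNat (M + 1)), fun {u v} huv => ?_⟩,
    fun u v huv => f.injective ?_⟩⟩⟩
  · have hadj : (completeBipartiteGraph (Fin a) ℕ).Adj (f u) (f v) := f.toHom.map_adj huv
    simpa using hadj
  · change (f u).map id (Fin.ofNat (M + 1)) = (f v).map id (Fin.ofNat (M + 1)) at huv
    change f u = f v
    rcases hu : f u with i | i <;> rcases hv : f v with j | j <;> rw [hu, hv] at huv
    · simpa using huv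
    · simp at huv
    · simp at huv
    · rw [Sum.map_inr, Sum.map_inr, Sum.inr.injEq, Fin.ext_iff] at huv
      simpa [Nat.mod_eq_of_lt (hle hu), Nat.mod_eq_of_lt (hle hv)] using huv

lemma exists_noBip {F : GraphFamily} {k : ℕ}
    (hK : ¬ FamilyFree F (completeBipartiteGraph (Fin (k + 1)) ℕ)) :
    ∃ m : ℕ, ∀ (V : Type) (G : SimpleGraph V), FamilyFree F G → NoBip k m G := by
  simp only [FamilyFree, not_forall, SimpleGraph.Free, not_not] at hK
  obtain ⟨A, hA, hAK⟩ := hK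
  obtain ⟨m, hm⟩ := isContained_Kbip_of_isContained_nat hAK
  exact ⟨m, fun V G hG => NoBip.of_free fun h => hG A hA (hm.trans h)⟩

lemma NoBip.congr {k m : ℕ} {G : SimpleGraph V} {H : SimpleGraph W} (e : G ≃g H)
    (h : NoBip k m G) : NoBip k m H := by
  intro T S hT hTS
  rw [← Finset.card_map e.symm.toEquiv.toEmbedding]
  refine h (T.map e.symm.toEquiv.toEmbedding) _ (by rw [Finset.card_map, hT]) ?_
  simp only [Finset.mem_map]
  rintro _ ⟨t, ht, rfl⟩ _ ⟨s, hs, rfl⟩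
  exact e.symm.map_adj_iff.2 (hTS t ht s hs)

end Sparsity

section CommonNeighbours

variable {V : Type*} [Fintype V] {G : SimpleGraph V} {k m : ℕ}

open Classical in
/-- The common neighbours of the vertices of `L`. -/
noncomputable def commonNb (G : SimpleGraph V) (L : Finset V) : Finset V :=
  Finset.univ.filter fun v => ∀ l ∈ L, G.Adj l v

open Classical in
/-- The vertices outside `L` that miss some vertex of `L`. -/
noncomputable def exceptional (G : SimpleGraph V) (L : Finset V) : Finset V :=
  Finset.univ.filter fun v => v ∉ L ∧ ∃ l ∈ L, ¬ G.Adj l v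

lemma mem_commonNb {L : Finset V} {v : V} : v ∈ commonNb G L ↔ ∀ l ∈ L, G.Adj l v := by
  simp [commonNb]

lemma notMem_of_mem_commonNb {L : Finset V} {v : V} (h : v ∈ commonNb G L) : v ∉ L :=
  fun hv => G.irrefl (mem_commonNb.1 h v hv)

lemma mem_exceptional {L : Finset V} {v : V} :
    v ∈ exceptional G L ↔ v ∉ L ∧ v ∉ commonNb G L := by simp [exceptional, commonNb]

lemma NoBip.card_commonNb_lt (hB : NoBip k m G) {T : Finset V} (hT : T.card = k + 1) :
    (commonNb G T).card < m :=
  hB T _ hT fun t ht _ hs => mem_commonNb.1 hs t ht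

lemma NoBip.card_inter_commonNb_lt [DecidableEq V] [DecidableRel G.Adj] (hB : NoBip k m G)
    {L : Finset V} (hL : L.card = k) {v : V} (hv : v ∉ L) :
    (G.neighborFinset v ∩ commonNb G L).card < m := by
  refine hB (insert v L) _ (by rw [Finset.card_insert_of_notMem hv, hL]) fun t ht s hs => ?_
  rw [Finset.mem_inter, SimpleGraph.mem_neighborFinset, mem_commonNb] at hs
  rcases Finset.mem_insert.1 ht with rfl | ht
  · exact hs.1
  · exact hs.2 t ht

lemma card_compl_commonNb_le [DecidableEq V] {L : Finset V} {b : ℝ}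
    (h : ∀ l ∈ L, Fintype.card V - b ≤ (deg G l : ℝ)) :
    ((commonNb G L)ᶜ.card : ℝ) ≤ L.card * b := by
  classical
  have hsub : (commonNb G L)ᶜ ⊆ L.biUnion fun l => (G.neighborFinset l)ᶜ := by
    intro v hv
    simpa [mem_commonNb] using hv
  have hcompl (l : V) : ((G.neighborFinset l)ᶜ.card : ℝ) = Fintype.card V - deg G l := by
    rw [eq_sub_iff_add_eq', ← card_neighborFinset_eq_deg]
    exact_mod_cast Finset.card_add_card_compl (G.neighborFinset l)
  calc ((commonNb G L)ᶜ.card : ℝ)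
      ≤ ∑ l ∈ L, ((G.neighborFinset l)ᶜ.card : ℝ) := by
        exact_mod_cast (Finset.card_le_card hsub).trans Finset.card_biUnion_le
    _ ≤ ∑ _l ∈ L, b := Finset.sum_le_sum fun l hl => by rw [hcompl]; linarith [h l hl]
    _ = L.card * b := by simp

lemma card_exceptional_le {L : Finset V} {b : ℝ}
    (h : ∀ l ∈ L, Fintype.card V - b ≤ (deg G l : ℝ)) :
    ((exceptional G L).card : ℝ) ≤ L.card * b := by
  classical
  refine le_trans ?_ (card_compl_commonNb_le h)
  exact_mod_cast Finset.card_le_card fun v hv => Finset.mem_compl.2 (mem_exceptional.1 hv).2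

lemma NoBip.card_le_of_forall_le_deg (hB : NoBip k m G) {L : Finset V} {b : ℝ}
    (h : ∀ l ∈ L, Fintype.card V - b ≤ (deg G l : ℝ)) (hb : (k + 1) * b + m ≤ Fintype.card V) :
    L.card ≤ k := by
  classical
  by_contra! hgt
  obtain ⟨T, hTL, hT⟩ := Finset.exists_subset_card_eq (Nat.succ_le_of_lt hgt)
  have hfew : ((commonNb G T).card : ℝ) < m := by exact_mod_cast hB.card_commonNb_lt hT
  have hmany : ((commonNb G T)ᶜ.card : ℝ) ≤ (k + 1) * b := by
    simpa [hT] using card_compl_commonNb_le fun t ht => h t (hTL ht)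
  have hadd : ((commonNb G T).card : ℝ) + (commonNb G T)ᶜ.card = Fintype.card V := by
    exact_mod_cast Finset.card_add_card_compl _
  linarith

lemma NoBip.card_filter_le [DecidableEq V] [DecidableRel G.Adj] (hB : NoBip k m G)
    (U : Finset V) :
    (Finset.univ.filter fun u => k < (G.neighborFinset u ∩ U).card).card ≤ 2 ^ U.card * m := by
  have hsub : (Finset.univ.filter fun u => k < (G.neighborFinset u ∩ U).card) ⊆
      (U.powersetCard (k + 1)).biUnion (commonNb G) := by
    intro u hu
    obtain ⟨T, hT, hTc⟩ := Finset.exists_subset_card_eq (Finset.mem_filter.1 hu).2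
    refine Finset.mem_biUnion.2 ⟨T, Finset.mem_powersetCard.2
      ⟨hT.trans Finset.inter_subset_right, hTc⟩, mem_commonNb.2 fun t ht => ?_⟩
    exact ((G.mem_neighborFinset u t).1 (Finset.mem_inter.1 (hT ht)).1).symm
  calc _ ≤ _ := Finset.card_le_card hsub
    _ ≤ (U.powersetCard (k + 1)).card * m :=
      Finset.card_biUnion_le_card_mul _ _ _ fun T hT =>
        (hB.card_commonNb_lt (Finset.mem_powersetCard.1 hT).2).le
    _ ≤ U.powerset.card * m := by
      gcongr
      exact fun T hT => Finset.mem_powerset.2 (Finset.mem_powersetCard.1 hT).1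
    _ = 2 ^ U.card * m := by rw [Finset.card_powerset]

lemma NoBip.edgeCount_le {V : Type*} [Finite V] {G : SimpleGraph V} (hB : NoBip k m G)
    (A U : Finset V) :
    edgeCount G A U ≤ k * A.card + 2 ^ U.card * m * U.card := by
  classical
  have := Fintype.ofFinite V
  set bad := Finset.univ.filter fun u => k < (G.neighborFinset u ∩ U).card with hbad
  have hrow (u : V) : ∑ w ∈ U, adjInd G u w ≤ k + if u ∈ bad then (U.card : ℝ) else 0 := by
    rw [sum_adjInd_eq_card]
    split_ifs with h
    · have hU : ((G.neighborFinset u ∩ U).card : ℝ) ≤ U.card := by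
        exact_mod_cast Finset.card_le_card Finset.inter_subset_right
      linarith [Nat.cast_nonneg (α := ℝ) k]
    · rw [add_zero]
      exact_mod_cast not_lt.1 fun hlt => h (Finset.mem_filter.2 ⟨Finset.mem_univ u, hlt⟩)
  calc edgeCount G A U ≤ ∑ u ∈ A, ((k : ℝ) + if u ∈ bad then (U.card : ℝ) else 0) :=
        Finset.sum_le_sum fun u _ => hrow u
    _ ≤ k * A.card + ∑ u, (if u ∈ bad then (U.card : ℝ) else 0) := by
      rw [Finset.sum_add_distrib, Finset.sum_const, nsmul_eq_mul, mul_comm]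
      gcongr
      exact Finset.subset_univ A
    _ = k * A.card + bad.card * U.card := by simp
    _ ≤ k * A.card + 2 ^ U.card * m * U.card := by
      gcongr
      exact_mod_cast hB.card_filter_le U

end CommonNeighbours

section TwoWalks

variable {V : Type*} [Fintype V] {G : SimpleGraph V} {C : ℝ} {x : V → ℝ} {k m : ℕ}

lemma Sparse.edgeCount_univ_le (hS : Sparse C G) (A B : Finset V) :
    edgeCount G A B ≤ 2 * C * Fintype.card V :=
  (edgeCount_mono (Finset.subset_univ A) (Finset.subset_univ B)).trans (hS Finset.univ)

lemma IsPerron.lambdaMax_mul (hx : IsPerron G x) [DecidableRel G.Adj] (v : V) :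
    lambdaMax G * x v = ∑ u ∈ G.neighborFinset v, x u := by
  classical
  rw [← hx.eigen, nbrSum, sum_adjInd_mul, Finset.inter_univ]

lemma IsPerron.two_walk_le_of_levels [DecidableEq V] [DecidableRel G.Adj] (hx : IsPerron G x)
    (hS : Sparse C G) (z : V) {L U : Finset V} (hLU : L ⊆ U) {θ η : ℝ} (hη : 0 ≤ η)
    (hL : ∀ w ∈ U \ L, x w ≤ θ) (hU : ∀ w ∉ U, x w ≤ η) :
    lambdaMax G ^ 2 * x z ≤ edgeCount G (G.neighborFinset z) L
      + θ * edgeCount G (G.neighborFinset z) (U \ L) + 2 * C * η * Fintype.card V := by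
  set N := G.neighborFinset z
  calc lambdaMax G ^ 2 * x z = ∑ u ∈ N, ∑ w, adjInd G u w * x w := by
        rw [sq, mul_assoc, hx.lambdaMax_mul, Finset.mul_sum]
        exact Finset.sum_congr rfl fun u _ => (hx.eigen u).symm
    _ = ∑ u ∈ N, ∑ w ∈ L, adjInd G u w * x w + ∑ u ∈ N, ∑ w ∈ U \ L, adjInd G u w * x w
        + ∑ u ∈ N, ∑ w ∈ Uᶜ, adjInd G u w * x w := by
        simp only [← Finset.sum_add_distrib]
        refine Finset.sum_congr rfl fun u _ => ?_
        rw [add_comm (∑ w ∈ L, _), Finset.sum_sdiff hLU, Finset.sum_add_sum_compl]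
    _ ≤ 1 * edgeCount G N L + θ * edgeCount G N (U \ L) + η * edgeCount G N Uᶜ :=
        add_le_add (add_le_add (sum_sum_adjInd_mul_le N L fun w _ => hx.le_one w)
          (sum_sum_adjInd_mul_le N (U \ L) hL))
          (sum_sum_adjInd_mul_le N Uᶜ fun w hw => hU w (Finset.mem_compl.1 hw))
    _ ≤ 1 * edgeCount G N L + θ * edgeCount G N (U \ L) + η * (2 * C * Fintype.card V) := by
        gcongr
        exact hS.edgeCount_univ_le N Uᶜ
    _ = edgeCount G N L + θ * edgeCount G N (U \ L) + 2 * C * η * Fintype.card V := by ring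

lemma IsPerron.two_walk_le [DecidableRel G.Adj] (hx : IsPerron G x) (hS : Sparse C G) (z : V)
    {U : Finset V} {η : ℝ} (hη : 0 ≤ η) (hU : ∀ w ∉ U, x w ≤ η) :
    lambdaMax G ^ 2 * x z
      ≤ edgeCount G (G.neighborFinset z) U + 2 * C * η * Fintype.card V := by
  classical
  simpa [edgeCount] using hx.two_walk_le_of_levels hS z subset_rfl (θ := 0) hη (by simp) hU

end TwoWalks

section HeavyVertices

variable {V : Type*} [Fintype V] {G : SimpleGraph V} {C : ℝ} {x : V → ℝ} {k m : ℕ}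

/-- The vertices of weight at least `η`. -/
noncomputable def heavy (x : V → ℝ) (η : ℝ) : Finset V := Finset.univ.filter (η ≤ x ·)

lemma mem_heavy {η : ℝ} {v : V} : v ∈ heavy x η ↔ η ≤ x v := by simp [heavy]

lemma le_of_notMem_heavy {η : ℝ} {v : V} (h : v ∉ heavy x η) : x v ≤ η :=
  (not_le.1 (mt mem_heavy.2 h)).le

lemma Sparse.card_mul_le_of_forall_le_deg (hS : Sparse C G) {U : Finset V} {b : ℝ}
    (h : ∀ v ∈ U, b ≤ deg G v) : U.card * b ≤ 2 * C * Fintype.card V := by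
  calc U.card * b = ∑ _v ∈ U, b := by simp
    _ ≤ edgeCount G U Finset.univ :=
      Finset.sum_le_sum fun v hv => (h v hv).trans_eq (sum_adjInd_eq_deg G v).symm
    _ ≤ 2 * C * Fintype.card V := hS.edgeCount_univ_le _ _

lemma IsPerron.lambdaMax_mul_le_deg (hx : IsPerron G x) (v : V) :
    lambdaMax G * x v ≤ deg G v := by
  rw [← hx.eigen, ← sum_adjInd_eq_deg]
  exact Finset.sum_le_sum fun u _ => mul_le_of_le_one_right (adjInd_nonneg _ _ _) (hx.le_one u)

lemma IsPerron.card_heavy_mul_le (hx : IsPerron G x) (hS : Sparse C G) (η : ℝ)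
    (hl : 0 ≤ lambdaMax G) :
    (heavy x η).card * (lambdaMax G * η) ≤ 2 * C * Fintype.card V :=
  hS.card_mul_le_of_forall_le_deg fun v hv =>
    (mul_le_mul_of_nonneg_left (mem_heavy.1 hv) hl).trans (hx.lambdaMax_mul_le_deg v)

lemma IsPerron.two_mul_card_heavy_le (hx : IsPerron G x) (hS : Sparse C G) (hC : 1 ≤ C) {η : ℝ}
    (hη : 0 < η) (hl : 256 * C ^ 3 / η ^ 2 ≤ lambdaMax G) :
    2 * C * (heavy x (η / (8 * C))).card ≤ η * Fintype.card V / 8 := by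
  have : 0 < C := by linarith
  have hbig : 32 * C ^ 2 / η ≤ lambdaMax G * (η / (8 * C)) := by
    calc 32 * C ^ 2 / η = 256 * C ^ 3 / η ^ 2 * (η / (8 * C)) := by field_simp; ring
      _ ≤ lambdaMax G * (η / (8 * C)) := by gcongr
  have hcard : ((heavy x (η / (8 * C))).card : ℝ) * (32 * C ^ 2 / η) ≤ 2 * C * Fintype.card V :=
    (mul_le_mul_of_nonneg_left hbig (Nat.cast_nonneg _)).trans
      (hx.card_heavy_mul_le hS _ (le_trans (by positivity) hl))
  rw [mul_div_assoc', div_le_iff₀ hη] at hcard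
  refine le_of_mul_le_mul_right (a := 16 * C) ?_ (by positivity)
  linarith

lemma IsPerron.le_deg_of_le (hx : IsPerron G x) (hS : Sparse C G) (hC : 1 ≤ C) {η : ℝ}
    (hη : 0 < η) (hl : 256 * C ^ 3 / η ^ 2 ≤ lambdaMax G)
    (hl2 : Fintype.card V - k ≤ lambdaMax G ^ 2) (hn : 8 * (k : ℝ) ≤ Fintype.card V)
    {z : V} (hz : η ≤ x z) : η * Fintype.card V / (4 * C) ≤ deg G z := by
  classical
  set n : ℝ := (Fintype.card V : ℝ)
  set η₀ := η / (8 * C) with hη₀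
  have hwalk : lambdaMax G ^ 2 * x z ≤ 2 * C * (deg G z + (heavy x η₀).card) + η * n / 4 := by
    have hsmall : 2 * C * η₀ * n = η * n / 4 := by rw [hη₀]; field_simp; ring
    rw [← card_neighborFinset_eq_deg, ← hsmall]
    exact (hx.two_walk_le hS z (by positivity) fun w => le_of_notMem_heavy).trans
      (add_le_add_left (hS.edgeCount_le (by linarith) _ _) _)
  have hheavy : 2 * C * (heavy x η₀).card ≤ η * n / 8 := hx.two_mul_card_heavy_le hS hC hη hl
  have hlower : (n - k) * η ≤ lambdaMax G ^ 2 * x z :=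
    mul_le_mul hl2 hz hη.le (sq_nonneg _)
  have hk : η * k ≤ η * n / 8 := by rw [le_div_iff₀ (by norm_num)]; nlinarith
  rw [div_le_iff₀ (by positivity)]
  linarith

lemma IsPerron.card_heavy_le (hx : IsPerron G x) (hS : Sparse C G) (hC : 1 ≤ C) {η : ℝ}
    (hη : 0 < η) (hl : 256 * C ^ 3 / η ^ 2 ≤ lambdaMax G)
    (hl2 : Fintype.card V - k ≤ lambdaMax G ^ 2) (hn : 8 * (k : ℝ) ≤ Fintype.card V) :
    ((heavy x η).card : ℝ) ≤ 8 * C ^ 2 / η := by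
  obtain ⟨z, -⟩ := hx.exists_eq_one
  have hn0 : (0 : ℝ) < Fintype.card V := by exact_mod_cast Fintype.card_pos_iff.2 ⟨z⟩
  have hcount := hS.card_mul_le_of_forall_le_deg fun v (hv : v ∈ heavy x η) =>
    hx.le_deg_of_le hS hC hη hl hl2 hn (mem_heavy.1 hv)
  rw [mul_div_assoc', div_le_iff₀ (by positivity)] at hcount
  rw [le_div_iff₀ hη]
  refine le_of_mul_le_mul_right ?_ hn0
  linarith

lemma IsPerron.le_deg_of_one_sub_le (hx : IsPerron G x) (hS : Sparse C G) (hB : NoBip k m G)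
    (hk : 1 ≤ k) (hl2 : k * ((Fintype.card V : ℝ) - k) ≤ lambdaMax G ^ 2) {U : Finset V}
    {η δ : ℝ} (hη : 0 ≤ η) (hU : ∀ w ∉ U, x w ≤ η) (hδ0 : 0 ≤ δ) (hδ1 : δ ≤ 1)
    (herr : k ^ 2 + 2 ^ U.card * m * U.card + 2 * C * η * Fintype.card V ≤ δ * Fintype.card V)
    {z : V} (hz : 1 - δ ≤ x z) : Fintype.card V - 2 * δ * Fintype.card V ≤ (deg G z : ℝ) := by
  classical
  set n : ℝ := (Fintype.card V : ℝ)
  have hk' : (1 : ℝ) ≤ k := by exact_mod_cast hk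
  have hlower : k * (n - k) * (1 - δ) ≤ lambdaMax G ^ 2 * x z :=
    mul_le_mul hl2 hz (by linarith) (sq_nonneg _)
  have hwalk := hx.two_walk_le hS z hη hU
  have hedges := hB.edgeCount_le (G.neighborFinset z) U
  rw [card_neighborFinset_eq_deg] at hedges
  have hδn : δ * n ≤ k * (δ * n) := le_mul_of_one_le_left (by positivity) hk'
  have hδk : 0 ≤ δ * (k : ℝ) ^ 2 := by positivity
  refine le_of_mul_le_mul_left (a := (k : ℝ)) ?_ (by linarith)
  linarith

lemma IsPerron.le_card_heavy (hx : IsPerron G x) (hS : Sparse C G) (hB : NoBip k m G)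
    (hl2 : k * ((Fintype.card V : ℝ) - k) ≤ lambdaMax G ^ 2) {η δ : ℝ} (hη : 0 < η)
    (hηδ : η ≤ 1 - δ) (hδ0 : 0 < δ)
    (herr : 2 * (k ^ 2 + 2 ^ (heavy x η).card * m * (heavy x η).card
      + 2 * C * η * Fintype.card V) ≤ δ * Fintype.card V) :
    k ≤ (heavy x (1 - δ)).card := by
  classical
  by_contra! hlt
  obtain ⟨z, hz⟩ := hx.exists_eq_one
  have hn0 : (0 : ℝ) < Fintype.card V := by exact_mod_cast Fintype.card_pos_iff.2 ⟨z⟩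
  set n : ℝ := (Fintype.card V : ℝ)
  set N := G.neighborFinset z
  set H := heavy x η
  set L := heavy x (1 - δ)
  have hLH : L ⊆ H := fun w hw => mem_heavy.2 (hηδ.trans (mem_heavy.1 hw))
  have hN : (N.card : ℝ) ≤ n := Nat.cast_le.2 (Finset.card_le_univ N)
  have hwalk := hx.two_walk_le_of_levels hS z hLH hη.le
    (fun w hw => le_of_notMem_heavy (Finset.mem_sdiff.1 hw).2) fun w => le_of_notMem_heavy
  rw [hz, mul_one] at hwalk
  have hH : edgeCount G N (H \ L) + edgeCount G N L ≤ k * n + 2 ^ H.card * m * H.card := by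
    rw [edgeCount_sdiff_add hLH]
    exact (hB.edgeCount_le N H).trans (by gcongr)
  have hL : edgeCount G N L ≤ n * (k - 1) := by
    have hlt' : (L.card : ℝ) + 1 ≤ k := by exact_mod_cast hlt
    exact (edgeCount_le_card_mul_card N L).trans
      (mul_le_mul hN (by linarith) (by positivity) hn0.le)
  have hn : n / 2 < edgeCount G N (H \ L) := by
    have hδn : δ * n < 1 * n := mul_lt_mul_of_pos_right (by linarith) hn0
    have hδq : 0 ≤ δ * edgeCount G N (H \ L) := mul_nonneg hδ0.le (edgeCount_nonneg _ _)
    have hbad : (0 : ℝ) ≤ 2 ^ H.card * m * H.card := by positivity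
    linarith
  have hδ : δ * (n / 2) < δ * edgeCount G N (H \ L) := mul_lt_mul_of_pos_left hn hδ0
  linarith

end HeavyVertices

section LightVertices

variable {V : Type*} [Fintype V] {G : SimpleGraph V} {C : ℝ} {x : V → ℝ} {k m : ℕ}

lemma IsPerron.lambdaMax_mul_le_add_card [DecidableEq V] [DecidableRel G.Adj]
    (hx : IsPerron G x) (L : Finset V) (u : V) :
    lambdaMax G * x u ≤ L.card + ∑ w ∈ G.neighborFinset u \ L, x w := by
  rw [hx.lambdaMax_mul, ← Finset.sum_inter_add_sum_sdiff (G.neighborFinset u) L]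
  gcongr
  calc ∑ w ∈ G.neighborFinset u ∩ L, x w ≤ ((G.neighborFinset u ∩ L).card : ℝ) := by
        simpa using Finset.sum_le_card_nsmul _ x 1 fun w _ => hx.le_one w
    _ ≤ L.card := by exact_mod_cast Finset.card_le_card Finset.inter_subset_right

lemma NoBip.card_sdiff_le [DecidableEq V] [DecidableRel G.Adj] (hB : NoBip k m G)
    {L : Finset V} (hL : L.card = k) {u : V} (hu : u ∉ L) :
    (G.neighborFinset u \ L).card ≤ m + (G.neighborFinset u ∩ exceptional G L).card := by
  have hsub : G.neighborFinset u \ L ⊆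
      (G.neighborFinset u ∩ commonNb G L) ∪ (G.neighborFinset u ∩ exceptional G L) := by
    intro w hw
    rw [← Finset.inter_union_distrib_left, Finset.mem_inter, Finset.mem_union, mem_exceptional]
    exact ⟨(Finset.mem_sdiff.1 hw).1, by have := (Finset.mem_sdiff.1 hw).2; tauto⟩
  have hfew := hB.card_inter_commonNb_lt hL hu
  have hcard := (Finset.card_le_card hsub).trans (Finset.card_union_le _ _)
  omega

lemma IsPerron.lambdaMax_sq_mul_le_of_notMem (hx : IsPerron G x) (hS : Sparse C G) (hC : 0 ≤ C)
    (hB : NoBip k m G) (hl : 0 ≤ lambdaMax G) {L : Finset V} (hL : L.card = k) {v : V}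
    (hv : v ∉ L) :
    lambdaMax G ^ 2 * x v
      ≤ k * lambdaMax G + (k + m + 4 * C) * (m + (exceptional G L).card) := by
  classical
  set R := exceptional G L
  set T := G.neighborFinset v \ L
  have hT : (T.card : ℝ) ≤ m + R.card := by
    exact_mod_cast (hB.card_sdiff_le hL hv).trans
      (by gcongr; exact Finset.inter_subset_right)
  have hrow (u : V) (hu : u ∈ T) :
      lambdaMax G * x u ≤ k + m + ∑ w ∈ R, adjInd G u w := by
    have hcard : ((G.neighborFinset u \ L).card : ℝ) ≤ m + (G.neighborFinset u ∩ R).card := by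
      exact_mod_cast hB.card_sdiff_le hL (Finset.mem_sdiff.1 hu).2
    have hsum : ∑ w ∈ G.neighborFinset u \ L, x w ≤ (G.neighborFinset u \ L).card := by
      simpa using Finset.sum_le_card_nsmul _ x 1 fun w _ => hx.le_one w
    have hu' := hx.lambdaMax_mul_le_add_card L u
    rw [sum_adjInd_eq_card]
    rw [hL] at hu'
    linarith
  have hTR : edgeCount G T R ≤ 4 * C * (m + R.card) := by
    have hm : (0 : ℝ) ≤ 2 * C * m := by positivity
    have hTC : 2 * C * T.card ≤ 2 * C * (m + R.card) := by gcongr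
    linarith [hS.edgeCount_le hC T R]
  calc lambdaMax G ^ 2 * x v = lambdaMax G * (lambdaMax G * x v) := by ring
    _ ≤ lambdaMax G * (k + ∑ u ∈ T, x u) := by
        gcongr; exact hL ▸ hx.lambdaMax_mul_le_add_card L v
    _ = k * lambdaMax G + ∑ u ∈ T, lambdaMax G * x u := by rw [← Finset.mul_sum]; ring
    _ ≤ k * lambdaMax G + ∑ u ∈ T, (k + m + ∑ w ∈ R, adjInd G u w) := by
        gcongr with u hu; exact hrow u hu
    _ = k * lambdaMax G + ((k + m) * T.card + edgeCount G T R) := by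
        rw [Finset.sum_add_distrib, Finset.sum_const, nsmul_eq_mul, edgeCount]; ring
    _ ≤ k * lambdaMax G + ((k + m) * (m + R.card) + 4 * C * (m + R.card)) := by gcongr
    _ = k * lambdaMax G + (k + m + 4 * C) * (m + R.card) := by ring

lemma IsPerron.le_of_notMem (hx : IsPerron G x) (hS : Sparse C G) (hC : 0 ≤ C)
    (hB : NoBip k m G) {L : Finset V} (hL : L.card = k) {ε : ℝ} (hl : 1 ≤ lambdaMax G)
    (hlk : 4 * k ≤ ε * lambdaMax G) (hlm : 4 * ((k + m + 4 * C) * m) ≤ ε * lambdaMax G)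
    (hR : 4 * ((k + m + 4 * C) * (exceptional G L).card) ≤ 2 * ε * lambdaMax G ^ 2)
    {v : V} (hv : v ∉ L) : x v ≤ ε := by
  have hl0 : 0 < lambdaMax G := by linarith
  have hbound := hx.lambdaMax_sq_mul_le_of_notMem hS hC hB hl0.le hL hv
  have hk : 4 * k * lambdaMax G ≤ ε * lambdaMax G * lambdaMax G := by gcongr
  have hm : 4 * ((k + m + 4 * C) * m) ≤ ε * lambdaMax G * lambdaMax G :=
    hlm.trans (le_mul_of_one_le_right (le_trans (by positivity) hlk) hl)
  refine le_of_mul_le_mul_left (a := lambdaMax G ^ 2) ?_ (by positivity)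
  linarith

end LightVertices

section Core

lemma IsPerron.exists_dominating_set {V : Type*} [Fintype V] {G : SimpleGraph V} {C : ℝ}
    {x : V → ℝ} {k m : ℕ} (hx : IsPerron G x) (hS : Sparse C G) (hB : NoBip k m G) (hk : 1 ≤ k)
    (hl2 : k * ((Fintype.card V : ℝ) - k) ≤ lambdaMax G ^ 2) {η δ : ℝ} (hη : 0 < η)
    (hηδ : η ≤ 1 - δ) (hδ0 : 0 < δ)
    (herr : 2 * (k ^ 2 + 2 ^ (heavy x η).card * m * (heavy x η).card
      + 2 * C * η * Fintype.card V) ≤ δ * Fintype.card V)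
    (hm : (k + 1) * (2 * δ * Fintype.card V) + m ≤ Fintype.card V) :
    ∃ L : Finset V, L.card = k ∧ (∀ l ∈ L, 1 - δ ≤ x l) ∧
      ((exceptional G L).card : ℝ) ≤ k * (2 * δ * Fintype.card V) := by
  have hδn : 0 ≤ δ * Fintype.card V := by positivity
  have hdeg : ∀ l ∈ heavy x (1 - δ),
      Fintype.card V - 2 * δ * Fintype.card V ≤ (deg G l : ℝ) := fun l hl =>
    hx.le_deg_of_one_sub_le hS hB hk hl2 hη.le (fun w => le_of_notMem_heavy) hδ0.le
      (by linarith) (by linarith) (mem_heavy.1 hl)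
  have hcard : (heavy x (1 - δ)).card = k :=
    le_antisymm (hB.card_le_of_forall_le_deg hdeg hm)
      (hx.le_card_heavy hS hB hl2 hη hηδ hδ0 herr)
  exact ⟨_, hcard, fun l hl => mem_heavy.1 hl, hcard ▸ card_exceptional_le hdeg⟩

theorem exists_core (k m : ℕ) (hk : 1 ≤ k) {C : ℝ} (hC : 1 ≤ C) {ε : ℝ} (hε : 0 < ε)
    (hε1 : ε ≤ 1) :
    ∃ K : ℝ, ∀ (V : Type) [Fintype V] (G : SimpleGraph V) (x : V → ℝ), IsPerron G x →
      Sparse C G → NoBip k m G → K ≤ lambdaMax G → K ≤ Fintype.card V →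
      k * ((Fintype.card V : ℝ) - k) ≤ lambdaMax G ^ 2 →
      ∃ L : Finset V, L.card = k ∧ (∀ l ∈ L, 1 - ε ≤ x l) ∧ (∀ v ∉ L, x v ≤ ε) ∧
        ((exceptional G L).card : ℝ) ≤ ε * Fintype.card V := by
  have hk' : (1 : ℝ) ≤ k := by exact_mod_cast hk
  have hC0 : 0 < C := by linarith
  set M : ℝ := k + m + 4 * C with hM
  have hM1 : 1 ≤ M := by linarith [Nat.cast_nonneg (α := ℝ) m]
  obtain ⟨δ, hδ0, hMδ⟩ : ∃ δ : ℝ, 0 < δ ∧ M * (8 * (k + 1) * δ) = ε :=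
    ⟨ε / (8 * (k + 1) * M), by positivity, by field_simp⟩
  have hδε : 8 * (k + 1) * δ ≤ ε := hMδ ▸ le_mul_of_one_le_left (by positivity) hM1
  have hkδ : 0 ≤ k * δ := by positivity
  obtain ⟨η, hη0, hCη⟩ : ∃ η : ℝ, 0 < η ∧ 8 * C * η = δ :=
    ⟨δ / (8 * C), by positivity, by field_simp⟩
  have hηC : η ≤ C * η := le_mul_of_one_le_left hη0.le hC
  set b := 8 * C ^ 2 / η
  set B : ℝ := 2 ^ ⌊b⌋₊ * m * b
  obtain ⟨K, hK1, hK8, hKm, hKη, hKB, hKk, hKM⟩ : ∃ K : ℝ, 1 ≤ K ∧ 8 * k ≤ K ∧ 2 * m ≤ K ∧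
      256 * C ^ 3 / η ^ 2 ≤ K ∧ 4 * (k ^ 2 + B) / δ ≤ K ∧ 4 * k / ε ≤ K ∧ 4 * (M * m) / ε ≤ K :=
    ((eventually_ge_atTop _).and <| (eventually_ge_atTop _).and <| (eventually_ge_atTop _).and <|
      (eventually_ge_atTop _).and <| (eventually_ge_atTop _).and <|
      (eventually_ge_atTop _).and <| eventually_ge_atTop _).exists
  refine ⟨K, fun V _ G x hx hS hB hKl hKn hl2 => ?_⟩
  have hlkn : Fintype.card V - k ≤ lambdaMax G ^ 2 :=
    (le_mul_of_one_le_left (by linarith) hk').trans hl2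
  set n : ℝ := (Fintype.card V : ℝ)
  have hn0 : 0 < n := by linarith
  have hheavy : ((heavy x η).card : ℝ) ≤ b :=
    hx.card_heavy_le hS hC hη0 (hKη.trans hKl) hlkn (by linarith)
  have hbad : (2 : ℝ) ^ (heavy x η).card * m * (heavy x η).card ≤ B := by
    have hfloor : (heavy x η).card ≤ ⌊b⌋₊ := Nat.le_floor hheavy
    calc _ ≤ (2 : ℝ) ^ ⌊b⌋₊ * m * b := by gcongr; norm_num
      _ = B := rfl
  have hBn : 4 * (k ^ 2 + B) ≤ δ * n := (div_le_iff₀' hδ0).1 (hKB.trans hKn)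
  have hCηn : 8 * C * η * n = δ * n := by rw [hCη]
  have hδεn : 8 * (k + 1) * δ * n ≤ ε * n := by gcongr
  have hεn : ε * n ≤ n := mul_le_of_le_one_left hn0.le hε1
  obtain ⟨L, hLk, hL, hexc⟩ := hx.exists_dominating_set hS hB hk hl2 hη0 (by linarith) hδ0
    (by linarith) (by linarith)
  have hδn : 0 ≤ δ * n := by positivity
  have : 0 ≤ k * δ * n := by positivity
  refine ⟨L, hLk, fun l hl => by linarith [hL l hl], fun v hv => ?_, by linarith⟩
  refine hx.le_of_notMem hS hC0.le hB hLk (hK1.trans hKl)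
    ((div_le_iff₀' hε).1 (hKk.trans hKl)) ((div_le_iff₀' hε).1 (hKM.trans hKl)) ?_ hv
  calc 4 * (M * (exceptional G L).card) ≤ 4 * (M * (2 * (k + 1) * δ * n)) := by
        gcongr; linarith
    _ = ε * n := by rw [← hMδ]; ring
    _ ≤ ε * (2 * lambdaMax G ^ 2) := by gcongr; linarith
    _ = 2 * ε * lambdaMax G ^ 2 := by ring

end Core

section EdgePatterns

variable {V : Type*}

/-- The complete bipartite graph between `L` and its complement. -/
def crossOn (L : Finset V) : SimpleGraph V where
  Adj u v := (u ∈ L ∧ v ∉ L) ∨ (u ∉ L ∧ v ∈ L)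
  symm := ⟨fun _ _ h => h.elim (fun h => Or.inr h.symm) (fun h => Or.inl h.symm)⟩
  loopless := ⟨fun _ h => h.elim (fun h => h.2 h.1) (fun h => h.1 h.2)⟩

/-- The clique on `U`, with all other vertices isolated. -/
def cliqueOn (U : Finset V) : SimpleGraph V where
  Adj u v := u ≠ v ∧ u ∈ U ∧ v ∈ U
  symm := ⟨fun _ _ h => ⟨h.1.symm, h.2.2, h.2.1⟩⟩
  loopless := ⟨fun _ h => h.1 rfl⟩

/-- The edges of `G` inside `U`, as a graph on the whole vertex set. -/
abbrev within (G : SimpleGraph V) (U : Finset V) : SimpleGraph V := G ⊓ cliqueOn U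

lemma crossOn_adj {L : Finset V} {u v : V} :
    (crossOn L).Adj u v ↔ (u ∈ L ∧ v ∉ L) ∨ (u ∉ L ∧ v ∈ L) := Iff.rfl

lemma cliqueOn_adj {U : Finset V} {u v : V} :
    (cliqueOn U).Adj u v ↔ u ≠ v ∧ u ∈ U ∧ v ∈ U := Iff.rfl

lemma within_adj {G : SimpleGraph V} {U : Finset V} {u v : V} :
    (within G U).Adj u v ↔ G.Adj u v ∧ u ∈ U ∧ v ∈ U :=
  ⟨fun h => ⟨h.1, h.2.2⟩, fun h => ⟨h.1, h.1.ne, h.2⟩⟩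

lemma disjoint_crossOn_cliqueOn {L U : Finset V} (h : U ⊆ L ∨ Disjoint U L) :
    Disjoint (crossOn L) (cliqueOn U) := by
  rw [SimpleGraph.disjoint_left]
  intro u v hcross hclique
  rw [crossOn_adj] at hcross
  rcases h with h | h
  · have hu := h hclique.2.1
    have hv := h hclique.2.2
    tauto
  · have hu := Finset.disjoint_left.1 h hclique.2.1
    have hv := Finset.disjoint_left.1 h hclique.2.2
    tauto

lemma disjoint_cliqueOn {U U' : Finset V} (h : Disjoint U U') :
    Disjoint (cliqueOn U) (cliqueOn U') :=
  SimpleGraph.disjoint_left.2 fun _ _ huv huv' => Finset.disjoint_left.1 h huv.2.1 huv'.2.1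

lemma adjInd_sup {A B : SimpleGraph V} (h : Disjoint A B) (u v : V) :
    adjInd (A ⊔ B) u v = adjInd A u v + adjInd B u v := by
  have hAB := SimpleGraph.disjoint_left.1 h u v
  by_cases hA : A.Adj u v <;> by_cases hB : B.Adj u v <;> simp_all [adjInd]

lemma quadForm_sup [Fintype V] {A B : SimpleGraph V} (h : Disjoint A B) (x : V → ℝ) :
    quadForm (A ⊔ B) x = quadForm A x + quadForm B x := by
  simp only [quadForm, adjInd_sup h, add_mul, Finset.sum_add_distrib]

end EdgePatterns

section Cleaning

variable {V : Type*} [Fintype V] {G : SimpleGraph V} {L : Finset V} {x : V → ℝ}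

/-- Keep the edges of `G` inside `L` and inside the common neighbourhood of `L`, add all edges
between `L` and its complement, and delete all other edges. -/
noncomputable def cleaned (G : SimpleGraph V) (L : Finset V) : SimpleGraph V :=
  crossOn L ⊔ (within G L ⊔ within G (commonNb G L))

lemma disjoint_commonNb : Disjoint (commonNb G L) L :=
  Finset.disjoint_left.2 fun _ => notMem_of_mem_commonNb

lemma quadForm_cleaned (x : V → ℝ) : quadForm (cleaned G L) x = quadForm (crossOn L) x
    + quadForm (within G L) x + quadForm (within G (commonNb G L)) x := by
  rw [cleaned, quadForm_sup, quadForm_sup, add_assoc]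
  · exact (disjoint_cliqueOn disjoint_commonNb.symm).mono inf_le_right inf_le_right
  · rw [disjoint_sup_right]
    exact ⟨(disjoint_crossOn_cliqueOn (Or.inl subset_rfl)).mono_right inf_le_right,
      (disjoint_crossOn_cliqueOn (Or.inr disjoint_commonNb)).mono_right inf_le_right⟩

lemma cleaned_adj_iff_of_mem_exceptional {u v : V} (hv : v ∈ exceptional G L) :
    (cleaned G L).Adj v u ↔ u ∈ L := by
  rw [mem_exceptional] at hv
  simp only [cleaned, SimpleGraph.sup_adj, crossOn_adj, within_adj]
  tauto

lemma cleaned_adj_iff_of_notMem_exceptional {u v : V} (hu : u ∉ exceptional G L)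
    (hv : v ∉ exceptional G L) : (cleaned G L).Adj u v ↔ G.Adj u v := by
  have huL : u ∈ L → v ∉ L → G.Adj u v := fun hu' hv' =>
    mem_commonNb.1 (by simpa [mem_exceptional, hv'] using hv) u hu'
  have hvL : u ∉ L → v ∈ L → G.Adj v u := fun hu' hv' =>
    mem_commonNb.1 (by simpa [mem_exceptional, hu'] using hu) v hv'
  simp only [mem_exceptional] at hu hv
  simp only [cleaned, SimpleGraph.sup_adj, crossOn_adj, within_adj]
  have := G.adj_comm u v
  tauto

lemma cleaned_eq_of_exceptional_eq_empty (h : exceptional G L = ∅) : cleaned G L = G := by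
  ext u v
  exact cleaned_adj_iff_of_notMem_exceptional (by simp [h]) (by simp [h])

lemma sum_compl_exceptional [DecidableEq V] (f : V → ℝ) :
    ∑ v ∈ (exceptional G L)ᶜ, f v = ∑ v ∈ L, f v + ∑ v ∈ commonNb G L, f v := by
  rw [← Finset.sum_union disjoint_commonNb.symm]
  congr 1
  ext v
  simp only [Finset.mem_compl, mem_exceptional, Finset.mem_union]
  tauto

lemma sum_univ_eq_sum_add_sum_add_sum (G : SimpleGraph V) (L : Finset V) (f : V → ℝ) :
    ∑ v, f v = ∑ v ∈ L, f v + ∑ v ∈ commonNb G L, f v + ∑ v ∈ exceptional G L, f v := by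
  classical
  rw [← sum_compl_exceptional, Finset.sum_compl_add_sum]

lemma sum_sum_eq_of_symm_of_eq_zero [DecidableEq V] {f : V → V → ℝ} {R : Finset V}
    (hsymm : ∀ u v, f u v = f v u) (hzero : ∀ u ∉ R, ∀ v ∉ R, f u v = 0) :
    ∑ u, ∑ v, f u v = 2 * ∑ v ∈ R, ∑ u ∈ Rᶜ, f v u + ∑ v ∈ R, ∑ u ∈ R, f v u := by
  have hcompl : ∑ u ∈ Rᶜ, ∑ v ∈ Rᶜ, f u v = 0 :=
    Finset.sum_eq_zero fun u hu => Finset.sum_eq_zero fun v hv =>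
      hzero u (Finset.mem_compl.1 hu) v (Finset.mem_compl.1 hv)
  have hcross : ∑ u ∈ Rᶜ, ∑ v ∈ R, f u v = ∑ v ∈ R, ∑ u ∈ Rᶜ, f v u := by
    rw [Finset.sum_comm]
    exact Finset.sum_congr rfl fun v _ => Finset.sum_congr rfl fun u _ => hsymm u v
  simp only [← Finset.sum_compl_add_sum R, Finset.sum_add_distrib] at hcompl hcross ⊢
  linarith

lemma quadForm_cleaned_sub (x : V → ℝ) : quadForm (cleaned G L) x - quadForm G x =
    2 * (∑ v ∈ exceptional G L, ∑ l ∈ L, (1 - adjInd G v l) * (x v * x l)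
      - ∑ v ∈ exceptional G L, ∑ u ∈ commonNb G L, adjInd G v u * (x v * x u))
    - ∑ v ∈ exceptional G L, ∑ u ∈ exceptional G L, adjInd G v u * (x v * x u) := by
  classical
  set f : V → V → ℝ := fun u v => (adjInd (cleaned G L) u v - adjInd G u v) * (x u * x v)
  have hsub : quadForm (cleaned G L) x - quadForm G x = ∑ u, ∑ v, f u v := by
    simp only [quadForm, f, sub_mul, mul_assoc, Finset.sum_sub_distrib]
  have hsymm (u v : V) : f u v = f v u := by
    simp only [f, adjInd_comm _ u v, mul_comm (x u)]
  have hzero (u : V) (hu : u ∉ exceptional G L) (v : V) (hv : v ∉ exceptional G L) :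
      f u v = 0 := by
    simp only [f, adjInd_congr (cleaned_adj_iff_of_notMem_exceptional hu hv), sub_self, zero_mul]
  have hL {v l : V} (hv : v ∈ exceptional G L) (hl : l ∈ L) :
      f v l = (1 - adjInd G v l) * (x v * x l) := by
    simp only [f, adjInd_of_adj ((cleaned_adj_iff_of_mem_exceptional hv).2 hl)]
  have hnotL {v u : V} (hv : v ∈ exceptional G L) (hu : u ∉ L) :
      f v u = -(adjInd G v u * (x v * x u)) := by
    simp only [f, adjInd_of_not_adj (mt (cleaned_adj_iff_of_mem_exceptional hv).1 hu), zero_sub,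
      neg_mul]
  rw [hsub, sum_sum_eq_of_symm_of_eq_zero hsymm hzero, ← Finset.sum_sub_distrib, sub_eq_add_neg,
    ← Finset.sum_neg_distrib]
  congr 1
  · refine congrArg (2 * ·) (Finset.sum_congr rfl fun v hv => ?_)
    rw [sum_compl_exceptional, sub_eq_add_neg, ← Finset.sum_neg_distrib]
    exact congrArg₂ (· + ·) (Finset.sum_congr rfl fun l hl => hL hv hl)
      (Finset.sum_congr rfl fun u hu => hnotL hv (notMem_of_mem_commonNb hu))
  · refine Finset.sum_congr rfl fun v hv => ?_
    rw [← Finset.sum_neg_distrib]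
    exact Finset.sum_congr rfl fun u hu => hnotL hv (mem_exceptional.1 hu).1

end Cleaning

section Switching

variable {V : Type*} {G : SimpleGraph V} {C ε : ℝ} {x : V → ℝ} {k m : ℕ}

lemma Sparse.exists_sum_adjInd_le (hS : Sparse C G) {U : Finset V} (hU : U.Nonempty) :
    ∃ v ∈ U, ∑ u ∈ U, adjInd G v u ≤ 2 * C := by
  refine Finset.exists_le_of_sum_le hU ?_
  calc ∑ v ∈ U, ∑ u ∈ U, adjInd G v u ≤ 2 * C * U.card := hS U
    _ = ∑ _v ∈ U, 2 * C := by rw [Finset.sum_const, nsmul_eq_mul, mul_comm]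

lemma Sparse.sum_sum_min_le (hS : Sparse C G) (hx : ∀ v, 0 ≤ x v) (U : Finset V) :
    ∑ u ∈ U, ∑ v ∈ U, adjInd G u v * min (x u) (x v) ≤ 4 * C * ∑ u ∈ U, x u := by
  classical
  induction U using Finset.strongInduction with
  | H U ih =>
  rcases U.eq_empty_or_nonempty with rfl | hU
  · simp
  obtain ⟨v, hv, hdeg⟩ := hS.exists_sum_adjInd_le hU
  have hstar : ∑ u ∈ U.erase v, adjInd G v u * min (x v) (x u) ≤ 2 * C * x v :=
    calc _ ≤ ∑ u ∈ U.erase v, adjInd G v u * x v :=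
          Finset.sum_le_sum fun u _ =>
            mul_le_mul_of_nonneg_left (min_le_left _ _) (adjInd_nonneg _ _ _)
      _ = (∑ u ∈ U.erase v, adjInd G v u) * x v := by rw [Finset.sum_mul]
      _ ≤ (∑ u ∈ U, adjInd G v u) * x v :=
          mul_le_mul_of_nonneg_right (Finset.sum_le_sum_of_subset_of_nonneg
            (Finset.erase_subset _ _) fun _ _ _ => adjInd_nonneg _ _ _) (hx v)
      _ ≤ 2 * C * x v := mul_le_mul_of_nonneg_right hdeg (hx v)
  have hcomm : ∑ u ∈ U.erase v, adjInd G u v * min (x u) (x v)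
      = ∑ u ∈ U.erase v, adjInd G v u * min (x v) (x u) :=
    Finset.sum_congr rfl fun u _ => by rw [adjInd_comm, min_comm]
  have hih := ih _ (Finset.erase_ssubset hv)
  rw [← Finset.insert_erase hv]
  simp only [Finset.sum_insert (Finset.notMem_erase v U), Finset.sum_add_distrib, adjInd_self,
    zero_mul, zero_add]
  linarith

lemma Sparse.sum_sum_mul_le (hS : Sparse C G) (hε : 0 ≤ ε) (hx : ∀ v, 0 ≤ x v) {U : Finset V}
    (hU : ∀ v ∈ U, x v ≤ ε) :
    ∑ v ∈ U, ∑ u ∈ U, adjInd G v u * (x v * x u) ≤ ε * (4 * C) * ∑ v ∈ U, x v := by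
  have hmul {u v : V} (hu : u ∈ U) (hv : v ∈ U) : x v * x u ≤ ε * min (x v) (x u) := by
    rcases le_total (x v) (x u) with h | h
    · rw [min_eq_left h, mul_comm]
      exact mul_le_mul_of_nonneg_right (hU u hu) (hx v)
    · rw [min_eq_right h]
      exact mul_le_mul_of_nonneg_right (hU v hv) (hx u)
  calc ∑ v ∈ U, ∑ u ∈ U, adjInd G v u * (x v * x u)
      ≤ ∑ v ∈ U, ∑ u ∈ U, ε * (adjInd G v u * min (x v) (x u)) := by
        refine Finset.sum_le_sum fun v hv => Finset.sum_le_sum fun u hu => ?_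
        rw [mul_left_comm ε]
        exact mul_le_mul_of_nonneg_left (hmul hu hv) (adjInd_nonneg _ _ _)
    _ = ε * ∑ v ∈ U, ∑ u ∈ U, adjInd G v u * min (x v) (x u) := by simp only [Finset.mul_sum]
    _ ≤ ε * (4 * C * ∑ v ∈ U, x v) := mul_le_mul_of_nonneg_left (hS.sum_sum_min_le hx U) hε
    _ = ε * (4 * C) * ∑ v ∈ U, x v := by ring

variable [Fintype V] {L : Finset V}

lemma mul_le_sum_one_sub_adjInd_mul (hx : ∀ v, 0 ≤ x v) (hheavy : ∀ l ∈ L, 1 - ε ≤ x l) {v : V}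
    (hv : v ∈ exceptional G L) :
    (1 - ε) * x v ≤ ∑ l ∈ L, (1 - adjInd G v l) * (x v * x l) := by
  obtain ⟨l, hl, hvl⟩ : ∃ l ∈ L, ¬ G.Adj l v := by
    simpa [mem_commonNb] using (mem_exceptional.1 hv).2
  calc (1 - ε) * x v ≤ x l * x v := mul_le_mul_of_nonneg_right (hheavy l hl) (hx v)
    _ = (1 - adjInd G v l) * (x v * x l) := by
      rw [adjInd_of_not_adj fun h => hvl h.symm]; ring
    _ ≤ ∑ l ∈ L, (1 - adjInd G v l) * (x v * x l) :=
      Finset.single_le_sum (f := fun l => (1 - adjInd G v l) * (x v * x l)) (fun l _ =>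
        mul_nonneg (sub_nonneg.2 (adjInd_le_one G v l)) (mul_nonneg (hx v) (hx l))) hl

lemma NoBip.sum_commonNb_le (hB : NoBip k m G) (hL : L.card = k) (hε : 0 ≤ ε)
    (hx : ∀ v, 0 ≤ x v) (hlight : ∀ v ∉ L, x v ≤ ε) {v : V} (hv : v ∉ L) :
    ∑ u ∈ commonNb G L, adjInd G v u * (x v * x u) ≤ ε * m * x v := by
  classical
  calc ∑ u ∈ commonNb G L, adjInd G v u * (x v * x u)
      ≤ ∑ u ∈ commonNb G L, adjInd G v u * (x v * ε) :=
        Finset.sum_le_sum fun u hu => mul_le_mul_of_nonneg_left (mul_le_mul_of_nonneg_left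
          (hlight u (notMem_of_mem_commonNb hu)) (hx v)) (adjInd_nonneg _ _ _)
    _ = (G.neighborFinset v ∩ commonNb G L).card * (x v * ε) := by
        rw [← Finset.sum_mul, sum_adjInd_eq_card]
    _ ≤ m * (x v * ε) :=
        mul_le_mul_of_nonneg_right (by exact_mod_cast (hB.card_inter_commonNb_lt hL hv).le)
          (mul_nonneg (hx v) hε)
    _ = ε * m * x v := by ring

lemma quadForm_add_le_cleaned (hS : Sparse C G) (hB : NoBip k m G) (hL : L.card = k)
    (hx : ∀ v, 0 ≤ x v) (hε0 : 0 ≤ ε) (hε : ε * (2 + 2 * m + 4 * C) ≤ 1)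
    (hheavy : ∀ l ∈ L, 1 - ε ≤ x l) (hlight : ∀ v ∉ L, x v ≤ ε) :
    quadForm G x + ∑ v ∈ exceptional G L, x v ≤ quadForm (cleaned G L) x := by
  have hout {v : V} (hv : v ∈ exceptional G L) : v ∉ L := (mem_exceptional.1 hv).1
  have hgain : (1 - ε) * ∑ v ∈ exceptional G L, x v
      ≤ ∑ v ∈ exceptional G L, ∑ l ∈ L, (1 - adjInd G v l) * (x v * x l) := by
    rw [Finset.mul_sum]
    exact Finset.sum_le_sum fun v hv => mul_le_sum_one_sub_adjInd_mul hx hheavy hv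
  have hcommon : ∑ v ∈ exceptional G L, ∑ u ∈ commonNb G L, adjInd G v u * (x v * x u)
      ≤ ε * m * ∑ v ∈ exceptional G L, x v := by
    rw [Finset.mul_sum]
    exact Finset.sum_le_sum fun v hv => hB.sum_commonNb_le hL hε0 hx hlight (hout hv)
  have hinside := hS.sum_sum_mul_le hε0 hx (U := exceptional G L) fun v hv => hlight v (hout hv)
  have hsmall : ε * (2 + 2 * m + 4 * C) * ∑ v ∈ exceptional G L, x v
      ≤ 1 * ∑ v ∈ exceptional G L, x v :=
    mul_le_mul_of_nonneg_right hε (Finset.sum_nonneg fun v _ => hx v)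
  linarith [quadForm_cleaned_sub (G := G) (L := L) x]

lemma IsPerron.quadForm_le_of_lambdaMax_le (hx : IsPerron G x) {H : SimpleGraph V}
    (hl : lambdaMax H ≤ lambdaMax G) : quadForm H x ≤ quadForm G x := by
  obtain ⟨z, -⟩ := hx.exists_eq_one
  have : Nonempty V := ⟨z⟩
  rw [quadForm_eq_mul_sum_sq hx.eigen]
  exact (quadForm_le_lambdaMax_mul H x).trans (mul_le_mul_of_nonneg_right hl hx.sum_sq_pos.le)

/-- A vertex of `R` has a neighbour of positive weight in `H`, hence positive weight itself as
soon as `x` is also an eigenvector of `H`. -/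
lemma IsPerron.eq_empty_of_quadForm_le (hx : IsPerron G x) {H : SimpleGraph V} {R : Finset V}
    (hQ : quadForm G x + ∑ v ∈ R, x v ≤ quadForm H x)
    (hR : ∀ v ∈ R, ∃ l, H.Adj v l ∧ 0 < x l) (hl : lambdaMax H ≤ lambdaMax G) : R = ∅ := by
  classical
  obtain ⟨z, -⟩ := hx.exists_eq_one
  have : Nonempty V := ⟨z⟩
  have hsum : ∑ v ∈ R, x v = 0 := le_antisymm
    (by linarith [hx.quadForm_le_of_lambdaMax_le hl]) (Finset.sum_nonneg fun v _ => hx.nonneg v)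
  have heigen : lambdaMax H * ∑ v, x v ^ 2 ≤ quadForm H x :=
    (mul_le_mul_of_nonneg_right hl hx.sum_sq_pos.le).trans
      (by linarith [quadForm_eq_mul_sum_sq hx.eigen])
  refine Finset.eq_empty_of_forall_notMem fun v hv => ?_
  have hv0 : x v = 0 := (Finset.sum_eq_zero_iff_of_nonneg fun v _ => hx.nonneg v).1 hsum v hv
  obtain ⟨l, hvl, hlpos⟩ := hR v hv
  have hpos : 0 < nbrSum H x v := Finset.sum_pos'
    (fun u _ => mul_nonneg (adjInd_nonneg _ _ _) (hx.nonneg u))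
    ⟨l, Finset.mem_univ l, by rwa [adjInd_of_adj hvl, one_mul]⟩
  rw [nbrSum_eq_of_lambdaMax_mul_le_quadForm H x heigen v, hv0, mul_zero] at hpos
  exact hpos.false

end Switching

section Join

variable {V W : Type*}

@[simp] lemma graphJoin_inl_inl {A : SimpleGraph V} {B : SimpleGraph W} {u v : V} :
    (graphJoin A B).Adj (Sum.inl u) (Sum.inl v) ↔ A.Adj u v := by simp [graphJoin]

@[simp] lemma graphJoin_inr_inr {A : SimpleGraph V} {B : SimpleGraph W} {u v : W} :
    (graphJoin A B).Adj (Sum.inr u) (Sum.inr v) ↔ B.Adj u v := by simp [graphJoin]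

@[simp] lemma graphJoin_inl_inr {A : SimpleGraph V} {B : SimpleGraph W} {u : V} {v : W} :
    (graphJoin A B).Adj (Sum.inl u) (Sum.inr v) := by simp [graphJoin]

@[simp] lemma graphJoin_inr_inl {A : SimpleGraph V} {B : SimpleGraph W} {u : V} {v : W} :
    (graphJoin A B).Adj (Sum.inr v) (Sum.inl u) := by simp [graphJoin]

lemma completeBipartiteGraph_le_graphJoin (A : SimpleGraph V) (B : SimpleGraph W) :
    completeBipartiteGraph V W ≤ graphJoin A B := le_sup_right

lemma graphJoin_mono {A A' : SimpleGraph V} {B B' : SimpleGraph W} (hA : A ≤ A') (hB : B ≤ B') :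
    graphJoin A B ≤ graphJoin A' B' := by
  rintro (u | u) (v | v) h
  · exact graphJoin_inl_inl.2 (hA (graphJoin_inl_inl.1 h))
  · exact graphJoin_inl_inr
  · exact graphJoin_inr_inl
  · exact graphJoin_inr_inr.2 (hB (graphJoin_inr_inr.1 h))

lemma graphJoin_isContained {V' W' : Type*} {A : SimpleGraph V} {B : SimpleGraph W}
    {A' : SimpleGraph V'} {B' : SimpleGraph W'} (hA : A.IsContained A') (hB : B.IsContained B') :
    (graphJoin A B).IsContained (graphJoin A' B') := by
  obtain ⟨f⟩ := hA
  obtain ⟨g⟩ := hB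
  refine ⟨⟨⟨Sum.map f g, ?_⟩, Sum.map_injective.2 ⟨f.injective, g.injective⟩⟩⟩
  rintro (u | u) (v | v) h
  · exact graphJoin_inl_inl.2 (f.toHom.map_adj (graphJoin_inl_inl.1 h))
  · exact graphJoin_inl_inr
  · exact graphJoin_inr_inl
  · exact graphJoin_inr_inr.2 (g.toHom.map_adj (graphJoin_inr_inr.1 h))

lemma graphJoin_comap_isContained {U : Type*} {G : SimpleGraph U} (f : V ↪ U) (g : W ↪ U)
    (hadj : ∀ v w, G.Adj (f v) (g w)) :
    (graphJoin (G.comap f) (G.comap g)).IsContained G := by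
  refine ⟨⟨⟨Sum.elim f g, ?_⟩, f.injective.sumElim g.injective fun v w => (hadj v w).ne⟩⟩
  rintro (u | u) (v | v) h
  · exact (graphJoin_inl_inl (A := G.comap f)).1 h
  · exact hadj u v
  · exact (hadj v u).symm
  · exact (graphJoin_inr_inr (B := G.comap g)).1 h

lemma numEdges_graphJoin [Fintype V] [Fintype W] (A : SimpleGraph V) (B : SimpleGraph W) :
    numEdges (graphJoin A B) = numEdges A + numEdges B + Fintype.card V * Fintype.card W := by
  have hinl (u v) : adjInd (graphJoin A B) (Sum.inl u) (Sum.inl v) = adjInd A u v :=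
    adjInd_congr graphJoin_inl_inl
  have hinr (u v) : adjInd (graphJoin A B) (Sum.inr u) (Sum.inr v) = adjInd B u v :=
    adjInd_congr graphJoin_inr_inr
  have hcross (u v) : adjInd (graphJoin A B) (Sum.inl u) (Sum.inr v) = 1 :=
    adjInd_of_adj graphJoin_inl_inr
  have hcross' (u v) : adjInd (graphJoin A B) (Sum.inr u) (Sum.inl v) = 1 :=
    adjInd_of_adj graphJoin_inr_inl
  have hsum := sum_sum_adjInd (graphJoin A B)
  simp only [Fintype.sum_sum_type, hinl, hinr, hcross, hcross', Finset.sum_add_distrib,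
    sum_sum_adjInd, Finset.sum_const, Finset.card_univ, nsmul_eq_mul, mul_one] at hsum
  rify
  linarith

end Join

section EdgeCount

lemma numEdges_map {V W : Type*} (f : V ↪ W) (G : SimpleGraph V) :
    numEdges (G.map f) = numEdges G := by
  rw [numEdges, SimpleGraph.edgeSet_map]
  exact Set.ncard_image_of_injective _ f.sym2Map.injective

lemma numEdges_comap_equiv {V W : Type*} {G : SimpleGraph V} {U : Finset V} (e : W ≃ U) :
    numEdges (G.comap fun i => (e i : V)) = numEdges (within G U) := by
  let f : W ↪ V := e.toEmbedding.trans (Function.Embedding.subtype _)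
  rw [← numEdges_map f (G.comap fun i => (e i : V))]
  congr 1
  ext u v
  rw [SimpleGraph.map_adj, within_adj]
  constructor
  · rintro ⟨i, j, hij, rfl, rfl⟩
    exact ⟨hij, (e i).2, (e j).2⟩
  · rintro ⟨huv, hu, hv⟩
    exact ⟨e.symm ⟨u, hu⟩, e.symm ⟨v, hv⟩, by simpa using huv, by simp [f], by simp [f]⟩

lemma two_mul_numEdges_top (V : Type*) [Fintype V] :
    2 * (numEdges (⊤ : SimpleGraph V) : ℝ) = Fintype.card V * (Fintype.card V - 1) := by
  classical
  rw [← sum_sum_adjInd]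
  have hadj (u v : V) : adjInd (⊤ : SimpleGraph V) u v = 1 - if u = v then 1 else 0 := by
    by_cases h : u = v <;> simp [adjInd, h]
  simp only [hadj, Finset.sum_sub_distrib, Finset.sum_ite_eq, Finset.mem_univ, if_true,
    Finset.sum_const, Finset.card_univ, nsmul_eq_mul]
  ring

lemma two_mul_numEdges_cliqueOn {V : Type*} (U : Finset V) :
    2 * (numEdges (cliqueOn U) : ℝ) = U.card * (U.card - 1) := by
  have htop : within ⊤ U = cliqueOn U := top_inf_eq _
  have hcomap : (⊤ : SimpleGraph V).comap (fun i => (Equiv.refl U i : V)) = ⊤ := by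
    ext u v
    simp
  rw [← htop, ← numEdges_comap_equiv (Equiv.refl U), hcomap, two_mul_numEdges_top,
    Fintype.card_coe]

lemma quadForm_le_of_adj_le {V : Type*} [Fintype V] {A : SimpleGraph V} {x : V → ℝ}
    (hx : ∀ v, 0 ≤ x v) {ε : ℝ} (h : ∀ u v, A.Adj u v → x u ≤ ε) :
    quadForm A x ≤ 2 * ε ^ 2 * numEdges A := by
  calc quadForm A x ≤ ∑ u, ∑ v, adjInd A u v * ε ^ 2 := by
        refine Finset.sum_le_sum fun u _ => Finset.sum_le_sum fun v _ => ?_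
        by_cases hA : A.Adj u v
        · rw [adjInd_of_adj hA, one_mul, one_mul, sq]
          exact mul_le_mul (h u v hA) (h v u hA.symm) (hx v) ((hx u).trans (h u v hA))
        · simp [adjInd_of_not_adj hA]
    _ = (∑ u, ∑ v, adjInd A u v) * ε ^ 2 := by simp only [Finset.sum_mul]
    _ = 2 * ε ^ 2 * numEdges A := by rw [sum_sum_adjInd]; ring

lemma le_quadForm_of_adj_le {V : Type*} [Fintype V] {A : SimpleGraph V} {x : V → ℝ} {ε : ℝ}
    (hε : 0 ≤ ε) (h : ∀ u v, A.Adj u v → ε ≤ x u) :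
    2 * ε ^ 2 * numEdges A ≤ quadForm A x := by
  calc 2 * ε ^ 2 * numEdges A = (∑ u, ∑ v, adjInd A u v) * ε ^ 2 := by rw [sum_sum_adjInd]; ring
    _ = ∑ u, ∑ v, adjInd A u v * ε ^ 2 := by simp only [Finset.sum_mul]
    _ ≤ quadForm A x := by
        refine Finset.sum_le_sum fun u _ => Finset.sum_le_sum fun v _ => ?_
        by_cases hA : A.Adj u v
        · rw [adjInd_of_adj hA, one_mul, one_mul, sq]
          exact mul_le_mul (h u v hA) (h v u hA.symm) hε (hε.trans (h u v hA))
        · simp [adjInd_of_not_adj hA]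

end EdgeCount

section Extremal

variable {V W U : Type*} {F : GraphFamily} {H : SimpleGraph W} {B : SimpleGraph U}

lemma MemUpToIso.numEdges_le {n : ℕ} (hH : MemUpToIso H (EXContaining B F n)) [Fintype V]
    (hn : Fintype.card V = n) {G : SimpleGraph V} (hG : FamilyFree F G) (hB : B.IsContained G) :
    numEdges G ≤ numEdges H := by
  obtain ⟨H', ⟨-, hmax⟩, ⟨iso⟩⟩ := hH
  let e : G.comap (Fintype.equivFinOfCardEq hn).symm ≃g G := SimpleGraph.Iso.comap _ G
  rw [← numEdges_congr iso, ← numEdges_congr e]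
  exact hmax _ ((FamilyFree.congr e).2 hG) (hB.trans e.symm.isContained)

lemma numEdges_within_add_le [Fintype V] {k : ℕ} {G : SimpleGraph V} (hG : FamilyFree F G)
    {L : Finset V} (hL : L.card = k)
    (hH : MemUpToIso H (EXContaining (Kbip k (k + (commonNb G L).card - k)) F
      (k + (commonNb G L).card))) :
    numEdges (within G L) + numEdges (within G (commonNb G L)) + k * (commonNb G L).card
      ≤ numEdges H := by
  rw [Nat.add_sub_cancel_left] at hH
  let e : Fin k ≃ L := (L.equivFinOfCardEq hL).symm
  let e' : Fin (commonNb G L).card ≃ commonNb G L := (commonNb G L).equivFin.symm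
  let J := graphJoin (G.comap fun i => (e i : V)) (G.comap fun i => (e' i : V))
  have hJG : J.IsContained G :=
    graphJoin_comap_isContained (e.toEmbedding.trans (.subtype _))
      (e'.toEmbedding.trans (.subtype _)) fun i j => mem_commonNb.1 (e' j).2 _ (e i).2
  have hJ : numEdges J = numEdges (within G L) + numEdges (within G (commonNb G L))
      + k * (commonNb G L).card := by
    rw [numEdges_graphJoin, numEdges_comap_equiv, numEdges_comap_equiv, Fintype.card_fin,
      Fintype.card_fin]
  rw [← hJ]
  exact hH.numEdges_le (by simp) (hG.of_isContained hJG)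
    (.of_le (completeBipartiteGraph_le_graphJoin _ _))

end Extremal

section Split

lemma exists_equiv_mem_notMem {V : Type*} [Fintype V] {L : Finset V} {k n : ℕ} (hL : L.card = k)
    (hn : Fintype.card V = n) :
    ∃ e : Fin k ⊕ Fin (n - k) ≃ V, (∀ i, e (Sum.inl i) ∈ L) ∧ ∀ j, e (Sum.inr j) ∉ L := by
  classical
  have hcompl : Fintype.card {v // v ∉ L} = n - k := by
    rw [Fintype.card_subtype_compl, Fintype.card_coe, hL, hn]
  let e₁ : Fin k ≃ {v // v ∈ L} := (L.equivFinOfCardEq hL).symm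
  let e₂ : Fin (n - k) ≃ {v // v ∉ L} := (Fintype.equivFinOfCardEq hcompl).symm
  refine ⟨(Equiv.sumCongr e₁ e₂).trans (Equiv.sumCompl (· ∈ L)), fun i => ?_, fun j => ?_⟩
  · simp
  · simpa using (e₂ j).2

/-- A graph in which every vertex of `L` is adjacent to every vertex outside `L` is the join of
its two parts; the parts are indexed along an equivalence `e`. -/
def graphJoinIso {V U W : Type*} {L : Finset V} {H : SimpleGraph V} (e : U ⊕ W ≃ V)
    (hinl : ∀ i, e (Sum.inl i) ∈ L) (hinr : ∀ j, e (Sum.inr j) ∉ L) (hH : crossOn L ≤ H) :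
    graphJoin (H.comap (e ∘ Sum.inl)) (H.comap (e ∘ Sum.inr)) ≃g H where
  toEquiv := e
  map_rel_iff' := by
    rintro (u | u) (v | v)
    · simp
    · simp only [graphJoin_inl_inr, iff_true]
      exact hH (Or.inl ⟨hinl u, hinr v⟩)
    · simp only [graphJoin_inr_inl, iff_true]
      exact hH (Or.inr ⟨hinr u, hinl v⟩)
    · simp

variable {V : Type*} [Fintype V] {L : Finset V} {k n : ℕ}

lemma nonempty_iso_Kbip (hL : L.card = k) (hn : Fintype.card V = n) :
    Nonempty (crossOn L ≃g Kbip k (n - k)) := by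
  obtain ⟨e, hinl, hinr⟩ := exists_equiv_mem_notMem hL hn
  refine ⟨RelIso.symm ⟨e, ?_⟩⟩
  rintro (u | u) (v | v) <;> simp [crossOn_adj, hinl, hinr]

lemma nonempty_iso_cliqueJoinEmpty (hL : L.card = k) (hn : Fintype.card V = n) :
    Nonempty (crossOn L ⊔ cliqueOn L ≃g cliqueJoinEmpty k n) := by
  obtain ⟨e, hinl, hinr⟩ := exists_equiv_mem_notMem hL hn
  refine ⟨RelIso.symm ⟨e, ?_⟩⟩
  rintro (u | u) (v | v) <;> simp [crossOn_adj, cliqueOn_adj, hinl, hinr]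

lemma nonempty_iso_cliqueJoinEdge (hL : L.card = k) (hn : Fintype.card V = n) {P : Finset V}
    (hP : P.card = 2) (hPL : Disjoint P L) :
    Nonempty (crossOn L ⊔ cliqueOn L ⊔ cliqueOn P ≃g cliqueJoinEdge k n) := by
  classical
  obtain ⟨e, hinl, hinr⟩ := exists_equiv_mem_notMem hL hn
  have hinlP (i : Fin k) : e (Sum.inl i) ∉ P :=
    fun h => Finset.disjoint_left.1 hPL h (hinl i)
  set P' : Finset (Fin (n - k)) := {j | e (Sum.inr j) ∈ P} with hP'
  have hP'card : P'.card = 2 := by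
    rw [← hP, ← Finset.card_map (Function.Embedding.inr.trans e.toEmbedding)]
    congr 1
    ext v
    obtain ⟨i | j, rfl⟩ := e.surjective v <;> simp [hP', hinlP]
  obtain ⟨e', hinl', hinr'⟩ := exists_equiv_mem_notMem hP'card (Fintype.card_fin (n - k))
  simp only [hP', Finset.mem_filter_univ] at hinl' hinr'
  refine ⟨RelIso.symm ⟨(Equiv.sumCongr (Equiv.refl _) e').trans e, ?_⟩⟩
  rintro (u | u | u) (v | v | v) <;>
    simp [crossOn_adj, cliqueOn_adj, hinl, hinr, hinl', hinr', hinlP]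

end Split

section Missing

variable {V : Type*}

/-- The edges missing inside `L`. -/
def missing (G : SimpleGraph V) (L : Finset V) : SimpleGraph V := cliqueOn L \ G

lemma within_sup_missing (G : SimpleGraph V) (L : Finset V) :
    within G L ⊔ missing G L = cliqueOn L := by
  rw [within, inf_comm]
  exact sup_inf_sdiff _ _

lemma disjoint_within_missing (G : SimpleGraph V) (L : Finset V) :
    Disjoint (within G L) (missing G L) :=
  disjoint_sdiff_self_right.mono_left inf_le_left

lemma numEdges_cliqueOn [Finite V] (G : SimpleGraph V) (L : Finset V) :
    numEdges (cliqueOn L) = numEdges (within G L) + numEdges (missing G L) := by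
  rw [← within_sup_missing G L, numEdges_sup (disjoint_within_missing G L)]

lemma numEdges_cliqueOn_of_card_eq_two {P : Finset V} (hP : P.card = 2) :
    numEdges (cliqueOn P) = 1 := by
  have htwo := two_mul_numEdges_cliqueOn P
  rw [hP] at htwo
  push_cast at htwo
  rify
  linarith

lemma exists_card_eq_two_cliqueOn_le (G : SimpleGraph V) {S : Finset V} (hS : 2 ≤ S.card) :
    ∃ P ⊆ S, P.card = 2 ∧ (within G S = ⊥ ∨ cliqueOn P ≤ within G S) := by
  classical
  by_cases hbot : within G S = ⊥
  · obtain ⟨P, hPS, hP⟩ := Finset.exists_subset_card_eq hS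
    exact ⟨P, hPS, hP, Or.inl hbot⟩
  · obtain ⟨u, v, huv⟩ := SimpleGraph.ne_bot_iff_exists_adj.1 hbot
    refine ⟨{u, v}, ?_, Finset.card_pair huv.ne, Or.inr fun a b hab => ?_⟩
    · simp [Finset.insert_subset_iff, huv.2.2.1, huv.2.2.2]
    · obtain ⟨hne, ha, hb⟩ := hab
      rw [Finset.mem_insert, Finset.mem_singleton] at ha hb
      rcases ha with rfl | rfl <;> rcases hb with rfl | rfl
      exacts [absurd rfl hne, huv, huv.symm, absurd rfl hne]

end Missing

section CoreStructure

variable {V : Type*} [Fintype V] {k : ℕ} {G : SimpleGraph V} {x : V → ℝ} {L : Finset V}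

/-- `L` consists of `k` vertices that carry almost all the weight of the Perron vector `x` of `G`
and are adjacent to almost everything; replacing `G` by `cleaned G L` does not decrease its
quadratic form at `x`, and strictly increases it where `x` charges an exceptional vertex. -/
structure IsCore (k : ℕ) (G : SimpleGraph V) (x : V → ℝ) (L : Finset V) : Prop where
  perron : IsPerron G x
  card_eq : L.card = k
  heavy : ∀ l ∈ L, 3 / 4 ≤ x l
  light : ∀ v ∉ L, x v ≤ 1 / 4
  card_exceptional_le : ((exceptional G L).card : ℝ) ≤ 1 / 4 * Fintype.card V
  quadForm_add_le : quadForm G x + ∑ v ∈ exceptional G L, x v ≤ quadForm (cleaned G L) x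

lemma exists_isCore (k m : ℕ) (hk : 1 ≤ k) {C : ℝ} (hC : 1 ≤ C) :
    ∃ K : ℝ, ∀ (V : Type) [Fintype V] (G : SimpleGraph V) (x : V → ℝ), IsPerron G x →
      Sparse C G → NoBip k m G → K ≤ lambdaMax G → K ≤ Fintype.card V →
      k * ((Fintype.card V : ℝ) - k) ≤ lambdaMax G ^ 2 → ∃ L : Finset V, IsCore k G x L := by
  have : 0 < 4 + 2 * (m : ℝ) + 4 * C := by positivity
  obtain ⟨ε, hε0, hε⟩ : ∃ ε : ℝ, 0 < ε ∧ ε * (4 + 2 * m + 4 * C) = 1 :=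
    ⟨1 / (4 + 2 * m + 4 * C), by positivity, by field_simp⟩
  have hε4 : ε ≤ 1 / 4 := by
    have : 0 ≤ ε * (2 * m + 4 * C) := by positivity
    linarith
  obtain ⟨K, hK⟩ := exists_core k m hk hC hε0 (by linarith)
  refine ⟨K, fun V _ G x hx hS hB hKl hKn hl2 => ?_⟩
  obtain ⟨L, hcard, hheavy, hlight, hexc⟩ := hK V G x hx hS hB hKl hKn hl2
  exact ⟨L, hx, hcard, fun l hl => by linarith [hheavy l hl],
    fun v hv => (hlight v hv).trans hε4, hexc.trans (by gcongr),
    quadForm_add_le_cleaned hS hB hcard hx.nonneg hε0.le (by linarith) hheavy hlight⟩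

lemma card_eq_add (G : SimpleGraph V) (L : Finset V) :
    Fintype.card V = L.card + (commonNb G L).card + (exceptional G L).card := by
  have hsum := sum_univ_eq_sum_add_sum_add_sum G L fun _ => 1
  simp only [Finset.sum_const, nsmul_eq_mul, mul_one, Finset.card_univ] at hsum
  exact_mod_cast hsum

lemma IsCore.le_card_commonNb (h : IsCore k G x L) :
    (Fintype.card V : ℝ) / 2 - k ≤ (commonNb G L).card := by
  have hcard : (Fintype.card V : ℝ) = L.card + (commonNb G L).card + (exceptional G L).card := by
    exact_mod_cast card_eq_add G L
  rw [h.card_eq] at hcard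
  linarith [h.card_exceptional_le, Nat.cast_nonneg (α := ℝ) (Fintype.card V)]

lemma IsCore.cleaned_eq (h : IsCore k G x L) {H : SimpleGraph V} (hH : crossOn L ≤ H)
    (hQ : quadForm (cleaned G L) x ≤ quadForm H x) (hl : lambdaMax H ≤ lambdaMax G) :
    cleaned G L = G := by
  refine cleaned_eq_of_exceptional_eq_empty <|
    h.perron.eq_empty_of_quadForm_le (h.quadForm_add_le.trans hQ) (fun v hv => ?_) hl
  obtain ⟨hvL, l, hl, -⟩ : v ∉ L ∧ ∃ l ∈ L, ¬ G.Adj l v := by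
    simpa [mem_exceptional, mem_commonNb] using hv
  exact ⟨l, hH (Or.inr ⟨hvL, hl⟩), by linarith [h.heavy l hl]⟩

lemma IsCore.eq_crossOn (h : IsCore k G x L)
    (hedges : numEdges (within G L) + numEdges (within G (commonNb G L)) = 0)
    (hl : lambdaMax (crossOn L) ≤ lambdaMax G) : G = crossOn L := by
  have hcleaned : cleaned G L = crossOn L := by
    rw [cleaned, eq_bot_of_numEdges_eq_zero (A := within G L) (by omega),
      eq_bot_of_numEdges_eq_zero (A := within G (commonNb G L)) (by omega), sup_bot_eq, sup_bot_eq]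
  rw [← hcleaned, h.cleaned_eq le_rfl (by rw [hcleaned]) hl]

lemma quadForm_cliqueOn (G : SimpleGraph V) (L : Finset V) (x : V → ℝ) :
    quadForm (cliqueOn L) x = quadForm (within G L) x + quadForm (missing G L) x := by
  rw [← within_sup_missing G L, quadForm_sup (disjoint_within_missing G L)]

lemma IsCore.le_quadForm_missing (h : IsCore k G x L) :
    9 / 8 * (numEdges (missing G L) : ℝ) ≤ quadForm (missing G L) x := by
  have hadj (u v : V) (huv : (missing G L).Adj u v) : 3 / 4 ≤ x u := h.heavy u huv.1.2.1
  linarith [le_quadForm_of_adj_le (by norm_num) hadj]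

lemma IsCore.quadForm_within_commonNb_le (h : IsCore k G x L) {A : SimpleGraph V}
    (hA : A ≤ within G (commonNb G L)) : quadForm A x ≤ 1 / 8 * numEdges A := by
  have hadj (u v : V) (huv : A.Adj u v) : x u ≤ 1 / 4 :=
    h.light u (notMem_of_mem_commonNb (hA huv).2.2.1)
  linarith [quadForm_le_of_adj_le h.perron.nonneg hadj]

lemma quadForm_crossOn_sup_cliqueOn (L : Finset V) (x : V → ℝ) :
    quadForm (crossOn L ⊔ cliqueOn L) x = quadForm (crossOn L) x + quadForm (cliqueOn L) x :=
  quadForm_sup (disjoint_crossOn_cliqueOn (Or.inl subset_rfl)) x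

lemma IsCore.eq_sup_of_quadForm_add_le (h : IsCore k G x L) {H : SimpleGraph V}
    (hH : crossOn L ≤ H)
    (hQ : quadForm (cleaned G L) x + numEdges (missing G L) ≤ quadForm H x)
    (hl : lambdaMax H ≤ lambdaMax G) :
    numEdges (missing G L) = 0 ∧ G = crossOn L ⊔ cliqueOn L ⊔ within G (commonNb G L) := by
  have hcleaned := h.cleaned_eq hH (by linarith [Nat.cast_nonneg (α := ℝ) (numEdges (missing G L))])
    hl
  have hmissing : numEdges (missing G L) = 0 := by
    have hle : (numEdges (missing G L) : ℝ) ≤ (0 : ℕ) := by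
      rw [hcleaned] at hQ
      linarith [h.perron.quadForm_le_of_lambdaMax_le hl, Nat.cast_zero (R := ℝ)]
    exact Nat.le_zero.1 (Nat.cast_le.1 hle)
  refine ⟨hmissing, ?_⟩
  nth_rewrite 1 [← hcleaned]
  rw [cleaned, ← within_sup_missing G L, eq_bot_of_numEdges_eq_zero hmissing, sup_bot_eq, sup_assoc]

lemma IsCore.eq_crossOn_sup_cliqueOn (h : IsCore k G x L)
    (hedges : numEdges (within G L) + numEdges (within G (commonNb G L)) ≤ numEdges (cliqueOn L))
    (hl : lambdaMax (crossOn L ⊔ cliqueOn L) ≤ lambdaMax G) : G = crossOn L ⊔ cliqueOn L := by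
  rw [numEdges_cliqueOn G L] at hedges
  have hle : (numEdges (within G (commonNb G L)) : ℝ) ≤ numEdges (missing G L) := by
    exact_mod_cast (by omega)
  have hQ : quadForm (cleaned G L) x + numEdges (missing G L)
      ≤ quadForm (crossOn L ⊔ cliqueOn L) x := by
    rw [quadForm_cleaned, quadForm_crossOn_sup_cliqueOn, quadForm_cliqueOn G]
    linarith [h.le_quadForm_missing, h.quadForm_within_commonNb_le le_rfl]
  obtain ⟨hmissing, hG⟩ := h.eq_sup_of_quadForm_add_le le_sup_left hQ hl
  rwa [eq_bot_of_numEdges_eq_zero (A := within G (commonNb G L)) (by omega), sup_bot_eq] at hG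

lemma IsCore.pos_of_mem_commonNb (h : IsCore k G x L) (hk : 1 ≤ k) (hl : 0 < lambdaMax G) {v : V}
    (hv : v ∈ commonNb G L) : 0 < x v := by
  classical
  obtain ⟨l, hlL⟩ : L.Nonempty := Finset.card_pos.1 (h.card_eq ▸ hk)
  have hle : x l ≤ lambdaMax G * x v := by
    rw [h.perron.lambdaMax_mul]
    exact Finset.single_le_sum (fun u _ => h.perron.nonneg u)
      ((G.mem_neighborFinset v l).2 (mem_commonNb.1 hv l hlL).symm)
  exact pos_of_mul_pos_right (by linarith [h.heavy l hlL]) hl.le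

lemma quadForm_cliqueOn_pos {P : Finset V} (hP : P.card = 2) (hpos : ∀ v ∈ P, 0 < x v) :
    0 < quadForm (cliqueOn P) x := by
  obtain ⟨w, hw, hmin⟩ := P.exists_min_image x (Finset.card_pos.1 (by omega))
  have hle := le_quadForm_of_adj_le (A := cliqueOn P) (hpos w hw).le fun u _ huv => hmin u huv.2.1
  rw [numEdges_cliqueOn_of_card_eq_two hP] at hle
  exact lt_of_lt_of_le (by have := hpos w hw; positivity) hle

/-- All edges of `within G (commonNb G L)` other than the one on `P` are compensated by edges
missing inside `L`, which weigh much more. -/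
lemma IsCore.quadForm_within_commonNb_le_cliqueOn (h : IsCore k G x L) {P : Finset V}
    (hP : P.card = 2)
    (hPS : within G (commonNb G L) = ⊥ ∨ cliqueOn P ≤ within G (commonNb G L))
    (hpos : 0 ≤ quadForm (cliqueOn P) x)
    (hedges : numEdges (within G (commonNb G L)) ≤ numEdges (missing G L) + 1) :
    quadForm (within G (commonNb G L)) x
      ≤ quadForm (cliqueOn P) x + 1 / 8 * numEdges (missing G L) := by
  set A := within G (commonNb G L) \ cliqueOn P with hA
  rcases hPS with hbot | hle
  · have hle := h.quadForm_within_commonNb_le le_rfl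
    rw [hbot, numEdges_bot, Nat.cast_zero, mul_zero] at hle
    rw [hbot]
    exact hle.trans (by positivity)
  · have hsup : within G (commonNb G L) = cliqueOn P ⊔ A := (sup_sdiff_cancel_right hle).symm
    have hdisj : Disjoint (cliqueOn P) A := disjoint_sdiff_self_right
    have hcard : (numEdges A : ℝ) ≤ numEdges (missing G L) := by
      rw [hsup, numEdges_sup hdisj, numEdges_cliqueOn_of_card_eq_two hP] at hedges
      exact_mod_cast (by omega)
    have hform := h.quadForm_within_commonNb_le (A := A) sdiff_le
    rw [hsup, quadForm_sup hdisj]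
    linarith

lemma IsCore.eq_crossOn_sup_cliqueOn_sup_cliqueOn (h : IsCore k G x L) (hk : 1 ≤ k)
    (hlpos : 0 < lambdaMax G)
    (hedges : numEdges (within G L) + numEdges (within G (commonNb G L))
      ≤ numEdges (cliqueOn L) + 1)
    (hS : 2 ≤ (commonNb G L).card)
    (hl : ∀ P : Finset V, P.card = 2 → Disjoint P L →
      lambdaMax (crossOn L ⊔ cliqueOn L ⊔ cliqueOn P) ≤ lambdaMax G) :
    ∃ P : Finset V, P.card = 2 ∧ Disjoint P L ∧ G = crossOn L ⊔ cliqueOn L ⊔ cliqueOn P := by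
  rw [numEdges_cliqueOn G L] at hedges
  obtain ⟨P, hPS, hP, hbot_or_le⟩ := exists_card_eq_two_cliqueOn_le G hS
  have hPL : Disjoint P L := Finset.disjoint_of_subset_left hPS disjoint_commonNb
  have hpos : 0 < quadForm (cliqueOn P) x :=
    quadForm_cliqueOn_pos hP fun v hv => h.pos_of_mem_commonNb hk hlpos (hPS hv)
  have hdisj : Disjoint (crossOn L ⊔ cliqueOn L) (cliqueOn P) := by
    rw [disjoint_sup_left]
    exact ⟨disjoint_crossOn_cliqueOn (Or.inr hPL), disjoint_cliqueOn hPL.symm⟩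
  have hQ : quadForm (cleaned G L) x + numEdges (missing G L)
      ≤ quadForm (crossOn L ⊔ cliqueOn L ⊔ cliqueOn P) x := by
    rw [quadForm_cleaned, quadForm_sup hdisj, quadForm_crossOn_sup_cliqueOn, quadForm_cliqueOn G]
    linarith [h.le_quadForm_missing,
      h.quadForm_within_commonNb_le_cliqueOn hP hbot_or_le hpos.le (by omega)]
  obtain ⟨hmissing, hG⟩ := h.eq_sup_of_quadForm_add_le (le_sup_left.trans le_sup_left) hQ
    (hl P hP hPL)
  refine ⟨P, hP, hPL, ?_⟩
  rcases hbot_or_le with hbot | hle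
  · rw [hbot, sup_bot_eq] at hG
    have hform := h.perron.quadForm_le_of_lambdaMax_le (hl P hP hPL)
    rw [quadForm_sup hdisj, ← hG] at hform
    linarith
  · have hcard := numEdges_sup (disjoint_sdiff_self_right (x := cliqueOn P)
      (y := within G (commonNb G L)))
    rw [sup_sdiff_cancel_right hle, numEdges_cliqueOn_of_card_eq_two hP] at hcard
    rwa [← sup_sdiff_cancel_right hle, eq_bot_of_numEdges_eq_zero
      (A := within G (commonNb G L) \ cliqueOn P) (by omega), sup_bot_eq] at hG

end CoreStructure

section Redirect

lemma exists_injOn_redirect {V : Type*} (I : Finset V) {R S : Finset V}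
    (hRS : Disjoint R S)
    (hIS : I.card ≤ S.card) :
    ∃ f : V → V, Set.InjOn f I ∧ (∀ v ∉ R, f v = v) ∧ ∀ v ∈ I, v ∈ R → f v ∈ S := by
  classical
  have hcard : (I ∩ R).card ≤ (S \ I).card := by
    have hdisj : Disjoint (I ∩ R) (I ∩ S) := hRS.mono Finset.inter_subset_right
      Finset.inter_subset_right
    have hle : (I ∩ R ∪ I ∩ S).card ≤ I.card :=
      Finset.card_le_card (Finset.union_subset Finset.inter_subset_left Finset.inter_subset_left)
    rw [Finset.card_union_of_disjoint hdisj, Finset.inter_comm I S] at hle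
    have := Finset.card_sdiff_add_card_inter S I
    omega
  obtain ⟨g⟩ : Nonempty ((I ∩ R : Finset V) ↪ (S \ I : Finset V)) :=
    Function.Embedding.nonempty_of_card_le (by rwa [Fintype.card_coe, Fintype.card_coe])
  have hg (v) : (g v : V) ∈ S ∧ (g v : V) ∉ I := Finset.mem_sdiff.1 (g v).2
  refine ⟨fun v => if h : v ∈ I ∩ R then g ⟨v, h⟩ else v, fun a ha b hb hab => ?_,
    fun v hv => dif_neg fun h => hv (Finset.mem_inter.1 h).2, fun v hvI hvR => ?_⟩
  · simp only at hab
    split_ifs at hab with haR hbR hbR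
    · simpa using g.injective (Subtype.ext hab)
    · exact absurd (hab ▸ hb) (hg ⟨a, haR⟩).2
    · exact absurd (hab ▸ ha) (hg ⟨b, hbR⟩).2
    · exact hab
  · simp only [dif_pos (Finset.mem_inter.2 ⟨hvI, hvR⟩)]
    exact (hg _).1

/-- The exceptional vertices used by a copy of a forbidden graph in `cleaned G L` can be replaced
by unused common neighbours of `L`, which gives a copy in `G`. -/
lemma familyFree_cleaned {V : Type*} [Fintype V] {F : GraphFamily} {G : SimpleGraph V}
    (hG : FamilyFree F G) {L : Finset V}
    (hF : ∀ A ∈ F, A.1 ≤ (commonNb G L).card) : FamilyFree F (cleaned G L) := by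
  classical
  rintro A hA ⟨f⟩
  have hdisj : Disjoint (exceptional G L) (commonNb G L) :=
    Finset.disjoint_left.2 fun v hv => (mem_exceptional.1 hv).2
  have hcard : (Finset.univ.image f).card ≤ (commonNb G L).card := by
    rw [Finset.card_image_of_injective _ (show Function.Injective f from f.injective),
      Finset.card_univ, Fintype.card_fin]
    exact hF A hA
  obtain ⟨g, hinj, hfix, hmove⟩ := exists_injOn_redirect _ hdisj hcard
  have hmem (a) : f a ∈ Finset.univ.image f := Finset.mem_image_of_mem f (Finset.mem_univ a)
  have hadj (a b) (ha : f a ∈ exceptional G L) (hab : (cleaned G L).Adj (f a) (f b)) :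
      G.Adj (g (f a)) (g (f b)) := by
    rw [cleaned_adj_iff_of_mem_exceptional ha] at hab
    rw [hfix (f b) fun hb => (mem_exceptional.1 hb).1 hab]
    exact (mem_commonNb.1 (hmove _ (hmem a) ha) _ hab).symm
  refine hG A hA ⟨⟨⟨fun a => g (f a), fun {a b} hab => ?_⟩, fun a b hab => ?_⟩⟩
  · have hab' : (cleaned G L).Adj (f a) (f b) := f.toHom.map_adj hab
    by_cases ha : f a ∈ exceptional G L
    · exact hadj a b ha hab'
    by_cases hb : f b ∈ exceptional G L
    · exact (hadj b a hb hab'.symm).symm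
    rw [hfix _ ha, hfix _ hb]
    exact (cleaned_adj_iff_of_notMem_exceptional ha hb).1 hab'
  · exact f.injective (hinj (hmem a) (hmem b) hab)

lemma NoBip.deg_le {W : Type*} [Finite W] {k m : ℕ} {A : SimpleGraph (Fin k)}
    {Y : SimpleGraph W} (h : NoBip k m (graphJoin A Y)) (v : W) : deg Y v ≤ m := by
  classical
  have := Fintype.ofFinite W
  have hlt := h (insert (Sum.inr v) (Finset.univ.map Function.Embedding.inl))
    ((Y.neighborFinset v).map Function.Embedding.inr) ?_ ?_
  · rw [Finset.card_map, card_neighborFinset_eq_deg] at hlt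
    exact hlt.le
  · rw [Finset.card_insert_of_notMem (by simp), Finset.card_map, Finset.card_univ,
      Fintype.card_fin]
  · intro t ht s hs
    obtain ⟨u, hu, rfl⟩ := Finset.mem_map.1 hs
    rcases Finset.mem_insert.1 ht with rfl | ht
    · exact graphJoin_inr_inr.2 ((Y.mem_neighborFinset v u).1 hu)
    · obtain ⟨i, -, rfl⟩ := Finset.mem_map.1 ht
      exact graphJoin_inl_inr

end Redirect

section ExplicitExtremal

variable {F : GraphFamily} {k n : ℕ}

lemma sqrt_mul_le_lambdaMax_of_mem_SPEX (hk : 1 ≤ k) (hn : k < n) {G H : SimpleGraph (Fin n)}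
    (hG : G ∈ SPEX F n) (hH : FamilyFree F H) (hKH : (Kbip k (n - k)).IsContained H) :
    √(k * ((n : ℝ) - k)) ≤ lambdaMax G := by
  have : Nonempty (Fin k ⊕ Fin (n - k)) := ⟨Sum.inl ⟨0, hk⟩⟩
  rw [← Nat.cast_sub hn.le]
  exact (sqrt_mul_le_lambdaMax_Kbip hk (by omega)).trans
    ((lambdaMax_le_of_isContained hKH).trans (hG.2 H hH))

lemma eventually_exists_isCore {m : ℕ} {C : ℝ} (hk : 1 ≤ k) (hC : 1 ≤ C)
    (hS : ∀ (V : Type) (G : SimpleGraph V), FamilyFree F G → Sparse C G)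
    (hB : ∀ (V : Type) (G : SimpleGraph V), FamilyFree F G → NoBip k m G) (K : ℝ) :
    ∀ᶠ n : ℕ in atTop, ∀ G ∈ SPEX F n,
      (∃ H : SimpleGraph (Fin n), FamilyFree F H ∧ (Kbip k (n - k)).IsContained H) →
      ∃ x L, IsCore k G x L ∧ K ≤ lambdaMax G ∧ (n : ℝ) ≤ 2 * lambdaMax G ^ 2 := by
  obtain ⟨K₁, hK₁⟩ := exists_isCore k m hk hC
  have hcast (r : ℝ) : ∀ᶠ n : ℕ in atTop, r ≤ n :=
    tendsto_natCast_atTop_atTop.eventually_ge_atTop r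
  filter_upwards [hcast (2 * K ^ 2), hcast (2 * K₁ ^ 2), hcast K₁, hcast (2 * k + 1)] with
    n hnK hnK₁ hnK₁' hnk G hG ⟨H, hHF, hKH⟩
  have hkn : 2 * k + 1 ≤ n := by exact_mod_cast hnk
  have : Nonempty (Fin n) := ⟨⟨0, by omega⟩⟩
  have hsqrt := sqrt_mul_le_lambdaMax_of_mem_SPEX hk (by omega) hG hHF hKH
  have hhalf : (n : ℝ) / 2 ≤ k * (n - k) := by
    have : (n : ℝ) - k ≤ k * (n - k) :=
      le_mul_of_one_le_left (by linarith) (by exact_mod_cast hk)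
    linarith
  have hle (r : ℝ) (hr : 2 * r ^ 2 ≤ n) : r ≤ lambdaMax G :=
    (Real.le_sqrt_of_sq_le (by linarith)).trans hsqrt
  have hsq : (k : ℝ) * (n - k) ≤ lambdaMax G ^ 2 := (Real.sqrt_le_iff.1 hsqrt).2
  obtain ⟨x, hx⟩ := exists_isPerron G
  obtain ⟨L, hL⟩ := hK₁ (Fin n) G x hx (hS _ G hG.1) (hB _ G hG.1) (hle K₁ hnK₁)
    (by rwa [Fintype.card_fin]) (by rwa [Fintype.card_fin])
  exact ⟨x, L, hL, hle K hnK, by linarith⟩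

lemma SPEX_nonempty {H : SimpleGraph (Fin n)} (hH : FamilyFree F H) : (SPEX F n).Nonempty := by
  obtain ⟨G, hG, hmax⟩ := Set.exists_max_image {G : SimpleGraph (Fin n) | FamilyFree F G} lambdaMax
    (Set.toFinite _) ⟨H, hH⟩
  exact ⟨G, hG, hmax⟩

lemma SPEX_eq_isoClass (hn : 0 < n) {W : Type*} {T : SimpleGraph W} {H : SimpleGraph (Fin n)}
    (hH : FamilyFree F H) (h : ∀ G ∈ SPEX F n, Nonempty (G ≃g T)) :
    SPEX F n = isoClass T n := by
  have : Nonempty (Fin n) := ⟨⟨0, hn⟩⟩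
  refine Set.Subset.antisymm h ?_
  rintro G ⟨e⟩
  obtain ⟨G₀, hG₀⟩ := SPEX_nonempty hH
  obtain ⟨e₀⟩ := h G₀ hG₀
  have e' : G₀ ≃g G := e₀.trans e.symm
  exact ⟨(FamilyFree.congr e').1 hG₀.1, fun G' hG' => lambdaMax_congr e' ▸ hG₀.2 G' hG'⟩

lemma numEdges_sum {V W : Type*} [Finite V] [Finite W] (G : SimpleGraph V) (H : SimpleGraph W) :
    numEdges (G ⊕g H) = numEdges G + numEdges H :=
  (Nat.card_congr SimpleGraph.edgeSetSumEquiv).trans Nat.card_sum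

lemma numEdges_Kbip (k s : ℕ) : numEdges (Kbip k s) = k * s := by
  have hbot : Kbip k s = graphJoin ⊥ ⊥ := by
    ext u v
    rcases u with u | u <;> rcases v with v | v <;> simp
  rw [hbot, numEdges_graphJoin, numEdges_bot, numEdges_bot, Fintype.card_fin, Fintype.card_fin,
    zero_add, zero_add]

lemma numEdges_top_eq_cliqueOn {V : Type*} {L : Finset V} (hL : L.card = k) :
    numEdges (⊤ : SimpleGraph (Fin k)) = numEdges (cliqueOn L) := by
  have htop := two_mul_numEdges_top (Fin k)
  have hclique := two_mul_numEdges_cliqueOn L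
  rw [Fintype.card_fin] at htop
  rw [hL] at hclique
  rify
  linarith

/-- Since `T` is extremal at the order `k + |S|` too, where `S` is the common neighbourhood of the
core `L`, it bounds the number of edges inside `L` and inside `S`. -/
lemma eventually_SPEX_eq_isoClass (hk : 1 ≤ k)
    (hex : (fun n : ℕ => (ex F n : ℝ)) =O[atTop] (fun n : ℕ => (n : ℝ)))
    (hK : ¬ FamilyFree F (completeBipartiteGraph (Fin (k + 1)) ℕ))
    {W : ℕ → Type} (T : ∀ n, SimpleGraph (W n))
    (hT : ∀ᶠ n : ℕ in atTop, MemUpToIso (T n) (EXContaining (Kbip k (n - k)) F n))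
    (hcore : ∀ n (G : SimpleGraph (Fin n)) x L, IsCore k G x L → 0 < lambdaMax G →
      2 ≤ (commonNb G L).card →
      numEdges (within G L) + numEdges (within G (commonNb G L)) + k * (commonNb G L).card
        ≤ numEdges (T (k + (commonNb G L).card)) →
      (∀ H : SimpleGraph (Fin n), Nonempty (H ≃g T n) → lambdaMax H ≤ lambdaMax G) →
      Nonempty (G ≃g T n)) :
    ∀ᶠ n : ℕ in atTop, SPEX F n = isoClass (T n) n := by
  obtain ⟨C, hC, hS⟩ := exists_sparse hex
  obtain ⟨m, hB⟩ := exists_noBip hK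
  obtain ⟨N, hN⟩ := eventually_atTop.1 hT
  have hlarge : ∀ᶠ n : ℕ in atTop, 2 * ((k : ℝ) + N + 2) ≤ n :=
    tendsto_natCast_atTop_atTop.eventually_ge_atTop _
  filter_upwards [eventually_exists_isCore hk hC hS hB 1, hT, eventually_gt_atTop 0, hlarge] with
    n hisCore ⟨H, ⟨⟨hH, hKH⟩, _⟩, ⟨e⟩⟩ hn hnN
  refine SPEX_eq_isoClass hn hH fun G hG => ?_
  obtain ⟨x, L, hL, hl, -⟩ := hisCore G hG ⟨H, hH, hKH⟩
  have hcard : N + 2 ≤ (commonNb G L).card := by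
    have hle := hL.le_card_commonNb
    rw [Fintype.card_fin] at hle
    rify
    linarith
  exact hcore n G x L hL (by linarith) (by omega)
    (numEdges_within_add_le hG.1 hL.card_eq (hN _ (by omega)))
    fun H' ⟨e'⟩ => hG.2 H' ((FamilyFree.congr (e.trans e'.symm)).1 hH)

theorem SPEX_eq_Kbip (hk : 1 ≤ k)
    (hex : (fun n : ℕ => (ex F n : ℝ)) =O[atTop] (fun n : ℕ => (n : ℝ)))
    (hK : ¬ FamilyFree F (completeBipartiteGraph (Fin (k + 1)) ℕ))
    (hT : ∀ᶠ n : ℕ in atTop, MemUpToIso (Kbip k (n - k)) (EXContaining (Kbip k (n - k)) F n)) :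
    ∀ᶠ n : ℕ in atTop, SPEX F n = isoClass (Kbip k (n - k)) n := by
  refine eventually_SPEX_eq_isoClass hk hex hK (fun n => Kbip k (n - k)) hT
    fun n G x L hL _ _ hedges hmax => ?_
  rw [Nat.add_sub_cancel_left, numEdges_Kbip] at hedges
  have hiso := nonempty_iso_Kbip hL.card_eq (Fintype.card_fin n)
  rwa [hL.eq_crossOn (by omega) (hmax _ hiso)]

theorem SPEX_eq_cliqueJoinEmpty (hk : 1 ≤ k)
    (hex : (fun n : ℕ => (ex F n : ℝ)) =O[atTop] (fun n : ℕ => (n : ℝ)))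
    (hK : ¬ FamilyFree F (completeBipartiteGraph (Fin (k + 1)) ℕ))
    (hT : ∀ᶠ n : ℕ in atTop,
      MemUpToIso (cliqueJoinEmpty k n) (EXContaining (Kbip k (n - k)) F n)) :
    ∀ᶠ n : ℕ in atTop, SPEX F n = isoClass (cliqueJoinEmpty k n) n := by
  refine eventually_SPEX_eq_isoClass hk hex hK (cliqueJoinEmpty k) hT
    fun n G x L hL _ _ hedges hmax => ?_
  rw [numEdges_graphJoin, numEdges_bot, Fintype.card_fin, Fintype.card_fin,
    Nat.add_sub_cancel_left, numEdges_top_eq_cliqueOn hL.card_eq] at hedges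
  have hiso := nonempty_iso_cliqueJoinEmpty hL.card_eq (Fintype.card_fin n)
  rwa [hL.eq_crossOn_sup_cliqueOn (by omega) (hmax _ hiso)]

theorem SPEX_eq_cliqueJoinEdge (hk : 1 ≤ k)
    (hex : (fun n : ℕ => (ex F n : ℝ)) =O[atTop] (fun n : ℕ => (n : ℝ)))
    (hK : ¬ FamilyFree F (completeBipartiteGraph (Fin (k + 1)) ℕ))
    (hT : ∀ᶠ n : ℕ in atTop,
      MemUpToIso (cliqueJoinEdge k n) (EXContaining (Kbip k (n - k)) F n)) :
    ∀ᶠ n : ℕ in atTop, SPEX F n = isoClass (cliqueJoinEdge k n) n := by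
  refine eventually_SPEX_eq_isoClass hk hex hK (cliqueJoinEdge k) hT
    fun n G x L hL hl hS hedges hmax => ?_
  have hedge : numEdges (⊤ : SimpleGraph (Fin 2)) = 1 := by
    rw [numEdges_top_eq_cliqueOn (L := (Finset.univ : Finset (Fin 2))) (by simp),
      numEdges_cliqueOn_of_card_eq_two (by simp)]
  rw [numEdges_graphJoin, numEdges_sum, numEdges_bot, hedge, Fintype.card_sum, Fintype.card_fin,
    Fintype.card_fin, Fintype.card_fin, Nat.add_sub_cancel_left, Nat.add_sub_cancel' hS,
    numEdges_top_eq_cliqueOn hL.card_eq] at hedges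
  have hiso (P : Finset (Fin n)) (hP : P.card = 2) (hPL : Disjoint P L) :=
    nonempty_iso_cliqueJoinEdge hL.card_eq (Fintype.card_fin n) hP hPL
  obtain ⟨P, hP, hPL, hG⟩ := hL.eq_crossOn_sup_cliqueOn_sup_cliqueOn hk hl (by omega) hS
    fun P hP hPL => hmax _ (hiso P hP hPL)
  exact hG ▸ hiso P hP hPL

end ExplicitExtremal

section Walks

variable {V W : Type*} [Fintype V] [Fintype W]

lemma nbrSum_nonneg (Y : SimpleGraph W) {f : W → ℝ} (hf : ∀ v, 0 ≤ f v) (v : W) :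
    0 ≤ nbrSum Y f v :=
  Finset.sum_nonneg fun u _ => mul_nonneg (adjInd_nonneg _ _ _) (hf u)

lemma nbrSum_add (Y : SimpleGraph W) (f g : W → ℝ) :
    nbrSum Y (f + g) = nbrSum Y f + nbrSum Y g := by
  ext v
  simp only [nbrSum, Pi.add_apply, mul_add, Finset.sum_add_distrib]

lemma nbrSum_smul (Y : SimpleGraph W) (c : ℝ) (f : W → ℝ) :
    nbrSum Y (c • f) = c • nbrSum Y f := by
  ext v
  simp only [nbrSum, Pi.smul_apply, smul_eq_mul, Finset.mul_sum, mul_left_comm]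

lemma nbrSum_graphJoin_inl (A : SimpleGraph V) (Y : SimpleGraph W) (x : V ⊕ W → ℝ) (i : V) :
    nbrSum (graphJoin A Y) x (Sum.inl i) = nbrSum A (x ∘ Sum.inl) i + ∑ v, x (Sum.inr v) := by
  simp only [nbrSum, Fintype.sum_sum_type, Function.comp_apply, adjInd_congr graphJoin_inl_inl,
    adjInd_of_adj graphJoin_inl_inr, one_mul]

lemma nbrSum_graphJoin_inr (A : SimpleGraph V) (Y : SimpleGraph W) (x : V ⊕ W → ℝ) (v : W) :
    nbrSum (graphJoin A Y) x (Sum.inr v) = ∑ i, x (Sum.inl i) + nbrSum Y (x ∘ Sum.inr) v := by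
  simp only [nbrSum, Fintype.sum_sum_type, Function.comp_apply, adjInd_congr graphJoin_inr_inr,
    adjInd_of_adj graphJoin_inr_inl, one_mul]

lemma nbrSum_top (x : V → ℝ) (i : V) : nbrSum (⊤ : SimpleGraph V) x i = ∑ j, x j - x i := by
  classical
  have hadj (j : V) : adjInd (⊤ : SimpleGraph V) i j * x j = x j - if i = j then x j else 0 := by
    by_cases h : i = j <;> simp [adjInd, h]
  simp only [nbrSum, hadj, Finset.sum_sub_distrib, Finset.sum_ite_eq, Finset.mem_univ, if_true]

lemma sum_nbrSum_top (x : V → ℝ) :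
    ∑ i, nbrSum (⊤ : SimpleGraph V) x i = (Fintype.card V - 1) * ∑ i, x i := by
  simp only [nbrSum_top, Finset.sum_sub_distrib, Finset.sum_const, Finset.card_univ, nsmul_eq_mul]
  ring

lemma sum_nbrSum_le (A : SimpleGraph V) {x : V → ℝ} (hx : ∀ i, 0 ≤ x i) :
    ∑ i, nbrSum A x i ≤ (Fintype.card V - 1) * ∑ i, x i := by
  rw [← sum_nbrSum_top]
  exact Finset.sum_le_sum fun i _ => Finset.sum_le_sum fun j _ =>
    mul_le_mul_of_nonneg_right (adjInd_le_of_imp fun h => le_top (a := A) h) (hx j)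

lemma sum_nbrSum_add_le_of_ne_top {A : SimpleGraph V} (hA : A ≠ ⊤) {x : V → ℝ} {c : ℝ}
    (hc : 0 ≤ c) (hx : ∀ i, c ≤ x i) :
    ∑ i, nbrSum A x i + c ≤ (Fintype.card V - 1) * ∑ i, x i := by
  obtain ⟨a, b, hab, hnadj⟩ := SimpleGraph.ne_top_iff_exists_not_adj.1 hA
  have hle (i j) : adjInd A i j * x j ≤ adjInd ⊤ i j * x j :=
    mul_le_mul_of_nonneg_right (adjInd_le_of_imp fun h => le_top (a := A) h) (hc.trans (hx j))
  have hrow : nbrSum A x a + c ≤ nbrSum ⊤ x a := by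
    have hterm : adjInd A a b * x b + c ≤ adjInd ⊤ a b * x b := by
      rw [adjInd_of_not_adj hnadj, adjInd_of_adj ((SimpleGraph.top_adj a b).2 hab)]
      linarith [hx b]
    classical
    rw [nbrSum, nbrSum, ← Finset.add_sum_erase _ _ (Finset.mem_univ b),
      ← Finset.add_sum_erase _ (fun u => adjInd ⊤ a u * x u) (Finset.mem_univ b)]
    linarith [Finset.sum_le_sum (s := Finset.univ.erase b) fun j _ => hle a j]
  classical
  rw [← sum_nbrSum_top, ← Finset.add_sum_erase _ _ (Finset.mem_univ a),
    ← Finset.add_sum_erase _ (nbrSum ⊤ x) (Finset.mem_univ a)]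
  have hrest : ∑ i ∈ Finset.univ.erase a, nbrSum A x i
      ≤ ∑ i ∈ Finset.univ.erase a, nbrSum ⊤ x i :=
    Finset.sum_le_sum fun i _ => Finset.sum_le_sum fun j _ => hle i j
  linarith

lemma sum_nbrSum_le_of_ne_top {A : SimpleGraph V} (hA : A ≠ ⊤) {x : V → ℝ}
    (hx : ∀ i, 1 / 2 ≤ x i) (hx1 : ∀ i, x i ≤ 1) :
    ∑ i, nbrSum A x i ≤ (Fintype.card V - 1 - 1 / (2 * Fintype.card V)) * ∑ i, x i := by
  have hsum : ∑ i, x i ≤ Fintype.card V :=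
    (Finset.sum_le_card_nsmul _ _ 1 fun i _ => hx1 i).trans (by simp)
  have hhalf : 1 / (2 * (Fintype.card V : ℝ)) * ∑ i, x i ≤ 1 / 2 := by
    calc 1 / (2 * (Fintype.card V : ℝ)) * ∑ i, x i
        ≤ 1 / (2 * Fintype.card V) * Fintype.card V := by gcongr
      _ = 1 / 2 * (Fintype.card V / Fintype.card V) := by ring
      _ ≤ 1 / 2 := mul_le_of_le_one_right (by norm_num) (div_self_le_one _)
  linarith [sum_nbrSum_add_le_of_ne_top hA (by norm_num) hx]

/-- The number of walks with `i` edges starting at a vertex. -/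
noncomputable def walk (Y : SimpleGraph W) : ℕ → W → ℝ
  | 0 => fun _ => 1
  | i + 1 => nbrSum Y (walk Y i)

/-- The total number of walks with `i` edges. -/
noncomputable def walkSum (Y : SimpleGraph W) (i : ℕ) : ℝ := ∑ v, walk Y i v

lemma walk_nonneg (Y : SimpleGraph W) (i : ℕ) (v : W) : 0 ≤ walk Y i v := by
  induction i generalizing v with
  | zero => exact zero_le_one
  | succ i ih => exact nbrSum_nonneg Y ih v

lemma walk_le {Y : SimpleGraph W} {D : ℕ} (hD : ∀ v, deg Y v ≤ D) (i : ℕ) (v : W) :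
    walk Y i v ≤ (D : ℝ) ^ i := by
  induction i generalizing v with
  | zero => exact (pow_zero _).ge
  | succ i ih =>
    calc walk Y (i + 1) v = ∑ u, adjInd Y v u * walk Y i u := rfl
      _ ≤ ∑ u, adjInd Y v u * (D : ℝ) ^ i := Finset.sum_le_sum fun u _ =>
          mul_le_mul_of_nonneg_left (ih u) (adjInd_nonneg _ _ _)
      _ = deg Y v * (D : ℝ) ^ i := by rw [← Finset.sum_mul, sum_adjInd_eq_deg]
      _ ≤ D * (D : ℝ) ^ i := by gcongr; exact hD v
      _ = (D : ℝ) ^ (i + 1) := by ring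

lemma walkSum_le {Y : SimpleGraph W} {D : ℕ} (hD : ∀ v, deg Y v ≤ D) (i : ℕ) :
    walkSum Y i ≤ Fintype.card W * (D : ℝ) ^ i :=
  (Finset.sum_le_card_nsmul _ _ _ fun v _ => walk_le hD i v).trans (by simp)

lemma walkSum_nonneg (Y : SimpleGraph W) (i : ℕ) : 0 ≤ walkSum Y i :=
  Finset.sum_nonneg fun v _ => walk_nonneg Y i v

lemma walk_one (Y : SimpleGraph W) (v : W) : walk Y 1 v = deg Y v := by
  simp only [walk, nbrSum, mul_one, sum_adjInd_eq_deg]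

lemma walkSum_zero (Y : SimpleGraph W) : walkSum Y 0 = Fintype.card W := by
  simp [walkSum, walk]

lemma walkSum_one (Y : SimpleGraph W) : walkSum Y 1 = 2 * numEdges Y := by
  simp only [walkSum, walk_one, sum_deg_eq]

lemma walkSum_two (Y : SimpleGraph W) :
    2 * walkSum Y 2 = ∑ u, ∑ v, adjInd Y u v * ((deg Y u : ℝ) + deg Y v) := by
  have hsnd : walkSum Y 2 = ∑ u, ∑ v, adjInd Y u v * (deg Y v : ℝ) := by
    refine Finset.sum_congr rfl fun u _ => Finset.sum_congr rfl fun v _ => ?_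
    rw [walk_one]
  have hfst : walkSum Y 2 = ∑ u, ∑ v, adjInd Y u v * (deg Y u : ℝ) := by
    rw [hsnd, Finset.sum_comm]
    exact Finset.sum_congr rfl fun u _ => Finset.sum_congr rfl fun v _ => by rw [adjInd_comm]
  simp only [mul_add, Finset.sum_add_distrib, ← hsnd, ← hfst]
  ring

lemma walkSum_three (Y : SimpleGraph W) :
    walkSum Y 3 = ∑ u, ∑ v, adjInd Y u v * ((deg Y u : ℝ) * deg Y v) := by
  have hone : walkSum Y 3 = ∑ v, walk Y 1 v * nbrSum Y (walk Y 1) v := by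
    rw [← sum_nbrSum_mul_comm Y (walk Y 1) (walk Y 1)]
    simpa only [walkSum, walk, mul_one] using sum_nbrSum_mul_comm Y (walk Y 2) (walk Y 0)
  simp only [hone, nbrSum, Finset.mul_sum, walk_one]
  exact Finset.sum_congr rfl fun u _ => Finset.sum_congr rfl fun v _ => by ring

/-- The Neumann series of `l⁴ (l - A)⁻¹ 1`, with `A` the adjacency matrix of `Y`, truncated after
the walks with three edges. -/
noncomputable def truncatedResolvent (Y : SimpleGraph W) (l : ℝ) : W → ℝ :=
  l ^ 3 • walk Y 0 + l ^ 2 • walk Y 1 + l • walk Y 2 + walk Y 3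

/-- The contribution of the walks with at most three edges in `Y` to the characteristic equation
of a join with `Y`. -/
noncomputable def walkPoly (Y : SimpleGraph W) (l : ℝ) : ℝ :=
  l ^ 3 * walkSum Y 0 + l ^ 2 * walkSum Y 1 + l * walkSum Y 2 + walkSum Y 3

lemma sum_truncatedResolvent (Y : SimpleGraph W) (l : ℝ) :
    ∑ v, truncatedResolvent Y l v = walkPoly Y l := by
  simp only [truncatedResolvent, Pi.add_apply, Pi.smul_apply, smul_eq_mul, Finset.sum_add_distrib,
    ← Finset.mul_sum]
  rfl

lemma truncatedResolvent_nonneg (Y : SimpleGraph W) {l : ℝ} (hl : 0 ≤ l) (v : W) :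
    0 ≤ truncatedResolvent Y l v := by
  have hsmul (c : ℝ) (hc : 0 ≤ c) (i : ℕ) : 0 ≤ (c • walk Y i) v :=
    mul_nonneg hc (walk_nonneg Y i v)
  exact add_nonneg (add_nonneg (add_nonneg (hsmul _ (by positivity) 0)
    (hsmul _ (by positivity) 1)) (hsmul _ hl 2)) (walk_nonneg Y 3 v)

lemma nbrSum_truncatedResolvent (Y : SimpleGraph W) (l : ℝ) (v : W) :
    nbrSum Y (truncatedResolvent Y l) v = l * truncatedResolvent Y l v + walk Y 4 v - l ^ 4 := by
  simp only [truncatedResolvent, nbrSum_add, nbrSum_smul, Pi.add_apply, Pi.smul_apply, smul_eq_mul]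
  simp only [walk]
  ring

variable {k : ℕ}

lemma quadForm_cliqueJoin_elim_one (X : SimpleGraph W) (y : W → ℝ) :
    quadForm (cliqueJoin k X) (Sum.elim (fun _ => 1) y)
      = k * (k - 1 + ∑ v, y v) + ∑ v, y v * (k + nbrSum X y v) := by
  simp only [quadForm_eq_sum_mul_nbrSum, Fintype.sum_sum_type, nbrSum_graphJoin_inl,
    nbrSum_graphJoin_inr, Sum.elim_comp_inl, Sum.elim_comp_inr, Sum.elim_inl, Sum.elim_inr,
    nbrSum_top, Finset.sum_const, Finset.card_univ, Fintype.card_fin, nsmul_eq_mul, mul_one,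
    one_mul]

/-- The test vector is `1` on the clique and a multiple of `truncatedResolvent X l` on `X`. -/
lemma walkPoly_le_of_lambdaMax_le (hk : 1 ≤ k) (X : SimpleGraph W) {l : ℝ} (hl : 0 < l)
    (hX : lambdaMax (cliqueJoin k X) ≤ l) : k * walkPoly X l ≤ l ^ 4 * (l - (k - 1)) := by
  have : Nonempty (Fin k ⊕ W) := ⟨Sum.inl ⟨0, hk⟩⟩
  set y : W → ℝ := (k / l ^ 4) • truncatedResolvent X l with hy
  have hy0 (v) : 0 ≤ y v := mul_nonneg (by positivity) (truncatedResolvent_nonneg X hl.le v)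
  have hle (v) : l * y v ≤ k + nbrSum X y v := by
    have hrem : k + nbrSum X y v - l * y v = k / l ^ 4 * walk X 4 v := by
      simp only [hy, nbrSum_smul, Pi.smul_apply, smul_eq_mul, nbrSum_truncatedResolvent]
      field_simp
      ring
    have := mul_nonneg (show 0 ≤ k / l ^ 4 by positivity) (walk_nonneg X 4 v)
    linarith
  have hsq : l * ∑ v, y v ^ 2 ≤ ∑ v, y v * (k + nbrSum X y v) := by
    rw [Finset.mul_sum]
    refine Finset.sum_le_sum fun v _ => ?_
    calc l * y v ^ 2 = y v * (l * y v) := by ring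
      _ ≤ y v * (k + nbrSum X y v) := mul_le_mul_of_nonneg_left (hle v) (hy0 v)
  have hform : k * (k - 1 + ∑ v, y v) + ∑ v, y v * (k + nbrSum X y v)
      ≤ l * (k + ∑ v, y v ^ 2) := by
    have hnorm : ∑ v, Sum.elim (fun _ : Fin k => 1) y v ^ 2 = k + ∑ v, y v ^ 2 := by simp
    rw [← quadForm_cliqueJoin_elim_one, ← hnorm]
    exact (quadForm_le_lambdaMax_mul _ _).trans
      (mul_le_mul_of_nonneg_right hX (Finset.sum_nonneg fun v _ => sq_nonneg _))
  have hsum : k - 1 + ∑ v, y v ≤ l :=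
    le_of_mul_le_mul_left (by linarith) (Nat.cast_pos (α := ℝ).2 hk)
  have hpoly : k * walkPoly X l = l ^ 4 * ∑ v, y v := by
    simp only [hy, Pi.smul_apply, smul_eq_mul, ← Finset.mul_sum, sum_truncatedResolvent]
    field_simp
  rw [hpoly]
  gcongr
  linarith

lemma pow_mul_sum_eq {Y : SimpleGraph W} {y : W → ℝ} {l s : ℝ}
    (hy : ∀ v, l * y v = s + nbrSum Y y v) :
    l ^ 4 * ∑ v, y v = s * walkPoly Y l + ∑ v, walk Y 4 v * y v := by
  have hcomm := sum_nbrSum_mul_comm Y (truncatedResolvent Y l) y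
  have hl (v) : nbrSum Y (truncatedResolvent Y l) v * y v
      = truncatedResolvent Y l v * (l * y v) + walk Y 4 v * y v - l ^ 4 * y v := by
    rw [nbrSum_truncatedResolvent]
    ring
  simp only [hl, hy, mul_add, Finset.sum_add_distrib, Finset.sum_sub_distrib, ← Finset.mul_sum,
    ← Finset.sum_mul, sum_truncatedResolvent] at hcomm
  linarith

lemma le_walkPoly_of_isPerron {A : SimpleGraph (Fin k)} {Y : SimpleGraph W}
    {x : Fin k ⊕ W → ℝ} (hx : IsPerron (graphJoin A Y) x) (hl : 0 ≤ lambdaMax (graphJoin A Y))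
    (hpos : 0 < ∑ i, x (Sum.inl i)) {D : ℕ} (hD : ∀ v, deg Y v ≤ D) {τ : ℝ}
    (hτ : ∑ i, nbrSum A (x ∘ Sum.inl) i ≤ (k - 1 - τ) * ∑ i, x (Sum.inl i)) :
    lambdaMax (graphJoin A Y) ^ 4 * (lambdaMax (graphJoin A Y) + τ - (k - 1))
      ≤ k * walkPoly Y (lambdaMax (graphJoin A Y)) + D ^ 4 * lambdaMax (graphJoin A Y) := by
  have heig := hx.eigen
  generalize lambdaMax (graphJoin A Y) = l at *
  set s := ∑ i, x (Sum.inl i) with hs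
  set y : W → ℝ := x ∘ Sum.inr with hy
  have hright (v) : l * y v = s + nbrSum Y y v := by
    rw [hy, Function.comp_apply, ← heig, nbrSum_graphJoin_inr]
  have hleft : l * s = ∑ i, nbrSum A (x ∘ Sum.inl) i + k * ∑ v, y v := by
    simp only [hs, Finset.mul_sum, ← heig, nbrSum_graphJoin_inl, Finset.sum_add_distrib]
    simp [hy, Finset.mul_sum]
  have htail : ∑ v, walk Y 4 v * y v ≤ D ^ 4 * ∑ v, y v := by
    rw [Finset.mul_sum]
    exact Finset.sum_le_sum fun v _ => mul_le_mul_of_nonneg_right (walk_le hD 4 v) (hx.nonneg _)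
  have hnonneg : 0 ≤ ∑ i, nbrSum A (x ∘ Sum.inl) i :=
    Finset.sum_nonneg fun i _ => nbrSum_nonneg A (fun j => hx.nonneg _) i
  have hsum : k * ∑ v, y v ≤ l * s := by linarith
  refine le_of_mul_le_mul_right ?_ hpos
  calc l ^ 4 * (l + τ - (k - 1)) * s = l ^ 4 * (l * s - (k - 1 - τ) * s) := by ring
    _ ≤ l ^ 4 * (k * ∑ v, y v) := by gcongr; linarith
    _ = k * (s * walkPoly Y l + ∑ v, walk Y 4 v * y v) := by rw [← pow_mul_sum_eq hright]; ring
    _ ≤ k * (s * walkPoly Y l + D ^ 4 * ∑ v, y v) := by gcongr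
    _ = k * s * walkPoly Y l + D ^ 4 * (k * ∑ v, y v) := by ring
    _ ≤ k * s * walkPoly Y l + D ^ 4 * (l * s) := by gcongr
    _ = (k * walkPoly Y l + D ^ 4 * l) * s := by ring

end Walks

section WalkComparison

variable {W : Type*} [Fintype W] {k : ℕ} {A : SimpleGraph (Fin k)} {X Y : SimpleGraph W} {D : ℕ}

lemma walkPoly_comparison (hk : 1 ≤ k) {x : Fin k ⊕ W → ℝ} (hx : IsPerron (graphJoin A Y) x)
    (hl : 0 < lambdaMax (graphJoin A Y)) (hpos : 0 < ∑ i, x (Sum.inl i)) (hD : ∀ v, deg Y v ≤ D)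
    {τ : ℝ} (hτ : ∑ i, nbrSum A (x ∘ Sum.inl) i ≤ (k - 1 - τ) * ∑ i, x (Sum.inl i))
    (hX : lambdaMax (cliqueJoin k X) ≤ lambdaMax (graphJoin A Y)) :
    k * walkPoly X (lambdaMax (graphJoin A Y)) + τ * lambdaMax (graphJoin A Y) ^ 4
      ≤ k * walkPoly Y (lambdaMax (graphJoin A Y)) + D ^ 4 * lambdaMax (graphJoin A Y) := by
  have hXpoly := walkPoly_le_of_lambdaMax_le hk X hl hX
  have hYpoly := le_walkPoly_of_isPerron hx hl.le hpos hD hτ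
  linarith

lemma numEdges_comparison {l τ : ℝ} (hl : 0 ≤ l) (hD : ∀ v, deg Y v ≤ D)
    (hcomp : k * walkPoly X l + τ * l ^ 4 ≤ k * walkPoly Y l + D ^ 4 * l) :
    2 * k * l ^ 2 * numEdges X + τ * l ^ 4
      ≤ 2 * k * l ^ 2 * numEdges Y + k * Fintype.card W * (l * D ^ 2 + D ^ 3) + D ^ 4 * l := by
  simp only [walkPoly, walkSum_zero, walkSum_one] at hcomp
  have hX : 0 ≤ k * (l * walkSum X 2 + walkSum X 3) :=
    mul_nonneg k.cast_nonneg
      (add_nonneg (mul_nonneg hl (walkSum_nonneg X 2)) (walkSum_nonneg X 3))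
  have hY : k * (l * walkSum Y 2 + walkSum Y 3)
      ≤ k * (l * (Fintype.card W * D ^ 2) + Fintype.card W * D ^ 3) := by
    gcongr
    exacts [walkSum_le hD 2, walkSum_le hD 3]
  linarith

lemma mul_le_of_numEdges_comparison {l τ : ℝ} (hl : 1 ≤ l) (hW : Fintype.card W ≤ 2 * l ^ 2)
    (hcomp : 2 * k * l ^ 2 * numEdges X + τ * l ^ 4
      ≤ 2 * k * l ^ 2 * numEdges Y + k * Fintype.card W * (l * D ^ 2 + D ^ 3) + D ^ 4 * l)
    (hedges : 2 * (numEdges Y : ℝ) ≤ 2 * numEdges X + k ^ 2) :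
    τ * l ≤ k ^ 3 + 2 * k * D ^ 2 + 2 * k * D ^ 3 + D ^ 4 := by
  have hsq : l ^ 2 ≤ l ^ 3 := pow_le_pow_right₀ hl (by norm_num)
  have hself : l ≤ l ^ 3 := le_self_pow₀ hl (by norm_num)
  have hkl : k * l ^ 2 * (2 * (numEdges Y : ℝ)) ≤ k * l ^ 2 * (2 * numEdges X + k ^ 2) := by
    gcongr
  have hbound : k * Fintype.card W * (l * D ^ 2 + D ^ 3)
      ≤ k * (2 * l ^ 2) * (l * D ^ 2 + D ^ 3) := by gcongr
  have : l ^ 3 * (τ * l) ≤ l ^ 3 * (k ^ 3 + 2 * k * D ^ 2 + 2 * k * D ^ 3 + D ^ 4) :=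
    calc l ^ 3 * (τ * l)
        ≤ k ^ 3 * l ^ 2 + 2 * k * D ^ 2 * l ^ 3 + 2 * k * D ^ 3 * l ^ 2 + D ^ 4 * l := by linarith
      _ ≤ k ^ 3 * l ^ 3 + 2 * k * D ^ 2 * l ^ 3 + 2 * k * D ^ 3 * l ^ 3 + D ^ 4 * l ^ 3 := by
        gcongr
      _ = _ := by ring
  exact le_of_mul_le_mul_left this (by positivity)

lemma eq_top_of_lambdaMax_le (hk : 1 ≤ k) {x : Fin k ⊕ W → ℝ} (hx : IsPerron (graphJoin A Y) x)
    (hheavy : ∀ i, 1 / 2 ≤ x (Sum.inl i)) (hD : ∀ v, deg Y v ≤ D)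
    (hX : lambdaMax (cliqueJoin k X) ≤ lambdaMax (graphJoin A Y))
    (hl : 1 ≤ lambdaMax (graphJoin A Y))
    (hW : Fintype.card W ≤ 2 * lambdaMax (graphJoin A Y) ^ 2)
    (hlarge : 2 * k * ((k : ℝ) ^ 3 + 2 * k * D ^ 2 + 2 * k * D ^ 3 + D ^ 4)
      < lambdaMax (graphJoin A Y))
    (hedges : numEdges (graphJoin A Y) ≤ numEdges (cliqueJoin k X)) : A = ⊤ := by
  by_contra hA
  have : Nonempty (Fin k) := ⟨⟨0, hk⟩⟩
  have hpos : 0 < ∑ i, x (Sum.inl i) :=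
    Finset.sum_pos (fun i _ => by linarith [hheavy i]) Finset.univ_nonempty
  have hmissing := sum_nbrSum_le_of_ne_top hA hheavy fun i => hx.le_one (Sum.inl i)
  rw [Fintype.card_fin] at hmissing
  have hcomp := numEdges_comparison (by linarith) hD
    (walkPoly_comparison hk hx (by linarith) hpos hD hmissing hX)
  have htop : 2 * (numEdges (⊤ : SimpleGraph (Fin k)) : ℝ) ≤ k ^ 2 := by
    rw [two_mul_numEdges_top, Fintype.card_fin]
    nlinarith [Nat.cast_nonneg (α := ℝ) k]
  have hYX : 2 * (numEdges Y : ℝ) ≤ 2 * numEdges X + k ^ 2 := by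
    simp only [cliqueJoin, numEdges_graphJoin] at hedges
    have : (numEdges Y : ℝ) ≤ numEdges (⊤ : SimpleGraph (Fin k)) + numEdges X := by
      exact_mod_cast (by omega :
        numEdges Y ≤ numEdges (⊤ : SimpleGraph (Fin k)) + numEdges X)
    linarith
  have hle := mul_le_of_numEdges_comparison hl hW hcomp hYX
  rw [div_mul_eq_mul_div, one_mul, div_le_iff₀' (by positivity)] at hle
  linarith

lemma numEdges_sub_le_of_comparison (hk : 1 ≤ k) {l q : ℝ} (hl : 1 ≤ l) (hq : 1 ≤ q)
    (hql : q ≤ 2 * l) (hWq : Fintype.card W ≤ q ^ 2) (hWl : Fintype.card W ≤ 2 * l ^ 2)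
    (hcomp : 2 * k * l ^ 2 * numEdges X
      ≤ 2 * k * l ^ 2 * numEdges Y + k * Fintype.card W * (l * D ^ 2 + D ^ 3) + D ^ 4 * l) :
    numEdges X - (2 * D ^ 2 + 2 * D ^ 3 + D ^ 4) * q ≤ numEdges Y := by
  have hk' : (1 : ℝ) ≤ k := by exact_mod_cast hk
  have hW : (Fintype.card W : ℝ) ≤ 2 * l * q :=
    hWq.trans (by rw [sq]; gcongr)
  have htwo : k * Fintype.card W * (l * D ^ 2) ≤ k * (2 * l * q) * (l * (D : ℝ) ^ 2) := by
    gcongr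
  have hthree : k * Fintype.card W * D ^ 3 ≤ k * (2 * l ^ 2) * (D : ℝ) ^ 3 * q :=
    (by gcongr : _ ≤ k * (2 * l ^ 2) * (D : ℝ) ^ 3).trans
      (le_mul_of_one_le_right (by positivity) hq)
  have hfour : D ^ 4 * l ≤ k * l ^ 2 * (D ^ 4 * q) := by
    have : 1 * l * 1 ≤ k * l ^ 2 * q := by
      gcongr
      exact le_self_pow₀ hl (by norm_num)
    calc D ^ 4 * l = D ^ 4 * (1 * l * 1) := by ring
      _ ≤ D ^ 4 * (k * l ^ 2 * q) := by gcongr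
      _ = k * l ^ 2 * (D ^ 4 * q) := by ring
  have : k * l ^ 2 * (2 * numEdges X : ℝ)
      ≤ k * l ^ 2 * (2 * numEdges Y + (2 * D ^ 2 + 2 * D ^ 3 + D ^ 4) * q) := by linarith
  have hhalf := le_of_mul_le_mul_left this (by positivity)
  have : 0 ≤ (2 * (D : ℝ) ^ 2 + 2 * D ^ 3 + D ^ 4) * q := by positivity
  linarith

lemma numEdges_le_of_walkPoly_comparison (hk : 1 ≤ k) {l K : ℝ} (hl : 1 ≤ l) (hK : 0 ≤ K)
    (hlarge : 2 * k * K + D ^ 4 < l)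
    (htwo : walkSum Y 2 ≤ walkSum X 2 + K) (hthree : walkSum Y 3 ≤ walkSum X 3 + K)
    (hcomp : k * walkPoly X l ≤ k * walkPoly Y l + D ^ 4 * l) : numEdges X ≤ numEdges Y := by
  by_contra! hlt
  have hlt' : (numEdges Y : ℝ) + 1 ≤ numEdges X := by exact_mod_cast hlt
  have hk' : (1 : ℝ) ≤ k := by exact_mod_cast hk
  have hedges : k * l ^ 2 * (2 * ((numEdges Y : ℝ) + 1)) ≤ k * l ^ 2 * (2 * numEdges X) := by
    gcongr
  have htwo' : k * l * walkSum Y 2 ≤ k * l * (walkSum X 2 + K) := by gcongr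
  have hthree' : k * walkSum Y 3 ≤ k * (walkSum X 3 + K) := by gcongr
  have hKl : k * K ≤ k * K * l := le_mul_of_one_le_right (by positivity) hl
  simp only [walkPoly, walkSum_zero, walkSum_one] at hcomp
  have hquad : l * (2 * k * l) ≤ l * (2 * k * K + D ^ 4) := by linarith
  have hlin := le_of_mul_le_mul_left hquad (by linarith)
  nlinarith

end WalkComparison

section FiniteFamily

variable {F : GraphFamily} {k : ℕ}

lemma IsCore.crossOn_le_of_mem_SPEX {n : ℕ} {G : SimpleGraph (Fin n)} {x : Fin n → ℝ}
    {L : Finset (Fin n)} (hL : IsCore k G x L) (hG : G ∈ SPEX F n)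
    (hF : ∀ A ∈ F, A.1 ≤ (commonNb G L).card) : crossOn L ≤ G := by
  have hclean : cleaned G L = G :=
    hL.cleaned_eq le_sup_left le_rfl (hG.2 _ (familyFree_cleaned hG.1 hF))
  exact le_sup_left.trans hclean.le

lemma IsCore.exists_graphJoin_iso {n : ℕ} {G : SimpleGraph (Fin n)} {x : Fin n → ℝ}
    {L : Finset (Fin n)} (hL : IsCore k G x L) (hcross : crossOn L ≤ G) :
    ∃ (A : SimpleGraph (Fin k)) (Y : SimpleGraph (Fin (n - k))) (e : graphJoin A Y ≃g G),
      ∀ i, 3 / 4 ≤ x (e (Sum.inl i)) := by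
  obtain ⟨e, hinl, hinr⟩ := exists_equiv_mem_notMem hL.card_eq (Fintype.card_fin n)
  exact ⟨_, _, graphJoinIso e hinl hinr hcross, fun i => hL.heavy _ (hinl i)⟩

lemma IsCore.exists_cliqueJoin_iso (hk : 1 ≤ k) {n D : ℕ} {G : SimpleGraph (Fin n)}
    {x : Fin n → ℝ} {L : Finset (Fin n)} (hL : IsCore k G x L) (hcross : crossOn L ≤ G)
    (hD : NoBip k D G) {X : SimpleGraph (Fin (n - k))}
    (hX : lambdaMax (cliqueJoin k X) ≤ lambdaMax G) (hl : 1 ≤ lambdaMax G)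
    (hn : (n : ℝ) ≤ 2 * lambdaMax G ^ 2)
    (hlarge : 2 * k * ((k : ℝ) ^ 3 + 2 * k * D ^ 2 + 2 * k * D ^ 3 + D ^ 4) < lambdaMax G)
    (hedges : numEdges G ≤ numEdges (cliqueJoin k X)) :
    ∃ Y : SimpleGraph (Fin (n - k)), Nonempty (G ≃g cliqueJoin k Y) ∧ (∀ v, deg Y v ≤ D) ∧
      k * walkPoly X (lambdaMax G) ≤ k * walkPoly Y (lambdaMax G) + D ^ 4 * lambdaMax G := by
  obtain ⟨A, Y, e, hheavy⟩ := hL.exists_graphJoin_iso hcross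
  have : Nonempty (Fin k) := ⟨⟨0, hk⟩⟩
  have hx := hL.perron.congr e
  have hYdeg (v) : deg Y v ≤ D := (hD.congr e.symm).deg_le v
  have hcard : (Fintype.card (Fin (n - k)) : ℝ) ≤ n := by simp
  have hpos : 0 < ∑ i, (x ∘ e) (Sum.inl i) :=
    Finset.sum_pos (fun i _ => lt_of_lt_of_le (by norm_num) (hheavy i)) Finset.univ_nonempty
  rw [← lambdaMax_congr e] at hX hl hn hlarge ⊢
  obtain rfl : A = ⊤ := eq_top_of_lambdaMax_le hk hx
    (fun i => le_trans (by norm_num) (hheavy i)) hYdeg hX hl (hcard.trans hn) hlarge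
    ((numEdges_congr e).trans_le hedges)
  have htop := sum_nbrSum_le (⊤ : SimpleGraph (Fin k)) (x := (x ∘ e) ∘ Sum.inl)
    fun i => hx.nonneg (Sum.inl i)
  rw [Fintype.card_fin, ← sub_zero ((k : ℝ) - 1)] at htop
  have hcomp := walkPoly_comparison hk hx (by linarith) hpos hYdeg htop hX
  exact ⟨Y, ⟨e.symm⟩, hYdeg, by simpa using hcomp⟩

theorem exists_degree_bound_and_join (hk : 1 ≤ k)
    (hex : (fun n : ℕ => (ex F n : ℝ)) =O[atTop] (fun n : ℕ => (n : ℝ)))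
    (hK : ¬ FamilyFree F (completeBipartiteGraph (Fin (k + 1)) ℕ)) (hF : F.Finite) :
    ∃ D : ℕ, ∀ X : ∀ n : ℕ, SimpleGraph (Fin (n - k)),
      (∀ᶠ n : ℕ in atTop, MemUpToIso (cliqueJoin k (X n)) (EXContaining (Kbip k (n - k)) F n)) →
      ∀ K : ℝ, ∀ᶠ n : ℕ in atTop, (∀ v, deg (X n) v ≤ D) ∧ ∀ G ∈ SPEX F n,
        ∃ Y : SimpleGraph (Fin (n - k)), Nonempty (G ≃g cliqueJoin k Y) ∧ (∀ v, deg Y v ≤ D) ∧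
          ∃ l : ℝ, K ≤ l ∧ 1 ≤ l ∧ (n : ℝ) ≤ 2 * l ^ 2 ∧
          k * walkPoly (X n) l ≤ k * walkPoly Y l + D ^ 4 * l := by
  obtain ⟨C, hC, hS⟩ := exists_sparse hex
  obtain ⟨D, hB⟩ := exists_noBip hK
  refine ⟨D, fun X hX K => ?_⟩
  obtain ⟨r, hr⟩ : ∃ r, ∀ A ∈ F, A.1 ≤ r := by
    obtain ⟨r, hr⟩ := (hF.image Sigma.fst).bddAbove
    exact ⟨r, fun A hA => hr ⟨A, hA, rfl⟩⟩
  obtain ⟨K', hK', hK'one, hK'large⟩ := ((eventually_ge_atTop K).and <|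
    (eventually_ge_atTop 1).and <| eventually_gt_atTop
      (2 * k * ((k : ℝ) ^ 3 + 2 * k * D ^ 2 + 2 * k * D ^ 3 + D ^ 4))).exists
  filter_upwards [eventually_exists_isCore hk hC hS hB K', hX, eventually_gt_atTop 0,
    tendsto_natCast_atTop_atTop.eventually_ge_atTop (2 * ((k : ℝ) + r))] with
    n hcore ⟨H, hH, ⟨e⟩⟩ hn hnr
  have : Nonempty (Fin n) := ⟨⟨0, hn⟩⟩
  refine ⟨fun v => ((hB _ H hH.1.1).congr e).deg_le v, fun G hG => ?_⟩
  obtain ⟨x, L, hL, hKl, hnl⟩ := hcore G hG ⟨H, hH.1⟩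
  have hcard : r ≤ (commonNb G L).card := by
    have hle := hL.le_card_commonNb
    rw [Fintype.card_fin] at hle
    rify
    linarith
  have hcross := hL.crossOn_le_of_mem_SPEX hG fun A hA => (hr A hA).trans hcard
  have hcontains : (Kbip k (n - k)).IsContained G := by
    obtain ⟨A, Y, e', -⟩ := hL.exists_graphJoin_iso hcross
    exact (SimpleGraph.IsContained.of_le (completeBipartiteGraph_le_graphJoin A Y)).trans
      e'.isContained
  have hlambda : lambdaMax (cliqueJoin k (X n)) ≤ lambdaMax G :=
    lambdaMax_congr e ▸ hG.2 H hH.1.1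
  have hedges : numEdges G ≤ numEdges (cliqueJoin k (X n)) :=
    numEdges_congr e ▸ hH.2 G hG.1 hcontains
  obtain ⟨Y, hiso, hY, hcomp⟩ := hL.exists_cliqueJoin_iso hk hcross (hB _ G hG.1) hlambda
    (hK'one.trans hKl) hnl (hK'large.trans_le hKl) hedges
  exact ⟨Y, hiso, hY, lambdaMax G, hK'.trans hKl, hK'one.trans hKl, hnl, hcomp⟩

theorem exists_join_of_mem_SPEX (hk : 1 ≤ k)
    (hex : (fun n : ℕ => (ex F n : ℝ)) =O[atTop] (fun n : ℕ => (n : ℝ)))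
    (hK : ¬ FamilyFree F (completeBipartiteGraph (Fin (k + 1)) ℕ)) (hF : F.Finite) :
    ∃ D : ℕ, ∀ X : ∀ n : ℕ, SimpleGraph (Fin (n - k)),
      (∀ᶠ n : ℕ in atTop, MemUpToIso (cliqueJoin k (X n)) (EXContaining (Kbip k (n - k)) F n)) →
      ∃ C : ℝ, ∀ᶠ n : ℕ in atTop, ∀ G ∈ SPEX F n,
        ∃ Y : SimpleGraph (Fin (n - k)), Nonempty (G ≃g cliqueJoin k Y) ∧
          (numEdges (X n) : ℝ) - C * Real.sqrt n ≤ numEdges Y ∧ ∀ v, deg Y v ≤ D := by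
  obtain ⟨D, hD⟩ := exists_degree_bound_and_join hk hex hK hF
  refine ⟨D, fun X hX => ⟨2 * D ^ 2 + 2 * D ^ 3 + D ^ 4, ?_⟩⟩
  filter_upwards [hD X hX 1, eventually_gt_atTop 0] with n ⟨_, hSPEX⟩ hn G hG
  obtain ⟨Y, hiso, hY, l, -, hl, hnl, hcomp⟩ := hSPEX G hG
  have hcard : (Fintype.card (Fin (n - k)) : ℝ) ≤ n := by simp
  have hsqrt : (√n : ℝ) ^ 2 = n := Real.sq_sqrt n.cast_nonneg
  have hsqrt_le : √n ≤ 2 * l := Real.sqrt_le_iff.2 ⟨by linarith, by linarith [sq_nonneg l]⟩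
  have hedges := numEdges_comparison (τ := 0) (zero_le_one.trans hl) hY (by simpa using hcomp)
  exact ⟨Y, hiso, numEdges_sub_le_of_comparison hk hl
    (Real.one_le_sqrt.2 (by exact_mod_cast hn)) hsqrt_le (hcard.trans hsqrt.ge) (hcard.trans hnl)
    (by simpa using hedges), hY⟩

theorem SPEX_subset_of_walkSum_le (hk : 1 ≤ k)
    (hex : (fun n : ℕ => (ex F n : ℝ)) =O[atTop] (fun n : ℕ => (n : ℝ)))
    (hK : ¬ FamilyFree F (completeBipartiteGraph (Fin (k + 1)) ℕ)) (hF : F.Finite)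
    {X : ∀ n : ℕ, SimpleGraph (Fin (n - k))}
    (hX : ∀ᶠ n : ℕ in atTop,
      MemUpToIso (cliqueJoin k (X n)) (EXContaining (Kbip k (n - k)) F n))
    (hwalk : ∀ D : ℕ, ∃ K : ℝ, ∀ᶠ n : ℕ in atTop, (∀ v, deg (X n) v ≤ D) →
      FamilyFree F (cliqueJoin k (X n)) → ∀ Y : SimpleGraph (Fin (n - k)), (∀ v, deg Y v ≤ D) →
      FamilyFree F (cliqueJoin k Y) → numEdges Y ≤ numEdges (X n) →
      walkSum Y 2 ≤ walkSum (X n) 2 + K ∧ walkSum Y 3 ≤ walkSum (X n) 3 + K) :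
    ∀ᶠ n : ℕ in atTop, SPEX F n ⊆ EXContaining (cliqueJoinEmpty k n) F n := by
  obtain ⟨D, hD⟩ := exists_degree_bound_and_join hk hex hK hF
  obtain ⟨K, hK⟩ := hwalk D
  filter_upwards [hD X hX (2 * k * |K| + D ^ 4 + 1), hK, hX] with n ⟨hXdeg, hSPEX⟩ hwalk
    hmem G hG
  obtain ⟨Y, ⟨e⟩, hY, l, hlarge, hl, -, hcomp⟩ := hSPEX G hG
  have hbip (Z : SimpleGraph (Fin (n - k))) : (Kbip k (n - k)).IsContained (cliqueJoin k Z) :=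
    SimpleGraph.IsContained.of_le (completeBipartiteGraph_le_graphJoin _ _)
  have hempty : (cliqueJoinEmpty k n).IsContained G :=
    (SimpleGraph.IsContained.of_le (graphJoin_mono le_rfl bot_le)).trans e.symm.isContained
  have hmax {G'} (hG' : FamilyFree F G') (hcontains : (Kbip k (n - k)).IsContained G') :
      numEdges G' ≤ numEdges (cliqueJoin k (X n)) :=
    hmem.numEdges_le (Fintype.card_fin n) hG' hcontains
  have hYX : numEdges Y ≤ numEdges (X n) := by
    have hle := numEdges_congr e ▸ hmax hG.1 ((hbip Y).trans e.symm.isContained)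
    simp only [cliqueJoin, numEdges_graphJoin] at hle
    omega
  have hXfree : FamilyFree F (cliqueJoin k (X n)) := by
    obtain ⟨H, hH, ⟨e'⟩⟩ := hmem
    exact (FamilyFree.congr e').1 hH.1.1
  obtain ⟨htwo, hthree⟩ := hwalk hXdeg hXfree Y hY ((FamilyFree.congr e).1 hG.1) hYX
  have hXY : numEdges (X n) ≤ numEdges Y :=
    numEdges_le_of_walkPoly_comparison hk hl (abs_nonneg K) (by linarith)
      (htwo.trans (by gcongr; exact le_abs_self K))
      (hthree.trans (by gcongr; exact le_abs_self K)) hcomp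
  refine ⟨⟨hG.1, hempty⟩, fun G' hG' hcontains => (hmax hG' ((hbip ⊥).trans hcontains)).trans ?_⟩
  simp only [numEdges_congr e, cliqueJoin, numEdges_graphJoin]
  omega

end FiniteFamily

section Packing

variable {F : GraphFamily} {k : ℕ} {V W τ : Type*} {T : SimpleGraph τ}

lemma exists_isContained_graphJoin_copies_fin [Finite V] {B : SimpleGraph V} {A : SimpleGraph W}
    (h : B.IsContained (graphJoin A (copies ℕ T))) :
    ∃ t : ℕ, B.IsContained (graphJoin A (copies (Fin t) T)) := by
  obtain ⟨f⟩ := h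
  have := Fintype.ofFinite V
  let copyIndex : W ⊕ ℕ × τ → ℕ := Sum.elim (fun _ => 0) Prod.fst
  obtain ⟨t, ht⟩ : ∃ t, ∀ v, copyIndex (f v) < t + 1 :=
    ⟨Finset.univ.sup fun v => copyIndex (f v), fun v =>
      Nat.lt_succ_of_le (Finset.le_sup (f := fun v => copyIndex (f v)) (Finset.mem_univ v))⟩
  let retract : graphJoin A (copies ℕ T) →g graphJoin A (copies (Fin (t + 1)) T) :=
    { toFun := Sum.map id (Prod.map (Fin.ofNat (t + 1)) id)
      map_rel' := by
        rintro (u | u) (v | v) huv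
        · simpa using huv
        · simp
        · simp
        · obtain ⟨hcopy, hadj⟩ := graphJoin_inr_inr.1 huv
          exact graphJoin_inr_inr.2 ⟨congrArg (Fin.ofNat (t + 1)) hcopy, hadj⟩ }
  have hretract (v) : Sum.map id (Prod.map Fin.val id) (retract (f v)) = f v := by
    have hv := ht v
    rcases hfv : f v with w | ⟨i, a⟩
    · rfl
    · rw [hfv] at hv
      exact congrArg (fun j => Sum.inr (j, a)) (Nat.mod_eq_of_lt hv)
  refine ⟨t + 1, ⟨⟨retract.comp f.toHom, fun u v huv => f.injective ?_⟩⟩⟩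
  change f u = f v
  rw [← hretract u, ← hretract v]
  exact congrArg _ huv

lemma isContained_copies_of_disjoint {ι : Type*} {Y : SimpleGraph W} (f : ι → T.Copy Y)
    (hf : ∀ i j, i ≠ j → ∀ u v, f i u ≠ f j v) : (copies ι T).IsContained Y := by
  refine ⟨⟨⟨fun p => f p.1 p.2, ?_⟩, ?_⟩⟩
  · rintro ⟨i, u⟩ ⟨_, v⟩ ⟨rfl, huv⟩
    exact (f i).toHom.map_adj huv
  · rintro ⟨i, u⟩ ⟨j, v⟩ huv
    obtain rfl : i = j := by_contra fun hij => hf i j hij u v huv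
    exact congrArg (Prod.mk i) ((f i).injective huv)

lemma exists_transversal_of_not_isContained_copies [Fintype τ] {Y : SimpleGraph W}
    {t : ℕ} (h : ¬ (copies (Fin t) T).IsContained Y) :
    ∃ U : Finset W, U.card ≤ t * Fintype.card τ ∧ ∀ f : T.Copy Y, ∃ i, f i ∈ U := by
  classical
  obtain ⟨s, hst, f, -, hmax⟩ : ∃ s ≤ t, ∃ f : Fin s → T.Copy Y,
      (∀ i j, i ≠ j → ∀ u v, f i u ≠ f j v) ∧ ∀ g : T.Copy Y, ∃ i v w, f i v = g w := by
    by_contra! hext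
    have (s) (hs : s ≤ t) :
        ∃ f : Fin s → T.Copy Y, ∀ i j, i ≠ j → ∀ u v, f i u ≠ f j v := by
      induction s with
      | zero => exact ⟨Fin.elim0, fun i => i.elim0⟩
      | succ s ih =>
        obtain ⟨f, hf⟩ := ih (by omega)
        obtain ⟨g, hg⟩ := hext s (by omega) f hf
        refine ⟨Fin.cons g f, Fin.cases (Fin.cases (by simp) ?_) fun i => Fin.cases ?_ ?_⟩
        · exact fun j _ u v => (hg j v u).symm
        · exact fun _ u v => hg i u v
        · exact fun j hij => hf i j fun h => hij (congrArg Fin.succ h)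
    obtain ⟨f, hf⟩ := this t le_rfl
    exact h (isContained_copies_of_disjoint f hf)
  refine ⟨Finset.univ.image fun p : Fin s × τ => f p.1 p.2, ?_, fun g => ?_⟩
  · refine Finset.card_image_le.trans ?_
    simpa using Nat.mul_le_mul_right _ hst
  · obtain ⟨i, v, w, hvw⟩ := hmax g
    exact ⟨w, Finset.mem_image.2 ⟨(i, v), Finset.mem_univ _, hvw⟩⟩

lemma exists_transversal {τ : Type} [Finite τ] {T : SimpleGraph τ}
    (h : ¬ FamilyFree F (cliqueJoin k (copies ℕ T))) :
    ∃ c : ℕ, ∀ (W : Type) (Y : SimpleGraph W), FamilyFree F (cliqueJoin k Y) →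
      ∃ U : Finset W, U.card ≤ c ∧ ∀ f : T.Copy Y, ∃ i, f i ∈ U := by
  unfold FamilyFree at h
  push Not at h
  obtain ⟨A, hA, hAT⟩ := h
  obtain ⟨t, ht⟩ := exists_isContained_graphJoin_copies_fin hAT
  have := Fintype.ofFinite τ
  exact ⟨t * Fintype.card τ, fun _ Y hY => exists_transversal_of_not_isContained_copies
    fun hc => hY A hA (ht.trans (graphJoin_isContained (.refl _) hc))⟩

lemma numEdges_copies {ι : Type*} [Fintype ι] [Finite τ] (T : SimpleGraph τ) :
    numEdges (copies ι T) = Fintype.card ι * numEdges T := by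
  classical
  have := Fintype.ofFinite τ
  have hadj (i j : ι) (u v : τ) :
      adjInd (copies ι T) (i, u) (j, v) = if i = j then adjInd T u v else 0 := by
    split_ifs with hij
    · exact adjInd_congr ⟨fun h => h.2, fun h => ⟨hij, h⟩⟩
    · exact adjInd_of_not_adj fun h => hij h.1
  have hrow (i : ι) (u : τ) :
      ∑ j : ι, ∑ v, (if i = j then adjInd T u v else 0) = ∑ v, adjInd T u v := by
    rw [Finset.sum_comm]
    simp
  have hsum := sum_sum_adjInd (copies ι T)
  simp only [Fintype.sum_prod_type, hadj, hrow, sum_sum_adjInd, Finset.sum_const,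
    Finset.card_univ, nsmul_eq_mul] at hsum
  have : (numEdges (copies ι T) : ℝ) = Fintype.card ι * numEdges T := by linarith
  exact_mod_cast this

lemma exists_packing [Fintype τ] [Nonempty τ] (T : SimpleGraph τ) (N : ℕ) :
    ∃ Z : SimpleGraph (Fin N), Z.IsContained (copies ℕ T) ∧
      (copies (Fin (N / Fintype.card τ)) T).IsContained Z := by
  let ψ : ℕ ≃ ℕ × τ := (Nat.divModEquiv (Fintype.card τ)).trans
    ((Equiv.refl ℕ).prodCongr (Fintype.equivFin τ).symm)
  let inclusion : Fin N ↪ ℕ × τ := Fin.valEmbedding.trans ψ.toEmbedding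
  have hlt (p : Fin (N / Fintype.card τ) × τ) : ψ.symm (p.1, p.2) < N :=
    calc (p.1 : ℕ) * Fintype.card τ + Fintype.equivFin τ p.2
        < (p.1 + 1) * Fintype.card τ := by
          rw [add_one_mul]
          exact Nat.add_lt_add_left (Fintype.equivFin τ p.2).2 _
      _ ≤ N / Fintype.card τ * Fintype.card τ := Nat.mul_le_mul_right _ p.1.2
      _ ≤ N := Nat.div_mul_le_self _ _
  have hψ (p) : inclusion ⟨ψ.symm (p.1, p.2), hlt p⟩ = ((p.1 : ℕ), p.2) :=
    ψ.apply_symm_apply _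
  refine ⟨(copies ℕ T).comap inclusion,
    (SimpleGraph.Embedding.comap inclusion _).isContained,
    ⟨⟨⟨fun p => ⟨ψ.symm (p.1, p.2), hlt p⟩, fun {p q} hpq => ?_⟩, fun p q hpq => ?_⟩⟩⟩
  · rw [SimpleGraph.comap_adj, hψ, hψ]
    exact ⟨congrArg Fin.val hpq.1, hpq.2⟩
  · have := congrArg inclusion hpq
    change inclusion ⟨_, hlt p⟩ = inclusion ⟨_, hlt q⟩ at this
    rw [hψ, hψ, Prod.mk.injEq] at this
    exact Prod.ext (Fin.ext this.1) this.2

lemma mul_le_numEdges_of_free_copies [Fintype τ] [Nonempty τ] {n : ℕ}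
    (h : FamilyFree F (cliqueJoin k (copies ℕ T))) (hkn : k ≤ n) {X : SimpleGraph (Fin (n - k))}
    (hX : MemUpToIso (cliqueJoin k X) (EXContaining (Kbip k (n - k)) F n)) :
    (n - k) / Fintype.card τ * numEdges T ≤ numEdges X := by
  obtain ⟨Z, hZT, hTZ⟩ := exists_packing T (n - k)
  have hZX := hX.numEdges_le (G := cliqueJoin k Z) (by simp [hkn])
    (h.of_isContained (graphJoin_isContained (.refl _) hZT))
    (.of_le (completeBipartiteGraph_le_graphJoin _ _))
  simp only [cliqueJoin, numEdges_graphJoin] at hZX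
  have hTZ := numEdges_le_of_isContained hTZ
  rw [numEdges_copies, Fintype.card_fin] at hTZ
  omega

end Packing

section EdgeTypes

variable {W : Type*} {X Y : SimpleGraph W} {D : ℕ} {N N' U U' : Finset W} {u v : W}

lemma exists_adj_ne (hu : 2 ≤ deg Y u) (v : W) : ∃ a, Y.Adj u a ∧ a ≠ v :=
  Set.exists_ne_of_one_lt_ncard hu v

lemma one_le_deg_of_adj [Finite W] (h : Y.Adj u v) : 1 ≤ deg Y u :=
  (Set.ncard_pos (Set.toFinite _)).2 ⟨v, h⟩

lemma eq_of_adj_of_deg_eq_one {w : W} (hu : deg Y u = 1) (hv : Y.Adj u v) (hw : Y.Adj u w) :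
    v = w := by
  obtain ⟨a, ha⟩ := Set.ncard_eq_one.1 hu
  have hsubsingleton : (Y.neighborSet u).Subsingleton := ha ▸ Set.subsingleton_singleton
  exact hsubsingleton hv hw

lemma exists_copy_top_three {a b c : W} (hab : Y.Adj a b) (hac : Y.Adj a c) (hbc : Y.Adj b c) :
    ∃ f : (⊤ : SimpleGraph (Fin 3)).Copy Y, ⇑f = ![a, b, c] := by
  refine ⟨⟨⟨![a, b, c], fun {i j} hij => ?_⟩, fun i j hij => ?_⟩, rfl⟩
  · fin_cases i <;> fin_cases j <;> simp [hab, hac, hbc, hab.symm, hac.symm, hbc.symm] at hij ⊢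
  · fin_cases i <;> fin_cases j <;>
      simp [hab.ne, hac.ne, hbc.ne, hab.ne', hac.ne', hbc.ne'] at hij ⊢

lemma exists_copy_pathGraph_four {a b c d : W} (hab : Y.Adj a b) (hbc : Y.Adj b c)
    (hcd : Y.Adj c d) (hac : a ≠ c) (had : a ≠ d) (hbd : b ≠ d) :
    ∃ f : (SimpleGraph.pathGraph 4).Copy Y, ⇑f = ![a, b, c, d] := by
  refine ⟨⟨⟨![a, b, c, d], fun {i j} hij => ?_⟩, fun i j hij => ?_⟩, rfl⟩
  · rw [SimpleGraph.pathGraph_adj] at hij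
    fin_cases i <;> fin_cases j <;> simp [hab, hbc, hcd, hab.symm, hbc.symm, hcd.symm] at hij ⊢
  · fin_cases i <;> fin_cases j <;>
      simp [hab.ne, hbc.ne, hcd.ne, hab.ne', hbc.ne', hcd.ne', hac, had, hbd, hac.symm, had.symm,
        hbd.symm] at hij ⊢

variable [Fintype W]

lemma sum_adjInd_mul_le_of_nonpos (hD : ∀ v, deg Y v ≤ D) {g : W → W → ℝ} {M : ℝ} (hM : 0 ≤ M)
    (hoff : ∀ u v, Y.Adj u v → u ∉ N → v ∉ N → g u v ≤ 0) (hle : ∀ u v, g u v ≤ M) :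
    ∑ u, ∑ v, adjInd Y u v * g u v ≤ 2 * N.card * D * M := by
  classical
  have hfst : ∑ u, ∑ v, (if u ∈ N then adjInd Y u v else 0) ≤ N.card * D := by
    calc ∑ u, ∑ v, (if u ∈ N then adjInd Y u v else 0)
        = ∑ u ∈ N, (deg Y u : ℝ) := by
          simp only [← sum_adjInd_eq_deg, Finset.sum_ite_irrel, Finset.sum_const_zero,
            Finset.sum_ite_mem, Finset.univ_inter]
      _ ≤ ∑ _u ∈ N, (D : ℝ) := Finset.sum_le_sum fun u _ => by exact_mod_cast hD u
      _ = N.card * D := by rw [Finset.sum_const, nsmul_eq_mul]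
  have hsnd : ∑ u, ∑ v, (if v ∈ N then adjInd Y u v else 0) ≤ N.card * D := by
    rw [Finset.sum_comm]
    simpa only [adjInd_comm] using hfst
  calc ∑ u, ∑ v, adjInd Y u v * g u v
      ≤ ∑ u, ∑ v, ((if u ∈ N then adjInd Y u v else 0)
          + (if v ∈ N then adjInd Y u v else 0)) * M := by
        refine Finset.sum_le_sum fun u _ => Finset.sum_le_sum fun v _ => ?_
        by_cases hY : Y.Adj u v
        · have huv := hle u v
          rw [adjInd_of_adj hY]
          split_ifs with hu hv hv
          · linarith
          · linarith
          · linarith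
          · linarith [hoff u v hY hu hv]
        · simp [adjInd_of_not_adj hY]
    _ = (∑ u, ∑ v, (if u ∈ N then adjInd Y u v else 0)
        + ∑ u, ∑ v, (if v ∈ N then adjInd Y u v else 0)) * M := by
        simp only [← Finset.sum_mul, Finset.sum_add_distrib]
    _ ≤ (N.card * D + N.card * D) * M := by gcongr
    _ = 2 * N.card * D * M := by ring

lemma sum_adjInd_mul_le_add {c : ℕ} (hXD : ∀ v, deg X v ≤ D) (hYD : ∀ v, deg Y v ≤ D)
    (hN : N.card ≤ c) (hN' : N'.card ≤ c) {wX wY : W → W → ℝ} {s M : ℝ} (hs : 0 ≤ s) (hM : 0 ≤ M)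
    (hY : ∀ u v, Y.Adj u v → u ∉ N → v ∉ N → wY u v ≤ s) (hYM : ∀ u v, wY u v ≤ M)
    (hX : ∀ u v, X.Adj u v → u ∉ N' → v ∉ N' → s ≤ wX u v) (hX₀ : ∀ u v, 0 ≤ wX u v)
    (he : numEdges Y ≤ numEdges X) :
    ∑ u, ∑ v, adjInd Y u v * wY u v ≤
      ∑ u, ∑ v, adjInd X u v * wX u v + 2 * c * D * (M + s) := by
  have hYsum := sum_adjInd_mul_le_of_nonpos hYD (N := N) (g := fun u v => wY u v - s) hM
    (fun u v huv hu hv => sub_nonpos.2 (hY u v huv hu hv)) fun u v => by linarith [hYM u v]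
  have hXsum := sum_adjInd_mul_le_of_nonpos hXD (N := N') (g := fun u v => s - wX u v) hs
    (fun u v huv hu hv => sub_nonpos.2 (hX u v huv hu hv)) fun u v => by linarith [hX₀ u v]
  simp only [mul_sub, Finset.sum_sub_distrib, ← Finset.sum_mul, sum_sum_adjInd] at hYsum hXsum
  have : 2 * (N.card : ℝ) * D * M ≤ 2 * c * D * M := by gcongr
  have : 2 * (N'.card : ℝ) * D * s ≤ 2 * c * D * s := by gcongr
  have : 2 * (numEdges Y : ℝ) * s ≤ 2 * numEdges X * s := by gcongr
  linarith

lemma exists_walkSum_le_of_edge_types (D c p q : ℕ) :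
    ∃ K : ℝ, ∀ (W : Type*) [Fintype W] {X Y : SimpleGraph W} {N N' : Finset W},
      (∀ v, deg X v ≤ D) → (∀ v, deg Y v ≤ D) → N.card ≤ c → N'.card ≤ c →
      (∀ u v, Y.Adj u v → u ∉ N → v ∉ N → deg Y u + deg Y v ≤ p ∧ deg Y u * deg Y v ≤ q) →
      (∀ u v, X.Adj u v → u ∉ N' → v ∉ N' → p ≤ deg X u + deg X v ∧ q ≤ deg X u * deg X v) →
      numEdges Y ≤ numEdges X →
      walkSum Y 2 ≤ walkSum X 2 + K ∧ walkSum Y 3 ≤ walkSum X 3 + K := by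
  refine ⟨2 * c * D * (D + D + p + D * D + q), fun W _ X Y N N' hXD hYD hN hN' hY hX he => ?_⟩
  have htwo := sum_adjInd_mul_le_add hXD hYD hN hN' (s := p) (M := D + D)
    (wX := fun u v => deg X u + deg X v) (wY := fun u v => deg Y u + deg Y v)
    (by positivity) (by positivity) (fun u v huv hu hv => by exact_mod_cast (hY u v huv hu hv).1)
    (fun u v => by exact_mod_cast add_le_add (hYD u) (hYD v))
    (fun u v huv hu hv => by exact_mod_cast (hX u v huv hu hv).1) (fun u v => by positivity) he
  have hthree := sum_adjInd_mul_le_add hXD hYD hN hN' (s := q) (M := D * D)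
    (wX := fun u v => deg X u * deg X v) (wY := fun u v => deg Y u * deg Y v)
    (by positivity) (by positivity) (fun u v huv hu hv => by exact_mod_cast (hY u v huv hu hv).2)
    (fun u v => by exact_mod_cast Nat.mul_le_mul (hYD u) (hYD v))
    (fun u v huv hu hv => by exact_mod_cast (hX u v huv hu hv).2) (fun u v => by positivity) he
  rw [← walkSum_two, ← walkSum_two] at htwo
  rw [← walkSum_three, ← walkSum_three] at hthree
  have : (0 : ℝ) ≤ c * D * (D + D + p) := by positivity
  have : (0 : ℝ) ≤ c * D * (D * D + q) := by positivity
  constructor <;> linarith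

open Classical in
/-- The closed neighbourhood of a set of vertices. Vertices outside the closed neighbourhood of a
transversal of all copies of a small graph have no such copy meeting them or their neighbours. -/
noncomputable def closedNeighborFinset (Y : SimpleGraph W) (U : Finset W) : Finset W :=
  U ∪ U.biUnion fun v => Y.neighborFinset v

lemma card_closedNeighborFinset_le {c : ℕ} (hD : ∀ v, deg Y v ≤ D) (hU : U.card ≤ c) :
    (closedNeighborFinset Y U).card ≤ c * (D + 1) := by
  classical
  have hnbrs : (U.biUnion fun v => Y.neighborFinset v).card ≤ U.card * D :=
    Finset.card_biUnion_le_card_mul _ _ _ fun v _ => (card_neighborFinset_eq_deg v).trans_le (hD v)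
  calc (closedNeighborFinset Y U).card
      ≤ U.card + (U.biUnion fun v => Y.neighborFinset v).card := by
        rw [closedNeighborFinset]
        convert Finset.card_union_le _ _
    _ ≤ U.card * (D + 1) := by linarith
    _ ≤ c * (D + 1) := Nat.mul_le_mul_right _ hU

lemma notMem_of_notMem_closedNeighborFinset (hv : v ∉ closedNeighborFinset Y U) :
    v ∉ U ∧ ∀ w, Y.Adj v w → w ∉ U := by
  classical
  refine ⟨fun h => hv (Finset.mem_union_left _ h), fun w hvw hw => hv ?_⟩
  exact Finset.mem_union_right _
    (Finset.mem_biUnion.2 ⟨w, hw, (SimpleGraph.mem_neighborFinset ..).2 hvw.symm⟩)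

lemma deg_le_of_notMem_closedNeighborFinset {d : ℕ}
    (hU : ∀ f : (completeBipartiteGraph (Fin 1) (Fin (d + 1))).Copy Y, ∃ i, f i ∈ U)
    (hv : v ∉ closedNeighborFinset Y U) : deg Y v ≤ d := by
  classical
  by_contra! hdeg
  obtain ⟨hvU, hnbrs⟩ := notMem_of_notMem_closedNeighborFinset hv
  obtain ⟨g⟩ : Nonempty (Fin (d + 1) ↪ Y.neighborFinset v) :=
    Function.Embedding.nonempty_of_card_le (by
      rw [Fintype.card_fin, Fintype.card_coe, card_neighborFinset_eq_deg]
      exact hdeg)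
  have hg (i) : Y.Adj v (g i) := (SimpleGraph.mem_neighborFinset ..).1 (g i).2
  let star : Fin 1 ⊕ Fin (d + 1) → W := Sum.elim (fun _ => v) fun i => g i
  obtain ⟨i, hi⟩ := hU ⟨⟨star, by
      rintro (a | a) (b | b) hab
      · simp at hab
      · exact hg b
      · exact (hg a).symm
      · simp at hab⟩, by
      rintro (a | a) (b | b) hab
      · rw [Subsingleton.elim a b]
      · exact absurd hab (hg b).ne
      · exact absurd hab.symm (hg a).ne
      · exact congrArg Sum.inr (g.injective (Subtype.ext hab))⟩
  rcases i with i | i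
  · exact hvU hi
  · exact hnbrs _ (hg i) hi

lemma deg_le_one_or_deg_le_one_of_notMem_closedNeighborFinset
    (hU : ∀ f : (SimpleGraph.pathGraph 4).Copy Y, ∃ i, f i ∈ U)
    (hU' : ∀ f : (⊤ : SimpleGraph (Fin 3)).Copy Y, ∃ i, f i ∈ U') (huv : Y.Adj u v)
    (hu : u ∉ closedNeighborFinset Y U) (hv : v ∉ closedNeighborFinset Y U)
    (hu' : u ∉ closedNeighborFinset Y U') (hv' : v ∉ U') : deg Y u ≤ 1 ∨ deg Y v ≤ 1 := by
  by_contra! ⟨hdu, hdv⟩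
  obtain ⟨a, hua, hav⟩ := exists_adj_ne hdu v
  obtain ⟨b, hvb, hbu⟩ := exists_adj_ne hdv u
  obtain ⟨huU, hu_nbrs⟩ := notMem_of_notMem_closedNeighborFinset hu
  obtain ⟨hvU, hv_nbrs⟩ := notMem_of_notMem_closedNeighborFinset hv
  obtain ⟨huU', hu_nbrs'⟩ := notMem_of_notMem_closedNeighborFinset hu'
  obtain rfl | hab := eq_or_ne a b
  · obtain ⟨f, hf⟩ := exists_copy_top_three huv hua hvb
    obtain ⟨i, hi⟩ := hU' f
    rw [hf] at hi
    fin_cases i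
    exacts [huU' hi, hv' hi, hu_nbrs' _ hua hi]
  · obtain ⟨f, hf⟩ := exists_copy_pathGraph_four hua.symm huv hvb hav hab hbu.symm
    obtain ⟨i, hi⟩ := hU f
    rw [hf] at hi
    fin_cases i
    exacts [hu_nbrs _ hua hi, huU hi, hvU hi, hv_nbrs _ hvb hi]

open Classical in
/-- The ends outside `N` of the edges of `X` that are components of `X` and avoid `N`. -/
noncomputable def isolatedEdgeEnds (X : SimpleGraph W) (N : Finset W) : Finset W :=
  {u | u ∉ N ∧ ∃ v ∉ N, X.Adj u v ∧ deg X u = 1 ∧ deg X v = 1}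

lemma mem_isolatedEdgeEnds :
    u ∈ isolatedEdgeEnds X N ↔ u ∉ N ∧ ∃ v ∉ N, X.Adj u v ∧ deg X u = 1 ∧ deg X v = 1 := by
  simp [isolatedEdgeEnds]

lemma sum_adjInd_mul_inv_deg_le (X : SimpleGraph W) :
    ∑ u, ∑ v, adjInd X u v * (deg X u : ℝ)⁻¹ ≤ Fintype.card W := by
  calc ∑ u, ∑ v, adjInd X u v * (deg X u : ℝ)⁻¹ ≤ ∑ _u : W, (1 : ℝ) := by
        refine Finset.sum_le_sum fun u _ => ?_
        rw [← Finset.sum_mul, sum_adjInd_eq_deg]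
        exact mul_inv_le_one
    _ = Fintype.card W := by simp

open Classical in
lemma sum_adjInd_mul_indicator_isolatedEdgeEnds (X : SimpleGraph W) (N : Finset W) (c : ℝ) :
    ∑ u, ∑ v, adjInd X u v * (if u ∈ isolatedEdgeEnds X N then c else 0) =
      (isolatedEdgeEnds X N).card * c := by
  have hrow (u : W) : ∑ v, adjInd X u v * (if u ∈ isolatedEdgeEnds X N then c else 0) =
      if u ∈ isolatedEdgeEnds X N then c else 0 := by
    rw [← Finset.sum_mul, sum_adjInd_eq_deg]
    split_ifs with hu
    · obtain ⟨-, v, -, -, hdeg, -⟩ := mem_isolatedEdgeEnds.1 hu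
      rw [hdeg, Nat.cast_one, one_mul]
    · exact mul_zero _
  simp only [hrow, Finset.sum_ite_mem, Finset.univ_inter, Finset.sum_const, nsmul_eq_mul]

open Classical in
lemma add_indicator_isolatedEdgeEnds_le (huv : X.Adj u v) (hsum : deg X u + deg X v ≤ 3) :
    3 / 2 + (if u ∈ isolatedEdgeEnds X N then (1 / 2 : ℝ) else 0) ≤
      (deg X u : ℝ)⁻¹ + (deg X v : ℝ)⁻¹ := by
  have hu := one_le_deg_of_adj huv
  have hv := one_le_deg_of_adj huv.symm
  by_cases hmem : u ∈ isolatedEdgeEnds X N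
  · obtain ⟨-, w, -, huw, hdu, hdw⟩ := mem_isolatedEdgeEnds.1 hmem
    obtain rfl := eq_of_adj_of_deg_eq_one hdu huw huv
    rw [hdu, hdw, if_pos hmem]
    norm_num
  · rw [if_neg hmem]
    obtain h | h | h : (deg X u = 1 ∧ deg X v = 1) ∨ (deg X u = 1 ∧ deg X v = 2) ∨
        (deg X u = 2 ∧ deg X v = 1) := by omega
    all_goals rw [h.1, h.2]; norm_num

/-- Discharging: an edge `uv` receives `1 / deg u + 1 / deg v`, in total at most `2 |W|`. Off `N`
this is at least `3 / 2`, and it is `2` on isolated edges. -/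
lemma card_isolatedEdgeEnds_le (hD : ∀ v, deg X v ≤ D)
    (hN : ∀ u v, X.Adj u v → u ∉ N → v ∉ N → deg X u + deg X v ≤ 3) :
    3 * (numEdges X : ℝ) + (isolatedEdgeEnds X N).card / 2 ≤
      2 * Fintype.card W + 4 * N.card * D := by
  classical
  have hfst := sum_adjInd_mul_inv_deg_le X
  have hsnd : ∑ u, ∑ v, adjInd X u v * (deg X v : ℝ)⁻¹ ≤ Fintype.card W := by
    rw [Finset.sum_comm]
    simpa only [adjInd_comm] using hfst
  have hdischarge := sum_adjInd_mul_le_of_nonpos hD (N := N) (M := 2)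
    (g := fun u v => 3 / 2 + (if u ∈ isolatedEdgeEnds X N then (1 / 2 : ℝ) else 0) -
      ((deg X u : ℝ)⁻¹ + (deg X v : ℝ)⁻¹)) (by norm_num)
    (fun u v huv hu hv => sub_nonpos.2 (add_indicator_isolatedEdgeEnds_le huv (hN u v huv hu hv)))
    (fun u v => by
      have : 0 ≤ (deg X u : ℝ)⁻¹ + (deg X v : ℝ)⁻¹ := by positivity
      split_ifs <;> linarith)
  simp only [mul_sub, mul_add, Finset.sum_sub_distrib, Finset.sum_add_distrib,
    sum_adjInd_mul_indicator_isolatedEdgeEnds, ← Finset.sum_mul (Finset.univ) _ (3 / 2 : ℝ),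
    sum_sum_adjInd] at hdischarge
  linarith

end EdgeTypes

section SmallTrees

variable {F : GraphFamily} {k : ℕ} {X : ∀ n : ℕ, SimpleGraph (Fin (n - k))} {Q : ℝ}

lemma exists_deg_le_off {d : ℕ} (h : ¬ FamilyFree F (cliqueJoin k
      (copies ℕ (completeBipartiteGraph (Fin 1) (Fin (d + 1)))))) :
    ∃ c : ℕ, ∀ (W : Type) [Finite W] (Y : SimpleGraph W) (D : ℕ), FamilyFree F (cliqueJoin k Y) →
      (∀ v, deg Y v ≤ D) → ∃ N : Finset W, N.card ≤ c * (D + 1) ∧ ∀ v ∉ N, deg Y v ≤ d := by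
  obtain ⟨c, hc⟩ := exists_transversal h
  refine ⟨c, fun W _ Y D hY hD => ?_⟩
  have := Fintype.ofFinite W
  obtain ⟨U, hUc, hU⟩ := hc W Y hY
  exact ⟨closedNeighborFinset Y U, card_closedNeighborFinset_le hD hUc,
    fun v hv => deg_le_of_notMem_closedNeighborFinset hU hv⟩

lemma exists_edge_types_off
    (hstar : ¬ FamilyFree F (cliqueJoin k (copies ℕ (completeBipartiteGraph (Fin 1) (Fin 3)))))
    (hpath : ¬ FamilyFree F (cliqueJoin k (copies ℕ (SimpleGraph.pathGraph 4))))
    (htriangle : ¬ FamilyFree F (cliqueJoin k (copies ℕ (⊤ : SimpleGraph (Fin 3))))) :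
    ∃ c : ℕ, ∀ (W : Type) [Finite W] (Y : SimpleGraph W) (D : ℕ), FamilyFree F (cliqueJoin k Y) →
      (∀ v, deg Y v ≤ D) → ∃ N : Finset W, N.card ≤ c * (D + 1) ∧
        ∀ u v, Y.Adj u v → u ∉ N → v ∉ N → deg Y u + deg Y v ≤ 3 ∧ deg Y u * deg Y v ≤ 2 := by
  classical
  obtain ⟨c₁, hc₁⟩ := exists_deg_le_off (d := 2) hstar
  obtain ⟨c₂, hc₂⟩ := exists_transversal hpath
  obtain ⟨c₃, hc₃⟩ := exists_transversal htriangle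
  refine ⟨c₁ + c₂ + c₃, fun W _ Y D hY hD => ?_⟩
  have := Fintype.ofFinite W
  obtain ⟨N, hNc, hN⟩ := hc₁ W Y D hY hD
  obtain ⟨U, hUc, hU⟩ := hc₂ W Y hY
  obtain ⟨U', hUc', hU'⟩ := hc₃ W Y hY
  refine ⟨N ∪ closedNeighborFinset Y U ∪ closedNeighborFinset Y U', ?_, fun u v huv hu hv => ?_⟩
  · calc (N ∪ closedNeighborFinset Y U ∪ closedNeighborFinset Y U').card
        ≤ N.card + (closedNeighborFinset Y U).card + (closedNeighborFinset Y U').card :=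
          (Finset.card_union_le _ _).trans (Nat.add_le_add_right (Finset.card_union_le _ _) _)
      _ ≤ c₁ * (D + 1) + c₂ * (D + 1) + c₃ * (D + 1) :=
          add_le_add_three hNc (card_closedNeighborFinset_le hD hUc)
            (card_closedNeighborFinset_le hD hUc')
      _ = (c₁ + c₂ + c₃) * (D + 1) := by ring
  · simp only [Finset.mem_union, not_or] at hu hv
    obtain ⟨⟨huN, huU⟩, huU'⟩ := hu
    obtain ⟨⟨hvN, hvU⟩, hvU'⟩ := hv
    have hu2 := hN u huN
    have hv2 := hN v hvN
    obtain h | h := deg_le_one_or_deg_le_one_of_notMem_closedNeighborFinset hU hU' huv huU hvU huU'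
      (notMem_of_notMem_closedNeighborFinset hvU').1
    · exact ⟨by omega, Nat.mul_le_mul h hv2⟩
    · exact ⟨by omega, Nat.mul_le_mul hu2 h⟩

lemma not_free_copies_of_sparse (hQ : Q < 3 / 4) (hX : JoinExtremal F k X Q) {τ : Type}
    [Fintype τ] [Nonempty τ] {T : SimpleGraph τ} (hτ : Fintype.card τ ≤ 4)
    (hT : 3 ≤ numEdges T) : ¬ FamilyFree F (cliqueJoin k (copies ℕ T)) := by
  intro hfree
  obtain ⟨hJ, C, hC⟩ := hX
  have hlim : Tendsto (fun n : ℕ => (3 / 4 - Q) * (n : ℝ)) atTop atTop :=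
    tendsto_natCast_atTop_atTop.const_mul_atTop (by linarith)
  obtain ⟨n, hmem, hsparse, hlarge, hkn⟩ := (hJ.and (hC.and ((hlim.eventually_gt_atTop
    (C + 3 * (k + 3) / 4)).and (eventually_ge_atTop k)))).exists
  have hpacking : (n - k) / 4 * 3 ≤ numEdges (X n) :=
    (Nat.mul_le_mul (Nat.div_le_div_left hτ Fintype.card_pos) hT).trans
      (mul_le_numEdges_of_free_copies hfree hkn hmem)
  have hdense : 3 * n ≤ 4 * numEdges (X n) + 3 * (k + 3) := by omega
  have : 3 * (n : ℝ) ≤ 4 * numEdges (X n) + 3 * (k + 3) := by exact_mod_cast hdense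
  linarith

lemma numEdges_pathGraph_four : numEdges (SimpleGraph.pathGraph 4) = 3 := by
  have hsum := sum_sum_adjInd (SimpleGraph.pathGraph 4)
  have hadj (u v : Fin 4) : adjInd (SimpleGraph.pathGraph 4) u v =
      if (u : ℕ) + 1 = v ∨ (v : ℕ) + 1 = u then 1 else 0 := by
    simp only [adjInd, SimpleGraph.pathGraph_adj]
  have : (numEdges (SimpleGraph.pathGraph 4) : ℝ) = 3 := by
    norm_num [hadj, Fin.sum_univ_four, show (3 : Fin 4) ≠ 0 by decide, -Finset.sum_boole] at hsum
    linarith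
  exact_mod_cast this

lemma numEdges_top_fin_three : numEdges (⊤ : SimpleGraph (Fin 3)) = 3 := by
  have hsum := two_mul_numEdges_top (Fin 3)
  norm_num at hsum
  have : (numEdges (⊤ : SimpleGraph (Fin 3)) : ℝ) = 3 := by linarith
  exact_mod_cast this

theorem SPEX_subset_of_almost_regular (hk : 1 ≤ k)
    (hex : (fun n : ℕ => (ex F n : ℝ)) =O[atTop] (fun n : ℕ => (n : ℝ)))
    (hK : ¬ FamilyFree F (completeBipartiteGraph (Fin (k + 1)) ℕ)) (hF : F.Finite)
    (hX : ∀ᶠ n : ℕ in atTop,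
      MemUpToIso (cliqueJoin k (X n)) (EXContaining (Kbip k (n - k)) F n)) {d : ℕ}
    (hB : ∃ B : ℕ, ∀ᶠ n : ℕ in atTop, {v | deg (X n) v ≠ d}.ncard ≤ B)
    (hstar : ¬ FamilyFree F (cliqueJoin k
      (copies ℕ (completeBipartiteGraph (Fin 1) (Fin (d + 1)))))) :
    ∀ᶠ n : ℕ in atTop, SPEX F n ⊆ EXContaining (cliqueJoinEmpty k n) F n := by
  classical
  obtain ⟨B, hB⟩ := hB
  obtain ⟨c, hc⟩ := exists_deg_le_off hstar
  refine SPEX_subset_of_walkSum_le hk hex hK hF hX fun D => ?_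
  obtain ⟨K, hwalk⟩ := exists_walkSum_le_of_edge_types D (c * (D + 1) + B) (d + d) (d * d)
  refine ⟨K, ?_⟩
  filter_upwards [hB] with n hn hXD _ Y hYD hY he
  obtain ⟨N, hNc, hN⟩ := hc _ Y D hY hYD
  refine hwalk _ (N' := {v | deg (X n) v ≠ d}) hXD hYD (hNc.trans (Nat.le_add_right _ _))
    ?_ ?_ ?_ he
  · rw [← Set.ncard_coe_finset, Finset.coe_filter_univ]
    exact hn.trans (Nat.le_add_left _ _)
  · intro u v _ hu hv
    exact ⟨add_le_add (hN u hu) (hN v hv), Nat.mul_le_mul (hN u hu) (hN v hv)⟩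
  · intro u v _ hu hv
    simp only [Finset.mem_filter_univ, not_not] at hu hv
    rw [hu, hv]
    exact ⟨le_rfl, le_rfl⟩

/-- If `K_k + ∞ · K_{1,2}` is not free, then almost every edge of `Y` is isolated. -/
lemma exists_walkSum_le_of_not_free_cherries
    (hcherry : ¬ FamilyFree F (cliqueJoin k (copies ℕ (Kbip 1 2)))) (D : ℕ) :
    ∃ K : ℝ, ∀ (W : Type) [Fintype W] (X Y : SimpleGraph W), (∀ v, deg X v ≤ D) →
      (∀ v, deg Y v ≤ D) → FamilyFree F (cliqueJoin k Y) → numEdges Y ≤ numEdges X →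
      walkSum Y 2 ≤ walkSum X 2 + K ∧ walkSum Y 3 ≤ walkSum X 3 + K := by
  obtain ⟨c, hc⟩ := exists_deg_le_off (d := 1) hcherry
  obtain ⟨K, hwalk⟩ := exists_walkSum_le_of_edge_types D (c * (D + 1)) 2 1
  refine ⟨K, fun W _ X Y hXD hYD hY he => ?_⟩
  obtain ⟨N, hNc, hN⟩ := hc _ Y D hY hYD
  refine hwalk W (N' := ∅) hXD hYD hNc (by simp) ?_ ?_ he
  · intro u v _ hu hv
    exact ⟨add_le_add (hN u hu) (hN v hv), Nat.mul_le_mul (hN u hu) (hN v hv)⟩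
  · intro u v huv _ _
    have hu := one_le_deg_of_adj huv
    have hv := one_le_deg_of_adj huv.symm
    exact ⟨add_le_add hu hv, Nat.mul_le_mul hu hv⟩

lemma card_isolatedEdgeEnds_le_of_free_cherries {n D : ℕ} {X : SimpleGraph (Fin (n - k))}
    {N : Finset (Fin (n - k))} (hcherry : FamilyFree F (cliqueJoin k (copies ℕ (Kbip 1 2))))
    (hkn : k ≤ n) (hX : MemUpToIso (cliqueJoin k X) (EXContaining (Kbip k (n - k)) F n))
    (hD : ∀ v, deg X v ≤ D)
    (hN : ∀ u v, X.Adj u v → u ∉ N → v ∉ N → deg X u + deg X v ≤ 3) :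
    (isolatedEdgeEnds X N).card ≤ 8 * N.card * D + 8 := by
  have hpacking := mul_le_numEdges_of_free_copies hcherry hkn hX
  simp only [numEdges_Kbip, Fintype.card_sum, Fintype.card_fin] at hpacking
  have hedges : 2 * (n - k) ≤ 3 * numEdges X + 4 := by omega
  have : 2 * ((n - k : ℕ) : ℝ) ≤ 3 * numEdges X + 4 := by exact_mod_cast hedges
  have hends := card_isolatedEdgeEnds_le hD hN
  rw [Fintype.card_fin] at hends
  rify
  linarith

/-- If `K_k + ∞ · K_{1,2}` is free, then almost every edge of `X` lies in a component `K_{1,2}`. -/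
lemma exists_walkSum_le_of_free_cherries
    (hcherry : FamilyFree F (cliqueJoin k (copies ℕ (Kbip 1 2))))
    (hstar : ¬ FamilyFree F (cliqueJoin k (copies ℕ (Kbip 1 3))))
    (hpath : ¬ FamilyFree F (cliqueJoin k (copies ℕ (SimpleGraph.pathGraph 4))))
    (htriangle : ¬ FamilyFree F (cliqueJoin k (copies ℕ (⊤ : SimpleGraph (Fin 3))))) (D : ℕ) :
    ∃ K : ℝ, ∀ (n : ℕ) (X Y : SimpleGraph (Fin (n - k))), k ≤ n →
      MemUpToIso (cliqueJoin k X) (EXContaining (Kbip k (n - k)) F n) →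
      (∀ v, deg X v ≤ D) → FamilyFree F (cliqueJoin k X) →
      (∀ v, deg Y v ≤ D) → FamilyFree F (cliqueJoin k Y) → numEdges Y ≤ numEdges X →
      walkSum Y 2 ≤ walkSum X 2 + K ∧ walkSum Y 3 ≤ walkSum X 3 + K := by
  classical
  obtain ⟨c, hc⟩ := exists_edge_types_off hstar hpath htriangle
  obtain ⟨K, hwalk⟩ :=
    exists_walkSum_le_of_edge_types D (c * (D + 1) + (8 * (c * (D + 1)) * D + 8)) 3 2
  refine ⟨K, fun n X Y hkn hmem hXD hXfree hYD hY he => ?_⟩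
  obtain ⟨N, hNc, hN⟩ := hc _ Y D hY hYD
  obtain ⟨N', hNc', hN'⟩ := hc _ X D hXfree hXD
  have hends := card_isolatedEdgeEnds_le_of_free_cherries hcherry hkn hmem hXD
    fun u v huv hu hv => (hN' u v huv hu hv).1
  refine hwalk _ (N' := N' ∪ isolatedEdgeEnds X N') hXD hYD (hNc.trans (Nat.le_add_right _ _))
    ?_ hN ?_ he
  · calc (N' ∪ isolatedEdgeEnds X N').card ≤ N'.card + (8 * N'.card * D + 8) :=
          (Finset.card_union_le _ _).trans (Nat.add_le_add_left hends _)
      _ ≤ c * (D + 1) + (8 * (c * (D + 1)) * D + 8) := by gcongr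
  · intro u v huv hu hv
    simp only [Finset.mem_union, mem_isolatedEdgeEnds, not_or] at hu hv
    have hu1 := one_le_deg_of_adj huv
    have hv1 := one_le_deg_of_adj huv.symm
    have hnot : ¬ (deg X u = 1 ∧ deg X v = 1) := fun h => hu.2 ⟨hu.1, v, hv.1, huv, h⟩
    obtain h | h : 2 ≤ deg X u ∨ 2 ≤ deg X v := by omega
    · exact ⟨add_le_add h hv1, Nat.mul_le_mul h hv1⟩
    · exact ⟨add_le_add hu1 h, Nat.mul_le_mul hu1 h⟩

theorem SPEX_subset_of_sparse (hk : 1 ≤ k)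
    (hex : (fun n : ℕ => (ex F n : ℝ)) =O[atTop] (fun n : ℕ => (n : ℝ)))
    (hK : ¬ FamilyFree F (completeBipartiteGraph (Fin (k + 1)) ℕ)) (hF : F.Finite)
    (hQ : Q < 3 / 4) (hX : JoinExtremal F k X Q) :
    ∀ᶠ n : ℕ in atTop, SPEX F n ⊆ EXContaining (cliqueJoinEmpty k n) F n := by
  refine SPEX_subset_of_walkSum_le hk hex hK hF hX.1 fun D => ?_
  by_cases hcherry : FamilyFree F (cliqueJoin k (copies ℕ (Kbip 1 2)))
  · obtain ⟨K, hwalk⟩ := exists_walkSum_le_of_free_cherries hcherry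
      (not_free_copies_of_sparse hQ hX (by simp) (numEdges_Kbip 1 3).ge)
      (not_free_copies_of_sparse hQ hX (by simp) numEdges_pathGraph_four.ge)
      (not_free_copies_of_sparse hQ hX (by simp) numEdges_top_fin_three.ge) D
    refine ⟨K, ?_⟩
    filter_upwards [hX.1, eventually_ge_atTop k] with n hmem hkn hXD hXfree Y
    exact hwalk n (X n) Y hkn hmem hXD hXfree
  · obtain ⟨K, hwalk⟩ := exists_walkSum_le_of_not_free_cherries hcherry D
    exact ⟨K, .of_forall fun n hXD _ Y => hwalk _ (X n) Y hXD⟩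

end SmallTrees

end SpectralTuran

theorem theorem1p1 (F : SpectralTuran.GraphFamily) (k : ℕ) (hk : 1 ≤ k)
    (hex : (fun n : ℕ => (SpectralTuran.ex F n : ℝ)) =O[Filter.atTop] (fun n : ℕ => (n : ℝ)))
    (hK : ¬ SpectralTuran.FamilyFree F (completeBipartiteGraph (Fin (k + 1)) ℕ)) :
    -- case (a)
    ((∀ᶠ n : ℕ in Filter.atTop, SpectralTuran.MemUpToIso (SpectralTuran.Kbip k (n - k))
        (SpectralTuran.EXContaining (SpectralTuran.Kbip k (n - k)) F n)) →
      ∀ᶠ n : ℕ in Filter.atTop,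
        SpectralTuran.SPEX F n = SpectralTuran.isoClass (SpectralTuran.Kbip k (n - k)) n) ∧
    -- case (b)
    ((∀ᶠ n : ℕ in Filter.atTop, SpectralTuran.MemUpToIso (SpectralTuran.cliqueJoinEmpty k n)
        (SpectralTuran.EXContaining (SpectralTuran.Kbip k (n - k)) F n)) →
      ∀ᶠ n : ℕ in Filter.atTop,
        SpectralTuran.SPEX F n = SpectralTuran.isoClass (SpectralTuran.cliqueJoinEmpty k n) n) ∧
    -- case (c)
    ((∀ᶠ n : ℕ in Filter.atTop, SpectralTuran.MemUpToIso (SpectralTuran.cliqueJoinEdge k n)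
        (SpectralTuran.EXContaining (SpectralTuran.Kbip k (n - k)) F n)) →
      ∀ᶠ n : ℕ in Filter.atTop,
        SpectralTuran.SPEX F n = SpectralTuran.isoClass (SpectralTuran.cliqueJoinEdge k n) n) ∧
    -- case (d)
    (F.Finite → ∀ (X : ∀ n : ℕ, SimpleGraph (Fin (n - k))) (Q : ℝ), 0 ≤ Q → Q < 3 / 4 →
      SpectralTuran.JoinExtremal F k X Q →
      ∀ᶠ n : ℕ in Filter.atTop, SpectralTuran.SPEX F n ⊆
        SpectralTuran.EXContaining (SpectralTuran.cliqueJoinEmpty k n) F n) ∧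
    -- case (e); the bound `D` on the maximum degree is chosen before `X` and `Q`
    (F.Finite → ∃ D : ℕ, ∀ (X : ∀ n : ℕ, SimpleGraph (Fin (n - k))) (Q : ℝ), 3 / 4 ≤ Q →
      SpectralTuran.JoinExtremal F k X Q →
      ∃ C : ℝ, ∀ᶠ n : ℕ in Filter.atTop, ∀ G ∈ SpectralTuran.SPEX F n,
        ∃ Y : SimpleGraph (Fin (n - k)),
          Nonempty (G ≃g SpectralTuran.cliqueJoin k Y) ∧
          (SpectralTuran.numEdges (X n) : ℝ) - C * Real.sqrt n ≤ SpectralTuran.numEdges Y ∧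
          ∀ v, SpectralTuran.deg Y v ≤ D) ∧
    -- case (f)
    (F.Finite → ∀ (X : ∀ n : ℕ, SimpleGraph (Fin (n - k))) (Q : ℝ), 3 / 4 ≤ Q →
      SpectralTuran.JoinExtremal F k X Q →
      ∀ d : ℕ,
      (∃ B : ℕ, ∀ᶠ n : ℕ in Filter.atTop,
        {v | SpectralTuran.deg (X n) v ≠ d}.ncard ≤ B) →
      ¬ SpectralTuran.FamilyFree F (SpectralTuran.cliqueJoin k
        (SpectralTuran.copies ℕ (completeBipartiteGraph (Fin 1) (Fin (d + 1))))) →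
      ∀ᶠ n : ℕ in Filter.atTop, SpectralTuran.SPEX F n ⊆
        SpectralTuran.EXContaining (SpectralTuran.cliqueJoinEmpty k n) F n) := by
  refine ⟨SpectralTuran.SPEX_eq_Kbip hk hex hK, SpectralTuran.SPEX_eq_cliqueJoinEmpty hk hex hK,
    SpectralTuran.SPEX_eq_cliqueJoinEdge hk hex hK,
    fun hF X Q _ hQ hX => SpectralTuran.SPEX_subset_of_sparse hk hex hK hF hQ hX, fun hF => ?_,
    fun hF X Q _ hX d hB hstar =>
      SpectralTuran.SPEX_subset_of_almost_regular hk hex hK hF hX.1 hB hstar⟩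
  obtain ⟨D, hD⟩ := SpectralTuran.exists_join_of_mem_SPEX hk hex hK hF
  exact ⟨D, fun X Q _ hX => hD X hX.1⟩
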